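/- **Setting.** Let $G=(U\cup W,E)$ be a finite bipartite graph with $m\ge 1$ edges and no isolated vertices, and let $b(v)\ge 1$ be the integer capacity of each vertex (agent) $v$. Each agent has a preference list, which is a linearly ordered list of disjoint nonempty ties (agents in the same tie are equally good, those in an earlier tie are better) that together contain exactly its neighbours. A $b$-matching is a set $M\subseteq E$ in which every agent $v$ has at most $b(v)$ partners; $M(v)$ is the set of partners of $v$, and $v$ is saturated if $|M(v)|=b(v)$, otherwise unsaturated. Given $M$: a *satellite* of $u\in U$ with respect to $w\in M(u)$ is an unsaturated $w_1\notin M(u)$ that is as good for $u$ as $w$; if there is one, $u$ is *satellitic* with respect to $w$, and $w$ is *insecure*. An edge $(u,w)$ is *special* if $w$ is unsaturated and some other unsaturated $w_1\notin M(u)$ is as good for $u$ as $w$. An agent $u\in U$ is *subsatellitic* if he has an unsaturated neighbour outside $M(u)$. A saturated, not insecure $w$ is *uneasy with respect to* $u$ if some subsatellitic $u_1\in M(w)$ is as good for $w$ as $u$. A *worst* partner of $w$ is a $u\in M(w)$ such that no member of $M(w)$ is worse for $w$. **Algorithm ASBM.** Start with $M=\emptyset$, $L_u$ the preference list of $u$,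 and $L'_u$ empty, for all $u\in U$. While there is an unsaturated $u\in U$ with $L_u\not\subseteq M(u)$ or with $L'_u\neq\emptyset$, choose such a $u$ and do the following. * If $L_u\not\subseteq M(u)$: let $w$ be at the top of $L_u\setminus M(u)$ (unsaturated agents come before saturated ones of the same tie; other ties are broken arbitrarily). If $(u,w)$ is not special, remove $w$ from $L_u$. Then: 1. if $w$ is unsaturated, add $(u,w)$ to $M$; 2. else, if $w$ is insecure, choose a satellite $w'$ of some $u'\in M(w)$ with respect to $w$; if $(u',w')$ is not special, remove $w'$ from $L_{u'}$; replace $(u',w)$ in $M$ by $(u,w)$ and $(u',w')$ (whether edges are special is decided before $M$ changes); 3. else, if $w$ prefers $u$ to her worst partners, let $u'$ be a worst partner of $w$, a subsatellitic one if one exists; replace $(u',w)$ in $M$ by $(u,w)$; then, if $w$ is uneasy with respect to $u'$, append $w$ to $L'_{u'}$; 4. else, if $w$ is uneasy with respect to $u$, append $w$ to $L'_u$. * If $L_u\subseteq M(u)$: remove the first element $w$ of $L'_u$. If $w\notin M(u)$ and $w$ is uneasy with respect to $u$, choose a subsatellitic $u'\in M(w)$ that is as good for $w$ as $u$; if $w$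 is uneasy with respect to $u'$, append $w$ to $L'_{u'}$; then replace $(u',w)$ in $M$ by $(u,w)$. The roles of the two sides may be exchanged; let the proposing side $U$ be one whose maximum capacity is the larger one. **Implementation.** ASBM is run on a random access machine on which reading or writing a number and each elementary operation on a doubly linked list (inspect or remove the first element, add at an end, delete at a pointer) take unit time. The data structures are: for each $u$ a list for each tie of $L_u$, unsaturated agents first, without the partners of $u$; the list $L'_u$; counters of the unsaturated neighbours of $u$ that are not his partners, in total and for each tie; the position of every agent in the lists it belongs to; for each $w$ a list of the partners who are satellitic with respect to $w$; and for each $w$ a priority queue (a tournament tree with $\min\{b(w),\deg w\}$ leaves) of the ties that contain partners of $w$, with the list of these partners, subsatellitic ones first, for each tie. A stack yields the next $u$; a displaced $u'$ is put on top of it. **Theorem 2 (running time of ASBM).** There is a constant $C$ such that on every instance this implementation halts, its run is a complete run of Algorithm ASBM (every round of its main loop either leaves $M$, all $L_u$ and all $L'_u$ unchanged or performs one iteration of ASBM, and at the end the condition of the while-loop of ASBM fails), and the total time, including the choice of the roles and the construction of the data structures, is at most $$C\cdot m\cdot\max\{1,\log c\},\qquad c=\min\Bigl\{\max_{u\in U}b(u),\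 \max_{w\in W}b(w)\Bigr\}.$$ In particular, if all capacities on one of the two sides are $1$ (Hospitals–Residents), the time is at most $C\cdot m$. -/

import Mathlib

namespace ASBM

/-! ## Instances -/

/-- An instance of the stable `b`-matching problem with ties and incomplete lists: two sides of
agents, capacities, and for every agent a preference list, which is a list of ties (best tie
first).  An agent occurs at most once on a list, ties are not empty, and acceptability is mutual,
so that the edges of the underlying bipartite graph are the pairs `(u, w)` with `w` on the list
of `u`. -/
structure Instance where
  nU : ℕ
  nW : ℕ
  capU : Fin nU → ℕ
  capW : Fin nW → ℕ
  prefU : Fin nU → List (List (Fin nW))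
  prefW : Fin nW → List (List (Fin nU))
  capU_pos : ∀ u, 0 < capU u
  capW_pos : ∀ w, 0 < capW w
  tieU_ne : ∀ u, [] ∉ prefU u
  tieW_ne : ∀ w, [] ∉ prefW w
  nodupU : ∀ u, (prefU u).flatten.Nodup
  nodupW : ∀ w, (prefW w).flatten.Nodup
  mutual_acc : ∀ u w, w ∈ (prefU u).flatten ↔ u ∈ (prefW w).flatten

/-- The number of edges. -/
def Instance.numEdges (I : Instance) : ℕ := ∑ u, (I.prefU u).flatten.length

/-- The same instance with the roles of the two sides exchanged. -/
def Instance.swap (I : Instance) : Instance where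
  nU := I.nW
  nW := I.nU
  capU := I.capW
  capW := I.capU
  prefU := I.prefW
  prefW := I.prefU
  capU_pos := I.capW_pos
  capW_pos := I.capU_pos
  tieU_ne := I.tieW_ne
  tieW_ne := I.tieU_ne
  nodupU := I.nodupW
  nodupW := I.nodupU
  mutual_acc := fun u w => (I.mutual_acc w u).symm

/-- `c`: the smaller one of the maximum capacities of the two sides. -/
def Instance.minMaxCap (I : Instance) : ℕ :=
  min (Finset.univ.sup I.capU) (Finset.univ.sup I.capW)

section Algorithm

variable (I : Instance)

/-! ## The algorithm, as a nondeterministic transition system -/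

/-- `(u, w)` is an edge: `u` and `w` are mutually acceptable. -/
def Edge (u : Fin I.nU) (w : Fin I.nW) : Prop := w ∈ (I.prefU u).flatten

/-- Position on the list of `u` of the tie that contains `w` (smaller is better). -/
def rankU (u : Fin I.nU) (w : Fin I.nW) : ℕ := (I.prefU u).findIdx (fun t => w ∈ t)

/-- Position on the list of `w` of the tie that contains `u` (smaller is better). -/
def rankW (w : Fin I.nW) (u : Fin I.nU) : ℕ := (I.prefW w).findIdx (fun t => u ∈ t)

/-- `w` and `w₁` are equally good for `u`. -/
def TiedU (u : Fin I.nU) (w w₁ : Fin I.nW) : Prop :=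
  Edge I u w ∧ Edge I u w₁ ∧ rankU I u w = rankU I u w₁

/-- `u` and `u₁` are equally good for `w`. -/
def TiedW (w : Fin I.nW) (u u₁ : Fin I.nU) : Prop :=
  Edge I u w ∧ Edge I u₁ w ∧ rankW I w u = rankW I w u₁

/-- `w` prefers `u` to `u₁`. -/
def PrefersW (w : Fin I.nW) (u u₁ : Fin I.nU) : Prop :=
  Edge I u w ∧ Edge I u₁ w ∧ rankW I w u < rankW I w u₁

/-- A set of pairs; in the algorithm always a `b`-matching. -/
abbrev Matching : Type := Finset (Fin I.nU × Fin I.nW)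

variable {I} in
/-- `u` is unsaturated in `M`. -/
def UnsatU (M : Matching I) (u : Fin I.nU) : Prop := (M.filter (fun e => e.1 = u)).card < I.capU u

variable {I} in
/-- `w` is unsaturated in `M`. -/
def UnsatW (M : Matching I) (w : Fin I.nW) : Prop := (M.filter (fun e => e.2 = w)).card < I.capW w

variable {I} in
/-- `w₁` is a satellite of `u` with respect to his partner `w`: an unsaturated agent, not matched
with `u`, who is as good for `u` as `w`. -/
def Satellite (M : Matching I) (u : Fin I.nU) (w w₁ : Fin I.nW) : Prop :=
  (u, w) ∈ M ∧ UnsatW M w₁ ∧ TiedU I u w w₁ ∧ (u, w₁) ∉ M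

variable {I} in
/-- `w` is matched with an agent that is satellitic with respect to `w`. -/
def Insecure (M : Matching I) (w : Fin I.nW) : Prop := ∃ u w₁, Satellite M u w w₁

variable {I} in
/-- `(u, w)` is special: `w` is unsaturated, and so is some other agent, not matched with `u`,
who is as good for `u` as `w`. -/
def Special (M : Matching I) (u : Fin I.nU) (w : Fin I.nW) : Prop :=
  UnsatW M w ∧ ∃ w₁, w₁ ≠ w ∧ UnsatW M w₁ ∧ TiedU I u w w₁ ∧ (u, w₁) ∉ M

variable {I} in
/-- Some unsaturated neighbour of `u` is not matched with `u`. -/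
def Subsatellitic (M : Matching I) (u : Fin I.nU) : Prop :=
  ∃ w, Edge I u w ∧ UnsatW M w ∧ (u, w) ∉ M

variable {I} in
/-- `w` is uneasy with respect to `u`. -/
def Uneasy (M : Matching I) (w : Fin I.nW) (u : Fin I.nU) : Prop :=
  ¬ UnsatW M w ∧ ¬ Insecure M w ∧ ∃ u₁, (u₁, w) ∈ M ∧ Subsatellitic M u₁ ∧ TiedW I w u₁ u

variable {I} in
/-- `u` is a worst agent among those matched with `w`. -/
def Worst (M : Matching I) (w : Fin I.nW) (u : Fin I.nU) : Prop :=
  (u, w) ∈ M ∧ ∀ u₁, (u₁, w) ∈ M → ¬ PrefersW I w u u₁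

/-- The variables of the algorithm: the `b`-matching `M`, the lists `L u` (their order is that of
the preference lists, see `OnTop`), and the lists `L' u`. -/
@[ext] structure State where
  M : Matching I
  L : Fin I.nU → Finset (Fin I.nW)
  L' : Fin I.nU → List (Fin I.nW)

/-- At the beginning nobody is matched, `L u` is the preference list of `u`, and `L' u` is empty. -/
def State.initial : State I where
  M := ∅
  L := fun u => (I.prefU u).flatten.toFinset
  L' := fun _ => []

variable {I}

/-- `w` is at the top of `L u` among the agents that `u` can propose to (those he is not matched
with): no such agent is in a better tie, and within a tie unsaturated agents come before
saturated ones. Apart from that ties are broken arbitrarily. -/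
def OnTop (A : State I) (u : Fin I.nU) (w : Fin I.nW) : Prop :=
  w ∈ A.L u ∧ (u, w) ∉ A.M ∧
  ∀ w₁ ∈ A.L u, (u, w₁) ∉ A.M →
    rankU I u w ≤ rankU I u w₁ ∧ (rankU I u w = rankU I u w₁ → UnsatW A.M w₁ → UnsatW A.M w)

/-- No agent is left on `L u` that `u` can propose to. -/
def Exhausted (A : State I) (u : Fin I.nU) : Prop := ∀ w ∈ A.L u, (u, w) ∈ A.M

open Classical in
/-- "If `(u, w)` is not special, remove `w` from `L u`." -/
noncomputable def dropL (M : Matching I) (L : Fin I.nU → Finset (Fin I.nW))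
    (u : Fin I.nU) (w : Fin I.nW) : Fin I.nU → Finset (Fin I.nW) :=
  if Special M u w then L else Function.update L u ((L u).erase w)

open Classical in
/-- "If `w` is uneasy with respect to `u`, add `w` to the end of `L' u`." -/
noncomputable def addL' (M : Matching I) (L' : Fin I.nU → List (Fin I.nW))
    (w : Fin I.nW) (u : Fin I.nU) : Fin I.nU → List (Fin I.nW) :=
  if Uneasy M w u then Function.update L' u (L' u ++ [w]) else L'

/-- One iteration of the main loop: some unsaturated `u` makes a proposal to some `w`. -/
inductive Step (A : State I) : State I → Prop
  /-- `u` proposes from `L u` to an unsaturated `w`. -/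
  | accept (u : Fin I.nU) (w : Fin I.nW) (hu : UnsatU A.M u) (htop : OnTop A u w)
      (hw : UnsatW A.M w) :
      Step A ⟨insert (u, w) A.M, dropL A.M A.L u w, A.L'⟩
  /-- `u` proposes from `L u` to an insecure `w`; `u'` passes to his satellite `w'`. -/
  | exchange (u : Fin I.nU) (w : Fin I.nW) (hu : UnsatU A.M u) (htop : OnTop A u w)
      (hw : ¬ UnsatW A.M w) (u' : Fin I.nU) (w' : Fin I.nW) (hs : Satellite A.M u' w w') :
      Step A ⟨(insert (u, w) (insert (u', w') A.M)).erase (u', w),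
        dropL A.M (dropL A.M A.L u w) u' w', A.L'⟩
  /-- `u` proposes from `L u` to a `w` who prefers him to a worst partner of hers; a worst partner
  `u'` has to go, a subsatellitic one if there is one. -/
  | replace (u : Fin I.nU) (w : Fin I.nW) (hu : UnsatU A.M u) (htop : OnTop A u w)
      (hw : ¬ UnsatW A.M w) (hi : ¬ Insecure A.M w) (u' : Fin I.nU) (hu' : Worst A.M w u')
      (hp : PrefersW I w u u')
      (hsub : Subsatellitic A.M u' ∨ ∀ v, Worst A.M w v → ¬ Subsatellitic A.M v) :
      Step A ⟨(insert (u, w) A.M).erase (u', w), dropL A.M A.L u w,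
        addL' ((insert (u, w) A.M).erase (u', w)) A.L' w u'⟩
  /-- `u` proposes from `L u` and is rejected. -/
  | reject (u : Fin I.nU) (w : Fin I.nW) (hu : UnsatU A.M u) (htop : OnTop A u w)
      (hw : ¬ UnsatW A.M w) (hi : ¬ Insecure A.M w)
      (hp : ∀ v, Worst A.M w v → ¬ PrefersW I w u v) :
      Step A ⟨A.M, dropL A.M A.L u w, addL' A.M A.L' w u⟩
  /-- `u` proposes from `L' u` and replaces a subsatellitic `u'` who is equally good for `w`. -/
  | accept' (u : Fin I.nU) (w : Fin I.nW) (l : List (Fin I.nW)) (hu : UnsatU A.M u)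
      (hL : Exhausted A u) (hl : A.L' u = w :: l) (hnot : (u, w) ∉ A.M) (hn : Uneasy A.M w u)
      (u' : Fin I.nU) (hu' : (u', w) ∈ A.M) (hsub : Subsatellitic A.M u') (ht : TiedW I w u' u) :
      Step A ⟨(insert (u, w) A.M).erase (u', w), A.L,
        addL' A.M (Function.update A.L' u l) w u'⟩
  /-- The first element of `L' u` is removed without effect. -/
  | reject' (u : Fin I.nU) (w : Fin I.nW) (l : List (Fin I.nW)) (hu : UnsatU A.M u)
      (hL : Exhausted A u) (hl : A.L' u = w :: l) (hn : (u, w) ∈ A.M ∨ ¬ Uneasy A.M w u) :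
      Step A ⟨A.M, A.L, Function.update A.L' u l⟩

/-- The condition of the main loop fails. -/
def Terminal (A : State I) : Prop :=
  ∀ u, UnsatU A.M u → Exhausted A u ∧ A.L' u = []

/-! ## The machine

A random access machine with cells that hold natural numbers and with doubly linked lists.
Memory can be accessed only through the operations below, and each of them takes one unit of
time: reading or writing a number, and on a list: inspecting or removing the first element,
adding an element at either end, and deleting an element (to which there is a pointer). -/

variable (I)

/-- Cells that hold a number. -/
inductive NumCell
  /-- position of `w` on the list of `u` -/
  | rkU (u : Fin I.nU) (w : Fin I.nW)
  /-- position of `u` on the list of `w` -/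
  | rkW (w : Fin I.nW) (u : Fin I.nU)
  /-- 1 if `u` and `w` are matched, else 0 -/
  | inM (u : Fin I.nU) (w : Fin I.nW)
  /-- 1 if `w` is on `L u`, else 0 -/
  | inL (u : Fin I.nU) (w : Fin I.nW)
  /-- number of partners of `u` -/
  | degU (u : Fin I.nU)
  /-- number of partners of `w` -/
  | degW (w : Fin I.nW)
  /-- number of unsaturated neighbours of `u` that are not matched with `u` -/
  | cnt (u : Fin I.nU)
  /-- the same for the tie at position `r` only -/
  | tieCnt (u : Fin I.nU) (r : ℕ)
  /-- position of the current tie of `u` -/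
  | ptr (u : Fin I.nU)
  /-- number of leaves of the priority queue of `w` -/
  | size (w : Fin I.nW)
  /-- nodes of the priority queue of `w`, a tournament tree with root `1` and leaves
  `size, ..., 2 * size - 1`. A leaf holds `r + 1` if it stands for the tie at position `r`, and
  `0` if it is not in use; an inner node holds the maximum of its children. -/
  | node (w : Fin I.nW) (i : ℕ)
  /-- the leaf that stands for the tie at position `r` in the priority queue of `w` -/
  | leaf (w : Fin I.nW) (r : ℕ)
  /-- stack of the unused leaves -/
  | free (w : Fin I.nW) (i : ℕ)
  /-- height of this stack -/
  | numFree (w : Fin I.nW)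
  deriving DecidableEq

/-- Lists of agents of the side `U`. -/
inductive UCell
  /-- agents who may have proposals to make -/
  | stack
  /-- the list of the agents matched with `w` who are satellitic with respect to `w` -/
  | sat (w : Fin I.nW)
  /-- the agents matched with `w` from her tie at position `r`, subsatellitic ones first: the
  list that the priority queue of `w` holds for this tie -/
  | queue (w : Fin I.nW) (r : ℕ)
  deriving DecidableEq

/-- Lists of agents of the side `W`. -/
inductive WCell
  /-- what is left on `L u` of the tie at position `r`, without partners of `u`;
  unsaturated agents first -/
  | tie (u : Fin I.nU) (r : ℕ)
  /-- an agent on `L u` who has just rejected `u`, so that it is `u`'s turn to propose to her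
  again -/
  | again (u : Fin I.nU)
  /-- the list `L' u` -/
  | second (u : Fin I.nU)
  deriving DecidableEq

/-- The contents of the memory and the time that has been used. -/
structure Machine where
  num : NumCell I → ℕ
  lstU : UCell I → List (Fin I.nU)
  lstW : WCell I → List (Fin I.nW)
  time : ℕ

/-- Empty memory at time `0`. -/
def Machine.blank : Machine I := ⟨fun _ => 0, fun _ => [], fun _ => [], 0⟩

/-- Programs. -/
abbrev Prog (α : Type) : Type := StateM (Machine I) α

variable {I}

/-- One unit of time. -/
def tick : Prog I Unit := modify fun s => { s with time := s.time + 1 }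

/-- Read a number of the input. -/
def input (n : ℕ) : Prog I ℕ := do tick; return n

def load (c : NumCell I) : Prog I ℕ := do tick; return (← get).num c

def store (c : NumCell I) (n : ℕ) : Prog I Unit := do
  tick; modify fun s => { s with num := Function.update s.num c n }

def headU (c : UCell I) : Prog I (Option (Fin I.nU)) := do tick; return ((← get).lstU c).head?

def headW (c : WCell I) : Prog I (Option (Fin I.nW)) := do tick; return ((← get).lstW c).head?

def popU (c : UCell I) : Prog I Unit := do
  tick; modify fun s => { s with lstU := Function.update s.lstU c (s.lstU c).tail }

def popW (c : WCell I) : Prog I Unit := do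
  tick; modify fun s => { s with lstW := Function.update s.lstW c (s.lstW c).tail }

def pushFrontU (c : UCell I) (u : Fin I.nU) : Prog I Unit := do
  tick; modify fun s => { s with lstU := Function.update s.lstU c (u :: s.lstU c) }

def pushBackU (c : UCell I) (u : Fin I.nU) : Prog I Unit := do
  tick; modify fun s => { s with lstU := Function.update s.lstU c (s.lstU c ++ [u]) }

def pushBackW (c : WCell I) (w : Fin I.nW) : Prog I Unit := do
  tick; modify fun s => { s with lstW := Function.update s.lstW c (s.lstW c ++ [w]) }

def eraseU (c : UCell I) (u : Fin I.nU) : Prog I Unit := do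
  tick; modify fun s => { s with lstU := Function.update s.lstU c ((s.lstU c).erase u) }

def eraseW (c : WCell I) (w : Fin I.nW) : Prog I Unit := do
  tick; modify fun s => { s with lstW := Function.update s.lstW c ((s.lstW c).erase w) }

/-- Loop over a list of the input; every round costs a unit of time besides that of its body. -/
def forEach {α : Type} : List α → (α → Prog I Unit) → Prog I Unit
  | [], _ => tick
  | a :: l, f => do tick; f a; forEach l f

/-- Loop over a preference list; `f` gets the position of the tie and the agent. -/
def forTies {α : Type} : ℕ → List (List α) → (ℕ → α → Prog I Unit) → Prog I Unit
  | _, [], _ => tick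
  | r, t :: ts, f => do tick; forEach t (f r); forTies (r + 1) ts f

def incr (c : NumCell I) : Prog I Unit := do store c ((← load c) + 1)

def decr (c : NumCell I) : Prog I Unit := do store c ((← load c) - 1)

/-! ## The implementation -/

/-- Repair the tournament tree of `w` on the way from node `i` to the root. The first argument
only bounds the depth of the recursion. -/
def pull (w : Fin I.nW) : ℕ → ℕ → Prog I Unit
  | 0, _ => tick
  | k + 1, i =>
    if i ≤ 1 then tick
    else do
      let a ← load (.node w (2 * (i / 2)))
      let b ← load (.node w (2 * (i / 2) + 1))
      store (.node w (i / 2)) (max a b)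
      pull w k (i / 2)

/-- Give a new value to a leaf of the tournament tree of `w`. -/
def setLeaf (w : Fin I.nW) (j v : ℕ) : Prog I Unit := do
  let n ← load (.size w)
  store (.node w (n + j)) v
  pull w (n + j) (n + j)

/-- Enter the pair `(u, w)` in the matching and `u` in the priority queue of `w`. -/
def link (u : Fin I.nU) (w : Fin I.nW) : Prog I Unit := do
  store (.inM u w) 1
  incr (.degU u)
  incr (.degW w)
  let r ← load (.rkW w u)
  let h ← headU (.queue w r)
  let c ← load (.cnt u)
  if 0 < c then pushFrontU (.queue w r) u else pushBackU (.queue w r) u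
  if h = none then
    decr (.numFree w)
    let k ← load (.numFree w)
    let j ← load (.free w k)
    store (.leaf w r) j
    setLeaf w j (r + 1)
  let p ← load (.rkU u w)
  let t ← load (.tieCnt u p)
  if 0 < t then pushFrontU (.sat w) u

/-- Remove the pair `(u, w)` from the matching and `u` from the priority queue of `w`. -/
def unlink (u : Fin I.nU) (w : Fin I.nW) : Prog I Unit := do
  store (.inM u w) 0
  decr (.degU u)
  decr (.degW w)
  let r ← load (.rkW w u)
  eraseU (.queue w r) u
  let h ← headU (.queue w r)
  if h = none then
    let j ← load (.leaf w r)
    setLeaf w j 0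
    let k ← load (.numFree w)
    store (.free w k) j
    incr (.numFree w)

/-- `u` ceases to be subsatellitic: he moves to the end of every list in a priority queue that
he is in. -/
def demote (u : Fin I.nU) : Prog I Unit :=
  forTies 0 (I.prefU u) fun _ w => do
    let x ← load (.inM u w)
    if x = 1 then
      let r ← load (.rkW w u)
      eraseU (.queue w r) u
      pushBackU (.queue w r) u

/-- In the tie of `u` at position `r` there is one unsaturated non-partner of `u` less. -/
def lower (u : Fin I.nU) (r : ℕ) : Prog I Unit := do
  decr (.tieCnt u r)
  decr (.cnt u)
  let c ← load (.cnt u)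
  if c = 0 then demote u

/-- `w` gets saturated: she moves to the end of the ties she belongs to, and counters are
decreased. -/
def saturate (w : Fin I.nW) : Prog I Unit :=
  forTies 0 (I.prefW w) fun _ u => do
    let x ← load (.inM u w)
    if x = 0 then
      let r ← load (.rkU u w)
      eraseW (.tie u r) w
      pushBackW (.tie u r) w
      lower u r

/-- Match `u` with an unsaturated `w`, who has been taken out of the tie-list of `u`. -/
def linkUnsat (u : Fin I.nU) (w : Fin I.nW) : Prog I Unit := do
  let r ← load (.rkU u w)
  let t ← load (.tieCnt u r)
  if t < 2 then store (.inL u w) 0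
  lower u r
  link u w
  let d ← load (.degW w)
  let c ← input (I.capW w)
  if d = c then saturate w

/-- Drop agents from the front of the list of satellitic partners of `w` until the first one is
still satellitic with respect to `w`; the first argument is this list. -/
def clean (w : Fin I.nW) : List (Fin I.nU) → Prog I (Option (Fin I.nU))
  | [] => do tick; return none
  | u :: l => do
    let r ← load (.rkU u w)
    let t ← load (.tieCnt u r)
    if 0 < t then return some u
    popU (.sat w)
    clean w l

/-- A satellitic partner of `w`, if there is one, that is, if `w` is insecure. -/
def findSat (w : Fin I.nW) : Prog I (Option (Fin I.nU)) := do
  clean w ((← get).lstU (.sat w))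

/-- Is the first agent of the list at position `r` in the priority queue of `w` subsatellitic?
If so, return him. -/
def findSub (w : Fin I.nW) (r : ℕ) : Prog I (Option (Fin I.nU)) := do
  match ← headU (.queue w r) with
  | none => return none
  | some u =>
    let c ← load (.cnt u)
    return if 0 < c then some u else none

/-- `u` takes the place of `u'` at a `w` who is saturated and not insecure. -/
def takeOver (u u' : Fin I.nU) (w : Fin I.nW) : Prog I Unit := do
  unlink u' w
  link u w
  let x ← load (.inL u' w)
  if x = 1 then pushBackW (.again u') w
  pushFrontU .stack u'

/-- `u` proposes from `L u` to `w`, who has been taken out of the tie-list of `u`. -/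
def propose (u : Fin I.nU) (w : Fin I.nW) : Prog I Unit := do
  let d ← load (.degW w)
  let c ← input (I.capW w)
  if d < c then linkUnsat u w
  else
    store (.inL u w) 0
    match ← findSat w with
    | some u' =>
      let r ← load (.rkU u' w)
      match ← headW (.tie u' r) with
      | none => tick
      | some w' =>
        popU (.sat w)
        unlink u' w
        popW (.tie u' r)
        let x ← load (.inL u' w)
        if x = 1 then pushBackW (.tie u' r) w
        linkUnsat u' w'
        link u w
        pushFrontU .stack u'
    | none =>
      let r ← load (.rkW w u)
      let q ← load (.node w 1)
      if r + 1 < q then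
        match ← headU (.queue w (q - 1)) with
        | none => tick
        | some u' =>
          takeOver u u' w
          match ← findSub w (q - 1) with
          | none => tick
          | some _ => pushBackW (.second u') w
      else
        match ← findSub w r with
        | none => tick
        | some _ => pushBackW (.second u) w

/-- `u` proposes from `L' u` to `w`, who has been taken out of `L' u`. -/
def propose' (u : Fin I.nU) (w : Fin I.nW) : Prog I Unit := do
  let x ← load (.inM u w)
  if x = 0 then
    match ← findSat w with
    | some _ => tick
    | none =>
      let r ← load (.rkW w u)
      match ← findSub w r with
      | none => tick
      | some u' =>
        takeOver u u' w
        pushBackW (.second u') w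

/-- One round of the main loop: look at the agent on top of the stack. He makes a proposal, or
passes to the next tie, or leaves the stack. -/
def round : Prog I Unit := do
  match ← headU .stack with
  | none => tick
  | some u =>
    let d ← load (.degU u)
    let c ← input (I.capU u)
    if d < c then
      match ← headW (.again u) with
      | some w =>
        popW (.again u)
        propose u w
      | none =>
        let p ← load (.ptr u)
        let n ← input (I.prefU u).length
        if p < n then
          match ← headW (.tie u p) with
          | some w =>
            popW (.tie u p)
            propose u w
          | none => incr (.ptr u)
        else
          match ← headW (.second u) with
          | some w =>
            popW (.second u)
            propose' u w
          | none => popU .stack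
    else popU .stack

/-- Set up the data structures: positions, tie-lists, counters, and priority queues with
`min (capW w) (deg w)` leaves. -/
def setup : Prog I Unit := do
  forEach (List.finRange I.nU) fun u => do
    forTies 0 (I.prefU u) fun r w => do
      store (.rkU u w) r
      store (.inL u w) 1
      pushBackW (.tie u r) w
      incr (.tieCnt u r)
      incr (.cnt u)
    pushBackU .stack u
  forEach (List.finRange I.nW) fun w => do
    forTies 0 (I.prefW w) fun r u => do
      store (.rkW w u) r
      let d ← load (.size w)
      let c ← input (I.capW w)
      if d < c then
        store (.free w d) d
        incr (.size w)
        incr (.numFree w)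

variable (I) in
/-- The machine after the setup and `i` rounds of the main loop. -/
def exec (i : ℕ) : Machine I :=
  (fun s => (round.run s).2)^[i] ((setup.run (Machine.blank I)).2)

/-- There are no agents left that may have proposals to make. -/
def Machine.Halted (s : Machine I) : Prop := s.lstU .stack = []

/-- The values of the variables of the algorithm that are represented in the memory. -/
def Machine.state (s : Machine I) : State I where
  M := Finset.univ.filter fun e => s.num (.inM e.1 e.2) = 1
  L := fun u => Finset.univ.filter fun w => s.num (.inL u w) = 1
  L' := fun u => s.lstW (.second u)

/-- The maximum of a list of numbers, and the time for finding it. -/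
def scanMax (l : List ℕ) : ℕ × ℕ := l.foldl (fun x n => (max x.1 n, x.2 + 1)) (0, 1)

end Algorithm

/-- Decide which side proposes: the side whose maximum capacity is larger. Return the instance
with the proposing side as its first side, and the time for the decision. -/
def Instance.chooseRoles (I : Instance) : Instance × ℕ :=
  let a := scanMax ((List.finRange I.nU).map I.capU)
  let b := scanMax ((List.finRange I.nW).map I.capW)
  (if a.1 < b.1 then I.swap else I, a.2 + b.2 + 1)

/-- The time for choosing the roles, the setup and `i` rounds of the main loop. -/
def Instance.totalTime (I : Instance) (i : ℕ) : ℕ :=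
  I.chooseRoles.2 + (exec I.chooseRoles.1 i).time

end ASBM

/-! The proof is an amortised analysis of a program that is verified at the same time. The memory is
compared with an abstract value of type `Ghost`. `Rep` says that the memory represents this value,
and `Inv` collects what holds between rounds. `Rep'` has separate parameters for the matching stored
in the queues, for the order inside the queues and for the order inside the tie-lists, because an
operation updates these one after the other and they disagree while it is running.

The central object is the set `F` of free pairs: edges `(u, w)` outside `M` with `w` unsaturated. A
saturated `w` never loses a partner without getting a new one in the same step, so she stays
saturated and `F` only shrinks. Satellites, special edges, insecure and subsatellitic agents can all
be read off from `F` (`Base.satellite_iff`, `Base.special_iff`, `Base.insecure_iff`,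
`Base.subsatellitic_iff`), and therefore from the counters. The lists of satellitic partners may
hold agents that are no longer satellitic, but never miss one that is. It thus suffices to clean
such a list from the front when it is consulted.

The number of rounds is bounded by `weight`, which every round decreases. Proposals from `L u`
shorten a list or remove a free pair, and either is worth 5. The delicate case is a successful
proposal from `L' u`, which lengthens both the stack and the list `L'` of the displaced agent. There
`u` has no free pair and replaces an agent who has one, so the number of matched pairs with a
subsatellitic first component drops (`livePairs_swap`); this number has coefficient 2 in `weight`.

The time of a round is logarithmic except for three loops, and these are paid for by `credit`.
Cleaning costs 3 for each discarded entry. An agent of the proposing side stops being subsatellitic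
at most once, which pays for `demote`, and an agent of the other side becomes saturated at most
once, which pays for `saturate`. Hence `wp_round`: a round uses at most `9 * ell + 105` units beyond
the credit released, where `ell` bounds the logarithms of the capacities of the receiving side.

Initially `weight` and `credit` are linear in the number of edges, and an induction on `weight`
(`exists_halted`) gives both halting and the time bound. Only the priority queues of the receiving
side cost a logarithm. By the choice of roles this side has the smaller maximum capacity, which is
`c`. -/

namespace ASBM

/-! ## Weakest preconditions -/

section WP

variable {I : Instance} {α β : Type}

/-- The machine one unit of time later. -/
abbrev Machine.later (s : Machine I) : Machine I := { s with time := s.time + 1 }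

/-- `Q` holds for the result and the final memory of `p`, started in `s`. -/
def wp (p : Prog I α) (Q : α → Machine I → Prop) (s : Machine I) : Prop :=
  Q (p.run s).1 (p.run s).2

theorem wp_mono {p : Prog I α} {Q Q' : α → Machine I → Prop} {s : Machine I}
    (h : wp p Q s) (hQ : ∀ a s', Q a s' → Q' a s') : wp p Q' s := hQ _ _ h

-- Programs are functions on memories, so this rule and those for the single instructions hold by
-- unfolding. Together they execute straight-line code symbolically and keep track of its time.
@[simp] theorem wp_bind (p : Prog I α) (f : α → Prog I β) (Q : β → Machine I → Prop)
    (s : Machine I) : wp (p >>= f) Q s ↔ wp p (fun a s' => wp (f a) Q s') s := Iff.rfl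

@[simp] theorem wp_pure (a : α) (Q : α → Machine I → Prop) (s : Machine I) :
    wp (pure a : Prog I α) Q s ↔ Q a s := Iff.rfl

@[simp] theorem wp_get (Q : Machine I → Machine I → Prop) (s : Machine I) :
    wp (get : Prog I (Machine I)) Q s ↔ Q s s := Iff.rfl

@[simp] theorem wp_tick (Q : Unit → Machine I → Prop) (s : Machine I) :
    wp tick Q s ↔ Q () s.later := Iff.rfl

@[simp] theorem wp_input (n : ℕ) (Q : ℕ → Machine I → Prop) (s : Machine I) :
    wp (input n) Q s ↔ Q n s.later := Iff.rfl

@[simp] theorem wp_load (c : NumCell I) (Q : ℕ → Machine I → Prop) (s : Machine I) :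
    wp (load c) Q s ↔ Q (s.num c) s.later := Iff.rfl

@[simp] theorem wp_store (c : NumCell I) (n : ℕ) (Q : Unit → Machine I → Prop) (s : Machine I) :
    wp (store c n) Q s ↔
      Q () ⟨Function.update s.num c n, s.lstU, s.lstW, s.time + 1⟩ := Iff.rfl

@[simp] theorem wp_incr (c : NumCell I) (Q : Unit → Machine I → Prop) (s : Machine I) :
    wp (incr c) Q s ↔
      Q () ⟨Function.update s.num c (s.num c + 1), s.lstU, s.lstW, s.time + 1 + 1⟩ := Iff.rfl

@[simp] theorem wp_decr (c : NumCell I) (Q : Unit → Machine I → Prop) (s : Machine I) :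
    wp (decr c) Q s ↔
      Q () ⟨Function.update s.num c (s.num c - 1), s.lstU, s.lstW, s.time + 1 + 1⟩ := Iff.rfl

@[simp] theorem wp_headU (c : UCell I) (Q : Option (Fin I.nU) → Machine I → Prop)
    (s : Machine I) : wp (headU c) Q s ↔ Q (s.lstU c).head? s.later := Iff.rfl

@[simp] theorem wp_headW (c : WCell I) (Q : Option (Fin I.nW) → Machine I → Prop)
    (s : Machine I) : wp (headW c) Q s ↔ Q (s.lstW c).head? s.later := Iff.rfl

@[simp] theorem wp_popU (c : UCell I) (Q : Unit → Machine I → Prop) (s : Machine I) :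
    wp (popU c) Q s ↔
      Q () ⟨s.num, Function.update s.lstU c (s.lstU c).tail, s.lstW, s.time + 1⟩ := Iff.rfl

@[simp] theorem wp_popW (c : WCell I) (Q : Unit → Machine I → Prop) (s : Machine I) :
    wp (popW c) Q s ↔
      Q () ⟨s.num, s.lstU, Function.update s.lstW c (s.lstW c).tail, s.time + 1⟩ := Iff.rfl

@[simp] theorem wp_pushFrontU (c : UCell I) (u : Fin I.nU) (Q : Unit → Machine I → Prop)
    (s : Machine I) : wp (pushFrontU c u) Q s ↔
      Q () ⟨s.num, Function.update s.lstU c (u :: s.lstU c), s.lstW, s.time + 1⟩ := Iff.rfl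

@[simp] theorem wp_pushBackU (c : UCell I) (u : Fin I.nU) (Q : Unit → Machine I → Prop)
    (s : Machine I) : wp (pushBackU c u) Q s ↔
      Q () ⟨s.num, Function.update s.lstU c (s.lstU c ++ [u]), s.lstW, s.time + 1⟩ := Iff.rfl

@[simp] theorem wp_pushBackW (c : WCell I) (w : Fin I.nW) (Q : Unit → Machine I → Prop)
    (s : Machine I) : wp (pushBackW c w) Q s ↔
      Q () ⟨s.num, s.lstU, Function.update s.lstW c (s.lstW c ++ [w]), s.time + 1⟩ := Iff.rfl

@[simp] theorem wp_eraseU (c : UCell I) (u : Fin I.nU) (Q : Unit → Machine I → Prop)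
    (s : Machine I) : wp (eraseU c u) Q s ↔
      Q () ⟨s.num, Function.update s.lstU c ((s.lstU c).erase u), s.lstW, s.time + 1⟩ := Iff.rfl

@[simp] theorem wp_eraseW (c : WCell I) (w : Fin I.nW) (Q : Unit → Machine I → Prop)
    (s : Machine I) : wp (eraseW c w) Q s ↔
      Q () ⟨s.num, s.lstU, Function.update s.lstW c ((s.lstW c).erase w), s.time + 1⟩ := Iff.rfl

theorem wp_ite {c : Prop} [Decidable c] {p q : Prog I α} {Q : α → Machine I → Prop}
    {s : Machine I} (hp : c → wp p Q s) (hq : ¬ c → wp q Q s) : wp (if c then p else q) Q s := by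
  split_ifs with h
  exacts [hp h, hq h]

/-- The invariant is indexed by the elements that are still to come, so that it can express how far
the loop has progressed. -/
theorem wp_forEach {l : List α} {f : α → Prog I Unit} {Q : Unit → Machine I → Prop}
    (Inv : List α → Machine I → Prop) {s : Machine I}
    (hstep : ∀ a ∈ l, ∀ l' s, Inv (a :: l') s → wp (f a) (fun _ s' => Inv l' s') s.later)
    (hend : ∀ s, Inv [] s → Q () s.later) (h : Inv l s) : wp (forEach l f) Q s := by
  induction l generalizing s with
  | nil => exact hend s h
  | cons a l ih =>
    simp only [forEach, wp_bind, wp_tick]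
    exact wp_mono (hstep a (by simp) l s h)
      fun _ s' hs' => ih (fun b hb => hstep b (by simp [hb])) hs'

/-- Rule for loops over preference lists, with a potential function `Ψ` that pays for expensive
rounds. -/
theorem wp_forTies {f : ℕ → α → Prog I Unit} (g : α → ℕ) (K : ℕ)
    (Inv : List α → Machine I → Prop) (Ψ : Machine I → ℕ)
    (hinv : ∀ l s t, Inv l s → Inv l { s with time := t })
    (hΨ : ∀ (s : Machine I) t, Ψ { s with time := t } = Ψ s)
    {ts : List (List α)} {r : ℕ} (hne : [] ∉ ts)
    (hg : ∀ i (h : i < ts.length), ∀ a ∈ ts[i], g a = r + i)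
    (hstep : ∀ a ∈ ts.flatten, ∀ l s, Inv (a :: l) s →
      wp (f (g a) a) (fun _ s' => Inv l s' ∧ s'.time + Ψ s' ≤ s.time + Ψ s + K) s)
    {s : Machine I} (h : Inv ts.flatten s) :
    wp (forTies r ts f) (fun _ s' => Inv [] s' ∧
      s'.time + Ψ s' ≤ s.time + Ψ s + (K + 3) * ts.flatten.length + 1) s := by
  induction ts generalizing r s with
  | nil =>
    simp only [forTies, wp_tick]
    exact ⟨hinv _ _ _ h, by simp [hΨ]; omega⟩
  | cons t ts ih =>
    simp only [forTies, wp_bind, wp_tick]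
    have ht : ∀ a ∈ t, g a = r := fun a ha => by simpa using hg 0 (by simp) a ha
    have hinner : wp (forEach t (f r)) (fun _ s' => Inv ts.flatten s' ∧
        s'.time + Ψ s' ≤ s.time + Ψ s + (K + 1) * t.length + 2) s.later := by
      refine wp_forEach (fun l s' => Inv (l ++ ts.flatten) s' ∧ s'.time + Ψ s' + (K + 1) * l.length
          ≤ s.time + Ψ s + (K + 1) * t.length + 1) ?_ ?_ ⟨hinv _ _ _ (by simpa using h), ?_⟩
      · rintro a ha l' s' ⟨h1, h2⟩
        have := hstep a (by simp [ha]) _ s'.later (hinv _ _ _ h1)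
        rw [ht a ha] at this
        refine wp_mono this ?_
        rintro _ s'' ⟨h3, h4⟩
        refine ⟨h3, ?_⟩
        simp only [List.length_cons, hΨ] at h2 h4
        rw [mul_add] at h2
        omega
      · rintro s' ⟨h1, h2⟩
        refine ⟨hinv _ _ _ (by simpa using h1), ?_⟩
        simp only [List.length_nil, hΨ] at h2 ⊢
        omega
      · simp only [hΨ]
        omega
    refine wp_mono hinner ?_
    rintro _ s' ⟨h1, h2⟩
    refine wp_mono (ih (r := r + 1) (fun h => hne (by simp [h])) ?_
      (fun a ha => hstep a (by simp only [List.flatten_cons, List.mem_append]; exact Or.inr ha))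
      h1) ?_
    · intro i hi a ha
      have := hg (i + 1) (by simpa using hi) a (by simpa using ha)
      omega
    · rintro _ s'' ⟨h3, h4⟩
      refine ⟨h3, ?_⟩
      -- A tie costs two units besides those of its members, one for entering it and one for the end
      -- of the inner loop. Since ties are not empty, these can be charged to a member. This gives
      -- `K + 3` per agent: the body, one unit for its round, and two for the tie.
      have hpos : 1 ≤ t.length := by
        rcases t with _ | ⟨b, t⟩
        · exact absurd (by simp) hne
        · simp
      simp only [List.flatten_cons, List.length_append, mul_add, add_mul] at h2 h4 ⊢
      omega

end WP

/-! ## Preference lists -/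

/-- Without repetitions, no earlier tie can contain `a`. This identifies the counter of `forTies`
with `rankU` and `rankW`. -/
theorem findIdx_eq_of_mem {α : Type} [DecidableEq α] {ts : List (List α)}
    (hnd : ts.flatten.Nodup) {i : ℕ} (h : i < ts.length) {a : α} (ha : a ∈ ts[i]) :
    ts.findIdx (fun t => a ∈ t) = i := by
  induction ts generalizing i with
  | nil => simp at h
  | cons t ts ih =>
    rw [List.flatten_cons, List.nodup_append] at hnd
    rw [List.findIdx_cons]
    rcases i with _ | i
    · have : a ∈ t := by simpa using ha
      simp [this]
    · have hi : i < ts.length := by simpa using h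
      have ha' : a ∈ ts[i] := by simpa using ha
      have : a ∉ t := fun hat => hnd.2.2 a hat a
        (List.mem_flatten.2 ⟨_, List.getElem_mem hi, ha'⟩) rfl
      simp [this, ih hnd.2.1 hi ha']

theorem findIdx_lt_of_mem {α : Type} [DecidableEq α] {ts : List (List α)} {a : α}
    (ha : a ∈ ts.flatten) : ts.findIdx (fun t => a ∈ t) < ts.length := by
  rw [List.findIdx_lt_length]
  obtain ⟨t, ht, hat⟩ := List.mem_flatten.1 ha
  exact ⟨t, ht, by simpa using hat⟩

theorem length_le_flatten {α : Type} {ts : List (List α)} (h : [] ∉ ts) :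
    ts.length ≤ ts.flatten.length := by
  induction ts with
  | nil => simp
  | cons t ts ih =>
    have := ih (fun h' => h (by simp [h']))
    have hpos : 1 ≤ t.length := by
      rcases t with _ | ⟨b, t⟩
      · exact absurd (by simp) h
      · simp
    rw [List.flatten_cons, List.length_append, List.length_cons]
    omega

/-! ## Tournament trees -/

/-- A tournament tree with `n` leaves, of which those for the ties in `S` are in use; `nf` leaves
are free. -/
structure TreeInv (n : ℕ) (node leaf free : ℕ → ℕ) (nf : ℕ) (S : Finset ℕ) : Prop where
  inner : ∀ i, 1 ≤ i → i < n → node i = max (node (2 * i)) (node (2 * i + 1))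
  used : ∀ r ∈ S, leaf r < n ∧ node (n + leaf r) = r + 1
  unused : ∀ i < nf, free i < n ∧ node (n + free i) = 0
  inj : ∀ i < nf, ∀ j < nf, free i = free j → i = j
  cover : ∀ j < n, (∃ i < nf, free i = j) ∨ ∃ r ∈ S, leaf r = j
  card : nf + S.card = n

namespace TreeInv

variable {n : ℕ} {node leaf free : ℕ → ℕ} {nf : ℕ} {S : Finset ℕ}

/-- Climb from `i` to `i / 2`. The tree need not be complete: the argument works for every number
`n` of leaves. -/
theorem le_root (hinner : ∀ i, 1 ≤ i → i < n → node i = max (node (2 * i)) (node (2 * i + 1)))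
    (i : ℕ) (h1 : 1 ≤ i) (h2 : i < 2 * n) : node i ≤ node 1 := by
  induction i using Nat.strong_induction_on with
  | _ i ih =>
    rcases Nat.lt_or_ge i 2 with h | h
    · obtain rfl : i = 1 := by omega
      exact le_rfl
    · refine le_trans ?_ (ih (i / 2) (by omega) (by omega) (by omega))
      rw [hinner (i / 2) (by omega) (by omega)]
      rcases Nat.even_or_odd' i with ⟨k, rfl | rfl⟩
      · rw [show 2 * k / 2 = k by omega]; exact le_max_left _ _
      · rw [show (2 * k + 1) / 2 = k by omega]; exact le_max_right _ _

/-- Descend to a child that attains the maximum until a leaf is reached; `2 * n - i` decreases on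
the way. -/
theorem exists_leaf
    (hinner : ∀ i, 1 ≤ i → i < n → node i = max (node (2 * i)) (node (2 * i + 1)))
    (i : ℕ) (h1 : 1 ≤ i) (h2 : i < 2 * n) : ∃ j < n, node i = node (n + j) := by
  induction hk : 2 * n - i using Nat.strong_induction_on generalizing i with
  | _ k ih =>
    rcases Nat.lt_or_ge i n with h | h
    · rw [hinner i h1 h]
      rcases le_total (node (2 * i)) (node (2 * i + 1)) with h' | h'
      · rw [max_eq_right h']
        exact ih _ (by omega) _ (by omega) (by omega) rfl
      · rw [max_eq_left h']
        exact ih _ (by omega) _ (by omega) (by omega) rfl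
    · exact ⟨i - n, by omega, by rw [Nat.add_sub_cancel' h]⟩

theorem le_node_one (h : TreeInv n node leaf free nf S) {r : ℕ} (hr : r ∈ S) :
    r + 1 ≤ node 1 := by
  obtain ⟨h1, h2⟩ := h.used r hr
  rw [← h2]
  exact le_root h.inner _ (by omega) (by omega)

/-- The value of the root is that of some leaf. This leaf is in use, since an unused one holds `0`
and the root is at least `r + 1` for a tie `r` in `S`. So the root names the last, that is, the
worst tie that contains partners. -/
theorem exists_node_one (h : TreeInv n node leaf free nf S) (hS : S.Nonempty) :
    ∃ r ∈ S, node 1 = r + 1 := by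
  obtain ⟨r, hr⟩ := hS
  have hr' := h.le_node_one hr
  have hn : 0 < n := by have := h.used r hr; omega
  obtain ⟨j, hj, hj'⟩ := exists_leaf h.inner 1 le_rfl (by omega)
  rcases h.cover j hj with ⟨i, hi, rfl⟩ | ⟨r', hr', rfl⟩
  · have := (h.unused i hi).2; omega
  · exact ⟨r', hr', by rw [hj', (h.used r' hr').2]⟩

/-- The new leaf is the top of the stack of unused leaves. The stack is not empty because `nf +
S.card = n`, and the top is not the leaf of another tie because unused leaves hold `0` and used ones
a positive number. -/
theorem alloc {node' : ℕ → ℕ} (h : TreeInv n node leaf free nf S) {r : ℕ} (hr : r ∉ S)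
    (hn : S.card < n)
    (hinner : ∀ i, 1 ≤ i → i < n → node' i = max (node' (2 * i)) (node' (2 * i + 1)))
    (hj : node' (n + free (nf - 1)) = r + 1)
    (hother : ∀ j, j ≠ free (nf - 1) → node' (n + j) = node (n + j)) :
    TreeInv n node' (Function.update leaf r (free (nf - 1))) free (nf - 1) (insert r S) := by
  have hc := h.card
  have hlt : nf - 1 < nf := by omega
  have hf := h.unused _ hlt
  refine ⟨hinner, ?_, ?_, fun i hi j hj => h.inj i (by omega) j (by omega), ?_, ?_⟩
  · intro r' hr'
    rcases Finset.mem_insert.1 hr' with rfl | hr'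
    · simpa using ⟨hf.1, hj⟩
    · have hne : r' ≠ r := fun e => hr (e ▸ hr')
      have hu := h.used r' hr'
      rw [Function.update_of_ne hne]
      refine ⟨hu.1, ?_⟩
      rw [hother, hu.2]
      intro e
      rw [e] at hu
      omega
  · intro i hi
    have hu := h.unused i (by omega)
    refine ⟨hu.1, ?_⟩
    rw [hother, hu.2]
    intro e
    have := h.inj i (by omega) _ hlt e
    omega
  · intro j hj
    rcases h.cover j hj with ⟨i, hi, rfl⟩ | ⟨r', hr', rfl⟩
    · by_cases hi' : i = nf - 1
      · exact Or.inr ⟨r, by simp, by simp [hi']⟩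
      · exact Or.inl ⟨i, by omega, rfl⟩
    · have hne : r' ≠ r := fun e => hr (e ▸ hr')
      exact Or.inr ⟨r', by simp [hr'], by simp [hne]⟩
  · rw [Finset.card_insert_of_notMem hr]
    omega

/-- The freed leaf is not on the stack already, since it held a positive number; so the entries of
the stack remain distinct. -/
theorem release {node' : ℕ → ℕ} (h : TreeInv n node leaf free nf S) {r : ℕ} (hr : r ∈ S)
    (hinner : ∀ i, 1 ≤ i → i < n → node' i = max (node' (2 * i)) (node' (2 * i + 1)))
    (hj : node' (n + leaf r) = 0)
    (hother : ∀ j, j ≠ leaf r → node' (n + j) = node (n + j)) :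
    TreeInv n node' leaf (Function.update free nf (leaf r)) (nf + 1) (S.erase r) := by
  have hu := h.used r hr
  have hfree : ∀ i < nf, free i ≠ leaf r := fun i hi e => by
    have := h.unused i hi
    rw [e] at this
    omega
  refine ⟨hinner, ?_, ?_, ?_, ?_, ?_⟩
  · intro r' hr'
    obtain ⟨hne, hr'⟩ := Finset.mem_erase.1 hr'
    have hu' := h.used r' hr'
    refine ⟨hu'.1, ?_⟩
    rw [hother, hu'.2]
    intro e
    rw [e] at hu'
    omega
  · intro i hi
    rcases Nat.lt_or_ge i nf with h' | h'
    · have := h.unused i h'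
      rw [Function.update_of_ne (by omega), hother _ (hfree i h')]
      exact this
    · obtain rfl : i = nf := by omega
      simpa using ⟨hu.1, hj⟩
  · intro i hi j hj e
    rcases Nat.lt_or_ge i nf with h1 | h1 <;> rcases Nat.lt_or_ge j nf with h2 | h2
    · rw [Function.update_of_ne (by omega), Function.update_of_ne (by omega)] at e
      exact h.inj i h1 j h2 e
    · obtain rfl : j = nf := by omega
      rw [Function.update_of_ne (by omega), Function.update_self] at e
      exact absurd e (hfree i h1)
    · obtain rfl : i = nf := by omega
      rw [Function.update_of_ne (by omega : j ≠ i), Function.update_self] at e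
      exact absurd e.symm (hfree j h2)
    · omega
  · intro j hj
    by_cases hjr : j = leaf r
    · exact Or.inl ⟨nf, by omega, by simp [hjr]⟩
    · rcases h.cover j hj with ⟨i, hi, rfl⟩ | ⟨r', hr', rfl⟩
      · exact Or.inl ⟨i, by omega, by rw [Function.update_of_ne (by omega)]⟩
      · exact Or.inr ⟨r', Finset.mem_erase.2 ⟨fun e => hjr (by rw [e]), hr'⟩, rfl⟩
  · rw [Finset.card_erase_of_mem hr]
    have := h.card
    have := Finset.card_pos.2 ⟨r, hr⟩
    omega

end TreeInv

/-! ### Updating a tournament tree along the path to the root -/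

section Pull

variable {I : Instance}

/-- Only nodes of the tournament tree of `w`, and the time, may have changed. -/
structure SameButNodes (w : Fin I.nW) (s s' : Machine I) : Prop where
  num : ∀ c, (∀ i, c ≠ .node w i) → s'.num c = s.num c
  lstU : s'.lstU = s.lstU
  lstW : s'.lstW = s.lstW

/-- The maximum equation may fail only at the parent of the node just changed. Repairing it there
moves the only possible defect one level up, until it leaves the tree. -/
theorem wp_pull (w : Fin I.nW) (n k i : ℕ) (s : Machine I) (hik : i ≤ k) (hi1 : 1 ≤ i)
    (hi : i < 2 * n)
    (hinner : ∀ i', 1 ≤ i' → i' < n → i' ≠ i / 2 → s.num (.node w i') =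
      max (s.num (.node w (2 * i'))) (s.num (.node w (2 * i' + 1)))) :
    wp (pull w k i) (fun _ s' => SameButNodes w s s' ∧
      (∀ j, n ≤ j → s'.num (.node w j) = s.num (.node w j)) ∧
      (∀ i', 1 ≤ i' → i' < n → s'.num (.node w i') =
        max (s'.num (.node w (2 * i'))) (s'.num (.node w (2 * i' + 1)))) ∧
      s'.time ≤ s.time + 3 * Nat.log 2 i + 1) s := by
  induction k generalizing i s with
  | zero => omega
  | succ k ih =>
    rw [pull]
    refine wp_ite (fun h => ?_) (fun h => ?_)
    · have : i / 2 = 0 := by omega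
      refine ⟨⟨fun _ _ => rfl, rfl, rfl⟩, fun _ _ => rfl, ?_, ?_⟩
      · intro i' h1 h2
        exact hinner i' h1 h2 (by omega)
      · show s.time + 1 ≤ _
        omega
    · simp only [wp_bind, wp_load, wp_store]
      refine wp_mono (ih (i / 2) _ (by omega) (by omega) (by omega) ?_) ?_
      · intro i' h1 h2 h3
        simp only [Function.update_apply, NumCell.node.injEq, true_and]
        -- Overwriting node `i / 2` affects its own equation and that of its parent. The parent is
        -- the exception allowed to the recursive call.
        have e1 : 2 * i' ≠ i / 2 := by omega
        have e2 : 2 * i' + 1 ≠ i / 2 := by omega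
        rw [if_neg e1, if_neg e2]
        split_ifs with h4
        · rw [h4]
        · exact hinner i' h1 h2 h4
      · rintro _ s' ⟨hs, hl, hin, ht⟩
        refine ⟨⟨fun c hc => ?_, hs.lstU, hs.lstW⟩, fun j hj => ?_, hin, ?_⟩
        · rw [hs.num c hc]
          exact Function.update_of_ne (hc _) _ _
        · rw [hl j hj]
          exact Function.update_of_ne (by simp; omega) _ _
        · have : Nat.log 2 i = Nat.log 2 (i / 2) + 1 :=
            Nat.log_of_one_lt_of_le (by omega) (by omega)
          simp only at ht
          omega

theorem wp_setLeaf (w : Fin I.nW) (j v : ℕ) (s : Machine I) (hj : j < s.num (.size w))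
    (hinner : ∀ i', 1 ≤ i' → i' < s.num (.size w) → s.num (.node w i') =
      max (s.num (.node w (2 * i'))) (s.num (.node w (2 * i' + 1)))) :
    wp (setLeaf w j v) (fun _ s' => SameButNodes w s s' ∧
      s'.num (.node w (s.num (.size w) + j)) = v ∧
      (∀ j', j' ≠ j → s'.num (.node w (s.num (.size w) + j')) =
        s.num (.node w (s.num (.size w) + j'))) ∧
      (∀ i', 1 ≤ i' → i' < s.num (.size w) → s'.num (.node w i') =
        max (s'.num (.node w (2 * i'))) (s'.num (.node w (2 * i' + 1)))) ∧
      s'.time ≤ s.time + 3 * Nat.log 2 (s.num (.size w)) + 6) s := by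
  set n := s.num (.size w) with hn
  simp only [setLeaf, wp_bind, wp_load, wp_store, ← hn]
  refine wp_mono (wp_pull w n _ _ _ le_rfl (by omega) (by omega) ?_) ?_
  · intro i' h1 h2 h3
    simp only [Function.update_apply, NumCell.node.injEq, true_and]
    rw [if_neg (by omega), if_neg (by omega), if_neg (by omega)]
    exact hinner i' h1 h2
  · rintro _ s' ⟨hs, hl, hin, ht⟩
    refine ⟨⟨fun c hc => ?_, hs.lstU, hs.lstW⟩, ?_, fun j' hj' => ?_, hin, ?_⟩
    · rw [hs.num c hc]
      exact Function.update_of_ne (hc _) _ _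
    · rw [hl _ (by omega)]
      simp
    · rw [hl _ (by omega)]
      exact Function.update_of_ne (by simpa using hj') _ _
    · have : Nat.log 2 (n + j) ≤ Nat.log 2 n + 1 := by
        rw [← Nat.log_mul_base (by norm_num) (by omega)]
        exact Nat.log_mono_right (by omega)
      simp only at ht
      omega

end Pull
end ASBM

namespace ASBM

/-! ## Abstract contents of the memory -/

/-- What the memory represents: the matching `M`, the pairs `F` counted as free (`w` unsaturated
and not matched with `u`), the pairs `T` in the tie-lists, and the lists. -/
structure Ghost (I : Instance) where
  M : Finset (Fin I.nU × Fin I.nW)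
  F : Finset (Fin I.nU × Fin I.nW)
  T : Finset (Fin I.nU × Fin I.nW)
  L : Fin I.nU → Finset (Fin I.nW)
  ptr : Fin I.nU → ℕ
  sat : Fin I.nW → List (Fin I.nU)
  stack : List (Fin I.nU)
  again : Fin I.nU → List (Fin I.nW)
  second : Fin I.nU → List (Fin I.nW)

variable {I : Instance}

/-- The agents that occur as first components of free pairs. -/
def live (F : Finset (Fin I.nU × Fin I.nW)) : Finset (Fin I.nU) := F.image Prod.fst

variable (I) in
/-- The positions on the list of `w` of the ties that contain partners of `w`. -/
def ranks (M : Finset (Fin I.nU × Fin I.nW)) (w : Fin I.nW) : Finset ℕ :=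
  (M.filter fun e => e.2 = w).image fun e => rankW I w e.1

/-- The machine represents `G`, except that the priority queues hold the matching `Mq`, that the
agents in `Q w` are first in the lists of the queue of `w`, and that the pairs in `Ft` are first
in the tie-lists. -/
structure Rep' (s : Machine I) (Mq : Finset (Fin I.nU × Fin I.nW)) (Q : Fin I.nW → Finset (Fin I.nU))
    (Ft : Finset (Fin I.nU × Fin I.nW)) (G : Ghost I) : Prop where
  rkU : ∀ u w, Edge I u w → s.num (.rkU u w) = rankU I u w
  rkW : ∀ u w, Edge I u w → s.num (.rkW w u) = rankW I w u
  size : ∀ w, s.num (.size w) = min (I.capW w) (I.prefW w).flatten.length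
  inM : ∀ u w, s.num (.inM u w) = if (u, w) ∈ G.M then 1 else 0
  inL : ∀ u w, s.num (.inL u w) = if w ∈ G.L u then 1 else 0
  degU : ∀ u, s.num (.degU u) = (G.M.filter fun e => e.1 = u).card
  degW : ∀ w, s.num (.degW w) = (G.M.filter fun e => e.2 = w).card
  cnt : ∀ u, s.num (.cnt u) = (G.F.filter fun e => e.1 = u).card
  tieCnt : ∀ u r, s.num (.tieCnt u r) =
    (G.F.filter fun e => e.1 = u ∧ rankU I u e.2 = r).card
  ptr : ∀ u, s.num (.ptr u) = G.ptr u
  tree : ∀ w, TreeInv (s.num (.size w)) (fun i => s.num (.node w i)) (fun r => s.num (.leaf w r))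
    (fun i => s.num (.free w i)) (s.num (.numFree w)) (ranks I Mq w)
  queue_nodup : ∀ w r, (s.lstU (.queue w r)).Nodup
  mem_queue : ∀ w r u, u ∈ s.lstU (.queue w r) ↔ (u, w) ∈ Mq ∧ rankW I w u = r
  queue_order : ∀ w r, (s.lstU (.queue w r)).Pairwise fun a b => b ∈ Q w → a ∈ Q w
  sat : ∀ w, s.lstU (.sat w) = G.sat w
  stack : s.lstU .stack = G.stack
  tie_nodup : ∀ u r, (s.lstW (.tie u r)).Nodup
  mem_tie : ∀ u r w, w ∈ s.lstW (.tie u r) ↔ (u, w) ∈ G.T ∧ rankU I u w = r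
  tie_order : ∀ u r, (s.lstW (.tie u r)).Pairwise fun a b => (u, b) ∈ Ft → (u, a) ∈ Ft
  again : ∀ u, s.lstW (.again u) = G.again u
  second : ∀ u, s.lstW (.second u) = G.second u

/-- The machine represents `G`. -/
abbrev Rep (s : Machine I) (G : Ghost I) : Prop := Rep' s G.M (fun _ => live G.F) G.F G

section

variable {s : Machine I} {Mq Ft : Finset (Fin I.nU × Fin I.nW)} {Q : Fin I.nW → Finset (Fin I.nU)}
  {G : Ghost I}

theorem Rep'.time (h : Rep' s Mq Q Ft G) (t : ℕ) : Rep' { s with time := t } Mq Q Ft G :=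
  { h with }

theorem filter_fst_insert_card {M : Finset (Fin I.nU × Fin I.nW)} {u : Fin I.nU} {w : Fin I.nW}
    (h : (u, w) ∉ M) (u' : Fin I.nU) : ((insert (u, w) M).filter fun e => e.1 = u').card =
      (M.filter fun e => e.1 = u').card + if u' = u then 1 else 0 := by
  rw [Finset.filter_insert]
  split_ifs with h1 h2 h2
  · rw [Finset.card_insert_of_notMem (by simp [h])]
  · exact absurd h1.symm h2
  · exact absurd h2.symm h1
  · rfl

theorem filter_snd_insert_card {M : Finset (Fin I.nU × Fin I.nW)} {u : Fin I.nU} {w : Fin I.nW}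
    (h : (u, w) ∉ M) (w' : Fin I.nW) : ((insert (u, w) M).filter fun e => e.2 = w').card =
      (M.filter fun e => e.2 = w').card + if w' = w then 1 else 0 := by
  rw [Finset.filter_insert]
  split_ifs with h1 h2 h2
  · rw [Finset.card_insert_of_notMem (by simp [h])]
  · exact absurd h1.symm h2
  · exact absurd h2.symm h1
  · rfl

theorem filter_fst_erase_card {M : Finset (Fin I.nU × Fin I.nW)} {u : Fin I.nU} {w : Fin I.nW}
    (h : (u, w) ∈ M) (u' : Fin I.nU) : ((M.erase (u, w)).filter fun e => e.1 = u').card +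
      (if u' = u then 1 else 0) = (M.filter fun e => e.1 = u').card := by
  have := filter_fst_insert_card (Finset.notMem_erase (u, w) M) u'
  rw [Finset.insert_erase h] at this
  exact this.symm

theorem filter_snd_erase_card {M : Finset (Fin I.nU × Fin I.nW)} {u : Fin I.nU} {w : Fin I.nW}
    (h : (u, w) ∈ M) (w' : Fin I.nW) : ((M.erase (u, w)).filter fun e => e.2 = w').card +
      (if w' = w then 1 else 0) = (M.filter fun e => e.2 = w').card := by
  have := filter_snd_insert_card (Finset.notMem_erase (u, w) M) w'
  rw [Finset.insert_erase h] at this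
  exact this.symm

theorem mem_ranks {M : Finset (Fin I.nU × Fin I.nW)} {w : Fin I.nW} {r : ℕ} :
    r ∈ ranks I M w ↔ ∃ u, (u, w) ∈ M ∧ rankW I w u = r := by
  simp [ranks]

theorem ranks_insert (M : Finset (Fin I.nU × Fin I.nW)) (u : Fin I.nU) (w w' : Fin I.nW) :
    ranks I (insert (u, w) M) w' =
      if w' = w then insert (rankW I w u) (ranks I M w') else ranks I M w' := by
  ext r
  split_ifs with h
  · subst h
    simp only [mem_ranks, Finset.mem_insert, Prod.mk.injEq, and_true]
    constructor
    · rintro ⟨u', rfl | h, rfl⟩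
      exacts [Or.inl rfl, Or.inr ⟨u', h, rfl⟩]
    · rintro (rfl | ⟨u', h, rfl⟩)
      exacts [⟨u, Or.inl rfl, rfl⟩, ⟨u', Or.inr h, rfl⟩]
  · simp [mem_ranks, h]

theorem mem_live {F : Finset (Fin I.nU × Fin I.nW)} {u : Fin I.nU} :
    u ∈ live F ↔ ∃ w, (u, w) ∈ F := by
  simp [live]

theorem Rep'.cnt_pos (h : Rep' s Mq Q Ft G) {u : Fin I.nU} :
    0 < s.num (.cnt u) ↔ u ∈ live G.F := by
  rw [h.cnt, Finset.card_pos, mem_live]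
  constructor
  · rintro ⟨⟨u', w⟩, he⟩
    obtain ⟨h1, rfl⟩ := Finset.mem_filter.1 he
    exact ⟨w, h1⟩
  · rintro ⟨w, hw⟩
    exact ⟨(u, w), by simp [hw]⟩

/-- The order inside a queue only concerns agents who are in it, so membership of others in `Q w` is
irrelevant. -/
theorem Rep'.congr_queue {Q' : Fin I.nW → Finset (Fin I.nU)} (h : Rep' s Mq Q Ft G)
    (hQ : ∀ u w, (u, w) ∈ Mq → (u ∈ Q w ↔ u ∈ Q' w)) : Rep' s Mq Q' Ft G :=
  { h with
    queue_order := fun w r => (h.queue_order w r).imp_of_mem fun ha hb hab => by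
      rw [← hQ _ _ ((h.mem_queue _ _ _).1 ha).1, ← hQ _ _ ((h.mem_queue _ _ _).1 hb).1]
      exact hab }

theorem Rep'.congr_tie {Ft' : Finset (Fin I.nU × Fin I.nW)} (h : Rep' s Mq Q Ft G)
    (hF : ∀ e ∈ G.T, e ∈ Ft ↔ e ∈ Ft') : Rep' s Mq Q Ft' G :=
  { h with
    tie_order := fun w r => (h.tie_order w r).imp_of_mem fun ha hb hab => by
      rw [← hF _ ((h.mem_tie _ _ _).1 ha).1, ← hF _ ((h.mem_tie _ _ _).1 hb).1]
      exact hab }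

/-! ## Linking and unlinking -/

/-- After this phase the tables already contain the new pair, while the queues still hold the
matching `Mq`. -/
theorem wp_linkMatching (h : Rep' s Mq Q Ft G) {u : Fin I.nU} {w : Fin I.nW} (huw : (u, w) ∉ G.M) :
    wp (do store (.inM u w) 1; incr (.degU u); incr (.degW w))
      (fun _ s' => Rep' s' Mq Q Ft { G with M := insert (u, w) G.M } ∧ s'.time ≤ s.time + 5) s := by
  simp only [wp_bind, wp_store, wp_incr]
  refine ⟨{ h with inM := ?_, degU := ?_, degW := ?_ }, le_rfl⟩
  · intro u' w'
    have := h.inM u' w'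
    simp only [Function.update_apply, reduceCtorEq, if_false, NumCell.inM.injEq, this,
      Finset.mem_insert, Prod.mk.injEq]
    split_ifs <;> simp_all
  · intro u'
    have h1 := h.degU u'
    have h2 := h.degU u
    simp only [Function.update_apply, reduceCtorEq, if_false, NumCell.degU.injEq, h1, h2,
      filter_fst_insert_card huw]
    split_ifs with h3
    · rw [h3]
    · rfl
  · intro w'
    have h1 := h.degW w'
    have h2 := h.degW w
    simp only [Function.update_apply, reduceCtorEq, if_false, NumCell.degW.injEq, h1, h2,
      filter_snd_insert_card huw]
    split_ifs with h3
    · rw [h3]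
    · rfl

theorem wp_unlinkMatching (h : Rep' s Mq Q Ft G) {u : Fin I.nU} {w : Fin I.nW} (huw : (u, w) ∈ G.M) :
    wp (do store (.inM u w) 0; decr (.degU u); decr (.degW w))
      (fun _ s' => Rep' s' Mq Q Ft { G with M := G.M.erase (u, w) } ∧
        s'.lstW = s.lstW ∧ s'.time ≤ s.time + 5) s := by
  simp only [wp_bind, wp_store, wp_decr]
  refine ⟨{ h with inM := ?_, degU := ?_, degW := ?_ }, trivial, le_rfl⟩
  · intro u' w'
    have := h.inM u' w'
    simp only [Function.update_apply, reduceCtorEq, if_false, NumCell.inM.injEq, this,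
      Finset.mem_erase, Prod.mk.injEq, ne_eq]
    split_ifs <;> simp_all
  · intro u'
    have h1 := h.degU u'
    have h2 := h.degU u
    have h3 := filter_fst_erase_card huw u'
    simp only [Function.update_apply, reduceCtorEq, if_false, NumCell.degU.injEq, h1, h2]
    split_ifs at h3 ⊢ with h4
    · subst h4; omega
    · omega
  · intro w'
    have h1 := h.degW w'
    have h2 := h.degW w
    have h3 := filter_snd_erase_card huw w'
    simp only [Function.update_apply, reduceCtorEq, if_false, NumCell.degW.injEq, h1, h2]
    split_ifs at h3 ⊢ with h4
    · subst h4; omega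
    · omega

theorem update_queue (f : UCell I → List (Fin I.nU)) (w w' : Fin I.nW) (r r' : ℕ)
    (l : List (Fin I.nU)) : Function.update f (.queue w r) l (.queue w' r') =
      if w' = w ∧ r' = r then l else f (.queue w' r') := by
  simp [Function.update_apply]

theorem Rep'.log_size (h : Rep' s Mq Q Ft G) (w : Fin I.nW) :
    Nat.log 2 (s.num (.size w)) ≤ Nat.log 2 (I.capW w) := by
  rw [h.size]
  exact Nat.log_mono_right (min_le_left _ _)

/-- The cells of the tournament tree of `w`. -/
def IsTreeCell (w : Fin I.nW) : NumCell I → Prop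
  | .node w' _ => w' = w
  | .leaf w' _ => w' = w
  | .free w' _ => w' = w
  | .numFree w' => w' = w
  | _ => False

/-- Frame rule for priority queues: a change confined to the tree of `w` and to the queue lists
leaves all other clauses of `Rep'` intact. -/
theorem Rep'.change_tree {s' : Machine I} {Mq' : Finset (Fin I.nU × Fin I.nW)} {w : Fin I.nW}
    (h : Rep' s Mq Q Ft G) (hnum : ∀ c, ¬ IsTreeCell w c → s'.num c = s.num c)
    (htree : TreeInv (s'.num (.size w)) (fun i => s'.num (.node w i)) (fun r => s'.num (.leaf w r))
      (fun i => s'.num (.free w i)) (s'.num (.numFree w)) (ranks I Mq' w))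
    (hranks : ∀ w', w' ≠ w → ranks I Mq' w' = ranks I Mq w')
    (q1 : ∀ w r, (s'.lstU (.queue w r)).Nodup)
    (q2 : ∀ w r u, u ∈ s'.lstU (.queue w r) ↔ (u, w) ∈ Mq' ∧ rankW I w u = r)
    (q3 : ∀ w r, (s'.lstU (.queue w r)).Pairwise fun a b => b ∈ Q w → a ∈ Q w)
    (hU : ∀ c, (∀ w r, c ≠ .queue w r) → s'.lstU c = s.lstU c)
    (hW : s'.lstW = s.lstW) : Rep' s' Mq' Q Ft G where
  rkU u' w' hh := by rw [hnum _ id]; exact h.rkU _ _ hh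
  rkW u' w' hh := by rw [hnum _ id]; exact h.rkW _ _ hh
  size _ := by rw [hnum _ id]; exact h.size _
  inM _ _ := by rw [hnum _ id]; exact h.inM _ _
  inL _ _ := by rw [hnum _ id]; exact h.inL _ _
  degU _ := by rw [hnum _ id]; exact h.degU _
  degW _ := by rw [hnum _ id]; exact h.degW _
  cnt _ := by rw [hnum _ id]; exact h.cnt _
  tieCnt _ _ := by rw [hnum _ id]; exact h.tieCnt _ _
  ptr _ := by rw [hnum _ id]; exact h.ptr _
  tree w' := by
    by_cases hw : w' = w
    · exact hw ▸ htree
    · rw [hranks w' hw]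
      convert h.tree w' using 1
      · exact hnum _ id
      · exact funext fun _ => hnum _ hw
      · exact funext fun _ => hnum _ hw
      · exact funext fun _ => hnum _ hw
      · exact hnum _ hw
  queue_nodup := q1
  mem_queue := q2
  queue_order := q3
  sat _ := by rw [hU _ (by simp)]; exact h.sat _
  stack := by rw [hU _ (by simp)]; exact h.stack
  tie_nodup := by rw [hW]; exact h.tie_nodup
  mem_tie := by rw [hW]; exact h.mem_tie
  tie_order := by rw [hW]; exact h.tie_order
  again := by rw [hW]; exact h.again
  second := by rw [hW]; exact h.second

theorem Rep'.mem_ranks_iff (h : Rep' s Mq Q Ft G) {w : Fin I.nW} {r : ℕ} :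
    r ∈ ranks I Mq w ↔ s.lstU (.queue w r) ≠ [] := by
  simp only [mem_ranks, ← h.mem_queue, List.ne_nil_iff_exists_cons]
  constructor
  · rintro ⟨u, hu⟩
    obtain ⟨a, l, hl⟩ := List.exists_cons_of_ne_nil (List.ne_nil_of_mem hu)
    exact ⟨a, l, hl⟩
  · rintro ⟨a, l, hl⟩
    exact ⟨a, by simp [hl]⟩

/-- Entering `u` in the priority queue of `w`. -/
def linkQueue (u : Fin I.nU) (w : Fin I.nW) : Prog I Unit := do
  let r ← load (.rkW w u)
  let h ← headU (.queue w r)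
  let c ← load (.cnt u)
  if 0 < c then pushFrontU (.queue w r) u else pushBackU (.queue w r) u
  if h = none then
    decr (.numFree w)
    let k ← load (.numFree w)
    let j ← load (.free w k)
    store (.leaf w r) j
    setLeaf w j (r + 1)

/-- The bound `hcard` guarantees an unused leaf, and `hQ` says that the counter of `u`, by which the
program chooses between front and back, decides correctly for the order of this queue. -/
theorem wp_linkQueue (h : Rep' s Mq Q Ft G) {u : Fin I.nU} {w : Fin I.nW} (he : Edge I u w)
    (huw : (u, w) ∉ Mq) (hQ : u ∈ Q w ↔ u ∈ live G.F)
    (hcard : (Mq.filter fun e => e.2 = w).card < min (I.capW w) (I.prefW w).flatten.length) :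
    wp (linkQueue u w) (fun _ s' => Rep' s' (insert (u, w) Mq) Q Ft G ∧
      s'.time ≤ s.time + 3 * Nat.log 2 (I.capW w) + 15) s := by
  have hrk := h.rkW u w he
  set r := rankW I w u with hr
  have hlog := h.log_size w
  simp only [linkQueue, wp_bind, wp_load, wp_headU, hrk]
  have key : ∀ nl t, (u ∈ Q w ∧ nl = u :: s.lstU (.queue w r)) ∨
      (u ∉ Q w ∧ nl = s.lstU (.queue w r) ++ [u]) → t = s.time + 4 →
      wp (if (s.lstU (.queue w r)).head? = none then do
            decr (.numFree w)
            let k ← load (.numFree w)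
            let j ← load (.free w k)
            store (.leaf w r) j
            setLeaf w j (r + 1) else pure ())
        (fun _ s' => Rep' s' (insert (u, w) Mq) Q Ft G ∧
          s'.time ≤ s.time + 3 * Nat.log 2 (I.capW w) + 15)
        ⟨s.num, Function.update s.lstU (.queue w r) nl, s.lstW, t⟩ := by
    intro nl t hnl ht
    have hu : u ∉ s.lstU (.queue w r) := fun h' => huw ((h.mem_queue _ _ _).1 h').1
    have q1 : ∀ w' r', (Function.update s.lstU (.queue w r) nl (.queue w' r')).Nodup := by
      intro w' r'
      rw [update_queue]
      split_ifs with hc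
      · rcases hnl with ⟨-, rfl⟩ | ⟨-, rfl⟩
        · exact List.nodup_cons.2 ⟨hu, h.queue_nodup _ _⟩
        · exact List.Nodup.append (h.queue_nodup _ _) (by simp) (by simpa using hu)
      · exact h.queue_nodup _ _
    have q2 : ∀ w' r' u', u' ∈ Function.update s.lstU (.queue w r) nl (.queue w' r') ↔
        (u', w') ∈ insert (u, w) Mq ∧ rankW I w' u' = r' := by
      intro w' r' u'
      rw [update_queue, Finset.mem_insert, Prod.mk.injEq]
      have hm := h.mem_queue w' r' u'
      split_ifs with hc
      · obtain ⟨rfl, rfl⟩ := hc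
        have : u' ∈ nl ↔ u' = u ∨ u' ∈ s.lstU (.queue w' r) := by
          rcases hnl with ⟨-, rfl⟩ | ⟨-, rfl⟩ <;> simp [or_comm]
        rw [this, hm]
        constructor
        · rintro (rfl | h')
          exacts [⟨Or.inl ⟨rfl, rfl⟩, hr.symm⟩, ⟨Or.inr h'.1, h'.2⟩]
        · rintro ⟨⟨rfl, -⟩ | h1, h2⟩
          exacts [Or.inl rfl, Or.inr ⟨h1, h2⟩]
      · rw [hm]
        constructor
        · rintro ⟨h1, h2⟩
          exact ⟨Or.inr h1, h2⟩
        · rintro ⟨⟨rfl, rfl⟩ | h1, h2⟩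
          exacts [absurd ⟨rfl, h2.symm⟩ hc, ⟨h1, h2⟩]
    have q3 : ∀ w' r', (Function.update s.lstU (.queue w r) nl (.queue w' r')).Pairwise
        fun a b => b ∈ Q w' → a ∈ Q w' := by
      intro w' r'
      rw [update_queue]
      split_ifs with hc
      · obtain ⟨rfl, rfl⟩ := hc
        rcases hnl with ⟨hq, rfl⟩ | ⟨hq, rfl⟩
        · exact List.pairwise_cons.2 ⟨fun _ _ _ => hq, h.queue_order _ _⟩
        · refine List.pairwise_append.2 ⟨h.queue_order _ _, by simp, fun a _ b hb hb' => ?_⟩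
          rw [List.mem_singleton.1 hb] at hb'
          exact absurd hb' hq
      · exact h.queue_order _ _
    have hrm : r ∈ ranks I Mq w ↔ s.lstU (.queue w r) ≠ [] := by
      exact h.mem_ranks_iff
    refine wp_ite (fun hn => ?_) (fun hn => ?_)
    · rw [List.head?_eq_none_iff] at hn
      have hrn : r ∉ ranks I Mq w := fun h' => hrm.1 h' hn
      have hT := h.tree w
      -- Different ties need different partners, so there are at most as many ties in use as
      -- partners.
      have hc : (ranks I Mq w).card < s.num (.size w) := by
        rw [h.size]
        exact lt_of_le_of_lt Finset.card_image_le hcard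
      have hcT := hT.card
      have hfree := hT.unused (s.num (.numFree w) - 1) (by omega)
      simp only [wp_bind, wp_decr, wp_load, wp_store]
      refine wp_mono (wp_setLeaf w _ (r + 1) _ ?_ ?_) ?_
      · simpa [Function.update_apply] using hfree.1
      · simpa [Function.update_apply] using hT.inner
      · rintro _ s' ⟨hs, h1, h2, h3, h4⟩
        simp only [Function.update_apply, reduceCtorEq, if_false, if_true] at h1 h2 h3 h4
        have hsn : ∀ c, (∀ i, c ≠ .node w i) → s'.num c = _ := hs.num
        have hnum : ∀ c, (∀ i, c ≠ .node w i) → c ≠ .numFree w → c ≠ .leaf w r →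
            s'.num c = s.num c := by
          intro c c1 c2 c3
          rw [hs.num c c1]
          simp only [Function.update_of_ne c2, Function.update_of_ne c3]
        refine ⟨?_, ?_⟩
        · have hT' := hT.alloc hrn hc (node' := fun i => s'.num (.node w i)) h3 h1 h2
          have hl : s'.lstU = Function.update s.lstU (.queue w r) nl := hs.lstU
          rw [← hl] at q1 q2 q3
          refine h.change_tree (w := w) ?_ ?_ ?_ q1 q2 q3 (fun c hc => ?_) hs.lstW
          · intro c hc
            refine hnum c ?_ ?_ ?_
            · rintro i rfl
              exact hc rfl
            · rintro rfl
              exact hc rfl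
            · rintro rfl
              exact hc rfl
          · rw [ranks_insert, if_pos rfl]
            convert hT' using 1
            · exact hnum _ (by simp) (by simp) (by simp)
            · funext r'
              rw [hs.num _ (by simp)]
              simp [Function.update_apply]
            · funext r'
              exact hnum _ (by simp) (by simp) (by simp)
            · rw [hs.num _ (by simp)]
              simp
          · intro w' hw
            rw [ranks_insert, if_neg hw]
          · rw [hs.lstU]
            exact Function.update_of_ne (hc _ _) _ _
        · omega
    · rw [wp_pure]
      -- The tie of `u` already has partners of `w`, so it owns a leaf and the tree stays as it is.
      refine ⟨{ h with tree := ?_, queue_nodup := q1, mem_queue := q2, queue_order := q3 }, ?_⟩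
      · intro w'
        rw [ranks_insert]
        split_ifs with hw
        · subst hw
          rw [Finset.insert_eq_of_mem (hrm.2 fun h' => hn (by rw [h']; rfl))]
          exact h.tree _
        · exact h.tree _
      · show t ≤ _
        omega
  refine wp_ite (fun hc => ?_) (fun hc => ?_)
  · exact key _ _ (Or.inl ⟨hQ.2 (h.cnt_pos.1 hc), rfl⟩) rfl
  · exact key _ _ (Or.inr ⟨fun h' => hc (h.cnt_pos.2 (hQ.1 h')), rfl⟩) rfl

/-- Entering `u`, if satellitic, in the list of satellitic partners of `w`. -/
def linkSat (u : Fin I.nU) (w : Fin I.nW) : Prog I Unit := do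
  let p ← load (.rkU u w)
  let t ← load (.tieCnt u p)
  if 0 < t then pushFrontU (.sat w) u

variable (I) in
/-- The number of free pairs of `u` in the tie at position `r`. -/
def tieNum (F : Finset (Fin I.nU × Fin I.nW)) (u : Fin I.nU) (r : ℕ) : ℕ :=
  (F.filter fun e => e.1 = u ∧ rankU I u e.2 = r).card

/-- The lists of satellitic partners after `u` and `w` have been linked. -/
def satPush (F : Finset (Fin I.nU × Fin I.nW)) (u : Fin I.nU) (w : Fin I.nW)
    (sat : Fin I.nW → List (Fin I.nU)) : Fin I.nW → List (Fin I.nU) :=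
  if 0 < tieNum I F u (rankU I u w) then Function.update sat w (u :: sat w) else sat

theorem wp_linkSat (h : Rep' s Mq Q Ft G) {u : Fin I.nU} {w : Fin I.nW} (he : Edge I u w) :
    wp (linkSat u w) (fun _ s' => Rep' s' Mq Q Ft { G with sat := satPush G.F u w G.sat } ∧
      s'.time ≤ s.time + 3) s := by
  simp only [linkSat, wp_bind, wp_load, h.rkU u w he, h.tieCnt]
  refine wp_ite (fun hc => ?_) (fun hc => ?_)
  · rw [wp_pushFrontU]
    have hp : satPush G.F u w G.sat = Function.update G.sat w (u :: G.sat w) := if_pos hc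
    refine ⟨{ h with sat := ?_ }, le_rfl⟩
    intro w'
    have h1 := h.sat w'
    have h2 := h.sat w
    simp only [hp, Function.update_apply, UCell.sat.injEq]
    split_ifs with hw
    · rw [h2]
    · exact h1
  · rw [wp_pure]
    have hp : satPush G.F u w G.sat = G.sat := if_neg hc
    exact ⟨{ h with sat := fun w' => (h.sat w').trans (congrFun hp.symm w') }, by simp⟩

/-- This cuts the program into three phases, so that each can be verified with its own intermediate
form of `Rep'`. -/
theorem link_eq (u : Fin I.nU) (w : Fin I.nW) : link u w = (do
    (do store (.inM u w) 1; incr (.degU u); incr (.degW w))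
    linkQueue u w
    linkSat u w) := by
  simp only [link, linkQueue, linkSat, bind_assoc]
  -- Three updates of tables and three read operations precede the conditionals, and they agree on
  -- both sides.
  iterate 6 refine bind_congr fun _ => ?_
  split_ifs <;> simp [bind_assoc]

theorem wp_link (h : Rep s G) {u : Fin I.nU} {w : Fin I.nW} (he : Edge I u w)
    (huw : (u, w) ∉ G.M)
    (hcard : (G.M.filter fun e => e.2 = w).card < min (I.capW w) (I.prefW w).flatten.length) :
    wp (link u w) (fun _ s' => Rep s' { G with
        M := insert (u, w) G.M, sat := satPush G.F u w G.sat } ∧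
      s'.time ≤ s.time + 3 * Nat.log 2 (I.capW w) + 23) s := by
  rw [link_eq, wp_bind]
  refine wp_mono (wp_linkMatching h huw) fun _ s1 h1 => ?_
  rw [wp_bind]
  refine wp_mono (wp_linkQueue h1.1 he huw Iff.rfl hcard) fun _ s2 h2 => ?_
  refine wp_mono (wp_linkSat h2.1 he) fun _ s3 h3 => ⟨h3.1, ?_⟩
  omega

/-- Removing `u` from the priority queue of `w`. -/
def unlinkQueue (u : Fin I.nU) (w : Fin I.nW) : Prog I Unit := do
  let r ← load (.rkW w u)
  eraseU (.queue w r) u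
  let h ← headU (.queue w r)
  if h = none then
    let j ← load (.leaf w r)
    setLeaf w j 0
    let k ← load (.numFree w)
    store (.free w k) j
    incr (.numFree w)

theorem unlink_eq (u : Fin I.nU) (w : Fin I.nW) : unlink u w = (do
    (do store (.inM u w) 0; decr (.degU u); decr (.degW w))
    unlinkQueue u w) := by
  simp only [unlink, unlinkQueue, bind_assoc]

theorem wp_unlinkQueue (h : Rep' s Mq Q Ft G) {u : Fin I.nU} {w : Fin I.nW} (he : Edge I u w)
    (huw : (u, w) ∈ Mq) :
    wp (unlinkQueue u w) (fun _ s' => Rep' s' (Mq.erase (u, w)) Q Ft G ∧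
      s'.lstW = s.lstW ∧ s'.time ≤ s.time + 3 * Nat.log 2 (I.capW w) + 14) s := by
  have hrk := h.rkW u w he
  set r := rankW I w u with hr
  have hlog := h.log_size w
  simp only [unlinkQueue, wp_bind, wp_load, wp_headU, wp_eraseU, hrk, Function.update_self]
  set nl := (s.lstU (.queue w r)).erase u with hnl
  have hnd := h.queue_nodup w r
  have q1 : ∀ w' r', (Function.update s.lstU (.queue w r) nl (.queue w' r')).Nodup := by
    intro w' r'
    rw [update_queue]
    split_ifs with hc
    · exact hnd.erase _
    · exact h.queue_nodup _ _
  have q2 : ∀ w' r' u', u' ∈ Function.update s.lstU (.queue w r) nl (.queue w' r') ↔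
      (u', w') ∈ Mq.erase (u, w) ∧ rankW I w' u' = r' := by
    intro w' r' u'
    rw [update_queue, Finset.mem_erase, Ne, Prod.mk.injEq]
    have hm := h.mem_queue w' r' u'
    split_ifs with hc
    · obtain ⟨rfl, rfl⟩ := hc
      rw [hnl, hnd.mem_erase_iff, hm]
      tauto
    · rw [hm]
      constructor
      · rintro ⟨h1, h2⟩
        refine ⟨⟨?_, h1⟩, h2⟩
        rintro ⟨rfl, rfl⟩
        exact hc ⟨rfl, h2.symm⟩
      · rintro ⟨⟨-, h1⟩, h2⟩
        exact ⟨h1, h2⟩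
  have q3 : ∀ w' r', (Function.update s.lstU (.queue w r) nl (.queue w' r')).Pairwise
      fun a b => b ∈ Q w' → a ∈ Q w' := by
    intro w' r'
    rw [update_queue]
    split_ifs with hc
    · obtain ⟨rfl, rfl⟩ := hc
      exact (h.queue_order _ _).sublist List.erase_sublist
    · exact h.queue_order _ _
  have hrm : r ∈ ranks I Mq w := mem_ranks.2 ⟨u, huw, rfl⟩
  -- The tie gives its leaf back exactly if `u` was the last partner of `w` in it.
  have hrm' : r ∈ ranks I (Mq.erase (u, w)) w ↔ nl ≠ [] := by
    have := q2 w r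
    rw [Function.update_self] at this
    simp only [mem_ranks, ← this]
    constructor
    · rintro ⟨u', hu'⟩
      exact List.ne_nil_of_mem hu'
    · intro hne
      obtain ⟨a, l, hl⟩ := List.exists_cons_of_ne_nil hne
      exact ⟨a, by simp [hl]⟩
  have hsub : ∀ w' r', r' ∈ ranks I Mq w' ↔ r' ∈ ranks I (Mq.erase (u, w)) w' ∨
      (w' = w ∧ r' = r) := by
    intro w' r'
    have := ranks_insert (Mq.erase (u, w)) u w w'
    rw [Finset.insert_erase huw] at this
    rw [this]
    split_ifs with hw
    · subst hw
      simp [or_comm, hr]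
    · simp [hw]
  refine wp_ite (fun hn => ?_) (fun hn => ?_)
  · rw [List.head?_eq_none_iff] at hn
    have hT := h.tree w
    have hu := hT.used r hrm
    have hranks : ranks I (Mq.erase (u, w)) w = (ranks I Mq w).erase r := by
      ext r'
      rw [Finset.mem_erase, hsub]
      constructor
      · intro h'
        exact ⟨fun e => hrm'.1 (e ▸ h') hn, Or.inl h'⟩
      · rintro ⟨h1, h2 | ⟨-, h2⟩⟩
        exacts [h2, absurd h2 h1]
    simp only [wp_bind, wp_incr, wp_load, wp_store]
    refine wp_mono (wp_setLeaf w _ 0 _ ?_ ?_) ?_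
    · simpa using hu.1
    · simpa using hT.inner
    · rintro _ s' ⟨hs, h1, h2, h3, h4⟩
      simp only at h1 h2 h3 h4
      have hsn : ∀ c, (∀ i, c ≠ .node w i) → s'.num c = s.num c := hs.num
      have hT' := hT.release hrm (node' := fun i => s'.num (.node w i)) h3 h1 h2
      refine ⟨?_, hs.lstW, ?_⟩
      · have hl : s'.lstU = Function.update s.lstU (.queue w r) nl := hs.lstU
        rw [← hl] at q1 q2 q3
        refine h.change_tree (w := w) ?_ ?_ ?_ q1 q2 q3 (fun c hc => ?_) hs.lstW
        · intro c hc
          have c1 : c ≠ .numFree w := by rintro rfl; exact hc rfl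
          have c2 : c ≠ .free w (s'.num (.numFree w)) := by rintro rfl; exact hc rfl
          simp only [Function.update_of_ne c1, Function.update_of_ne c2]
          refine hsn c ?_
          rintro i rfl
          exact hc rfl
        · rw [hranks]
          convert hT' using 1
          · simpa [Function.update_apply] using hsn _ (by simp)
          · funext r'
            simp
          · funext r'
            simpa [Function.update_apply] using hsn _ (by simp)
          · funext r'
            have e1 := hsn (.numFree w) (by simp)
            have e2 := hsn (.free w r') (by simp)
            simp [Function.update_apply, e1, e2]
          · have e1 := hsn (.numFree w) (by simp)
            simp [e1]
        · intro w' hw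
          ext r'
          rw [hsub]
          simp [hw]
        · show s'.lstU c = _
          rw [hs.lstU]
          exact Function.update_of_ne (hc _ _) _ _
      · show s'.time + 1 + 1 + 1 + 1 ≤ _
        omega
  · rw [wp_pure]
    refine ⟨{ h with tree := ?_, queue_nodup := q1, mem_queue := q2, queue_order := q3 }, rfl, ?_⟩
    · intro w'
      have : ranks I (Mq.erase (u, w)) w' = ranks I Mq w' := by
        ext r'
        rw [hsub]
        constructor
        · exact Or.inl
        · rintro (h' | ⟨rfl, rfl⟩)
          exacts [h', hrm'.2 fun h' => hn (by rw [h']; rfl)]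
      rw [this]
      exact h.tree _
    · show s.time + 1 + 1 + 1 ≤ _
      omega

theorem wp_unlink (h : Rep s G) {u : Fin I.nU} {w : Fin I.nW} (he : Edge I u w)
    (huw : (u, w) ∈ G.M) :
    wp (unlink u w) (fun _ s' => Rep s' { G with M := G.M.erase (u, w) } ∧
      s'.lstW = s.lstW ∧ s'.time ≤ s.time + 3 * Nat.log 2 (I.capW w) + 19) s := by
  rw [unlink_eq, wp_bind]
  refine wp_mono (wp_unlinkMatching h huw) fun _ s1 h1 => ?_
  refine wp_mono (wp_unlinkQueue h1.1 he huw) fun _ s2 h2 => ⟨h2.1, h2.2.1.trans h1.2.1, ?_⟩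
  omega

end
end ASBM

namespace ASBM

variable {I : Instance}

section

variable {s : Machine I} {Mq Ft : Finset (Fin I.nU × Fin I.nW)} {Q : Fin I.nW → Finset (Fin I.nU)}
  {G : Ghost I}

/-! ## Elementary operations on the abstract contents -/

theorem Rep'.store_inL (h : Rep' s Mq Q Ft G) (u : Fin I.nU) (w : Fin I.nW) (t : ℕ) :
    Rep' ⟨Function.update s.num (.inL u w) 0, s.lstU, s.lstW, t⟩ Mq Q Ft
      { G with L := Function.update G.L u ((G.L u).erase w) } := by
  refine { h with inL := ?_ }
  intro u' w'
  have := h.inL u' w'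
  simp only [Function.update_apply, NumCell.inL.injEq, this]
  by_cases h1 : u' = u
  · subst h1
    by_cases h2 : w' = w <;> simp [h2]
  · simp [h1]

theorem Rep'.pop_tie (h : Rep' s Mq Q Ft G) {u : Fin I.nU} {w : Fin I.nW} {r : ℕ}
    (hhead : (s.lstW (.tie u r)).head? = some w) (t : ℕ) :
    Rep' ⟨s.num, s.lstU, Function.update s.lstW (.tie u r) (s.lstW (.tie u r)).tail, t⟩ Mq Q Ft
      { G with T := G.T.erase (u, w) } := by
  obtain ⟨l, hl⟩ : ∃ l, s.lstW (.tie u r) = w :: l := by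
    rcases hh : s.lstW (.tie u r) with _ | ⟨a, l⟩
    · simp [hh] at hhead
    · rw [hh] at hhead
      exact ⟨l, by simp at hhead; rw [hhead]⟩
  have hnd := h.tie_nodup u r
  have hord := h.tie_order u r
  have hmem := h.mem_tie u r
  rw [hl] at hnd hord hmem
  have hup : ∀ u' r', Function.update s.lstW (.tie u r) (s.lstW (.tie u r)).tail (.tie u' r') =
      if u' = u ∧ r' = r then l else s.lstW (.tie u' r') := by
    intro u' r'
    simp [Function.update_apply, hl]
  refine { h with tie_nodup := ?_, mem_tie := ?_, tie_order := ?_ }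
  · intro u' r'
    dsimp only
    rw [hup]
    split_ifs
    exacts [hnd.of_cons, h.tie_nodup _ _]
  · intro u' r' w'
    dsimp only
    rw [hup, Finset.mem_erase, Ne, Prod.mk.injEq]
    split_ifs with hc
    · obtain ⟨rfl, rfl⟩ := hc
      have := hmem w'
      rw [List.mem_cons] at this
      have hw := (List.nodup_cons.1 hnd).1
      constructor
      · intro hw'
        obtain ⟨h1, h2⟩ := this.1 (Or.inr hw')
        refine ⟨⟨?_, h1⟩, h2⟩
        rintro ⟨-, rfl⟩
        exact hw hw'
      · rintro ⟨⟨h1, h2⟩, h3⟩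
        exact (this.2 ⟨h2, h3⟩).resolve_left fun e => h1 ⟨rfl, e⟩
    · rw [h.mem_tie]
      constructor
      · rintro ⟨h1, h2⟩
        refine ⟨⟨?_, h1⟩, h2⟩
        rintro ⟨rfl, rfl⟩
        exact hc ⟨rfl, h2.symm.trans ((hmem w').1 (by simp)).2⟩
      · rintro ⟨⟨-, h1⟩, h2⟩
        exact ⟨h1, h2⟩
  · intro u' r'
    dsimp only
    rw [hup]
    split_ifs with hc
    · obtain ⟨rfl, rfl⟩ := hc
      exact hord.of_cons
    · exact h.tie_order _ _

/-- Appending at the end preserves the order because the new pair does not belong to the pairs that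
have to come first. -/
theorem Rep'.push_tie (h : Rep' s Mq Q Ft G) {u : Fin I.nU} {w : Fin I.nW} (hT : (u, w) ∉ G.T)
    (hF : (u, w) ∉ Ft) {r : ℕ} (hr : rankU I u w = r) (t : ℕ) :
    Rep' ⟨s.num, s.lstU, Function.update s.lstW (.tie u r) (s.lstW (.tie u r) ++ [w]), t⟩ Mq Q Ft
      { G with T := insert (u, w) G.T } := by
  have hw : w ∉ s.lstW (.tie u r) := fun h' => hT ((h.mem_tie _ _ _).1 h').1
  have hup : ∀ u' r', Function.update s.lstW (.tie u r) (s.lstW (.tie u r) ++ [w]) (.tie u' r') =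
      if u' = u ∧ r' = r then s.lstW (.tie u r) ++ [w] else s.lstW (.tie u' r') := by
    intro u' r'
    simp [Function.update_apply]
  refine { h with tie_nodup := ?_, mem_tie := ?_, tie_order := ?_ }
  · intro u' r'
    dsimp only
    rw [hup]
    split_ifs
    exacts [(h.tie_nodup _ _).append (by simp) (by simpa using hw), h.tie_nodup _ _]
  · intro u' r' w'
    dsimp only
    rw [hup, Finset.mem_insert, Prod.mk.injEq]
    split_ifs with hc
    · obtain ⟨rfl, rfl⟩ := hc
      rw [List.mem_append, List.mem_singleton, h.mem_tie]
      constructor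
      · rintro (⟨h1, h2⟩ | rfl)
        exacts [⟨Or.inr h1, h2⟩, ⟨Or.inl ⟨rfl, rfl⟩, hr⟩]
      · rintro ⟨⟨-, rfl⟩ | h1, h2⟩
        exacts [Or.inr rfl, Or.inl ⟨h1, h2⟩]
    · rw [h.mem_tie]
      constructor
      · rintro ⟨h1, h2⟩
        exact ⟨Or.inr h1, h2⟩
      · rintro ⟨⟨rfl, rfl⟩ | h1, h2⟩
        exacts [absurd ⟨rfl, h2.symm.trans hr⟩ hc, ⟨h1, h2⟩]
  · intro u' r'
    dsimp only
    rw [hup]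
    split_ifs with hc
    · obtain ⟨rfl, rfl⟩ := hc
      refine List.pairwise_append.2 ⟨h.tie_order _ _, by simp, fun a _ b hb hb' => ?_⟩
      rw [List.mem_singleton.1 hb] at hb'
      exact absurd hb' hF
    · exact h.tie_order _ _

/-- Moving `w` to the end fits the order in which `(u, w)` no longer counts as free. For a moment
the tie-lists are thus ahead of the counters. -/
theorem Rep'.rotate_tie (h : Rep' s Mq Q Ft G) {u : Fin I.nU} {w : Fin I.nW} (hT : (u, w) ∈ G.T)
    {r : ℕ} (hr : rankU I u w = r) (t : ℕ) :
    Rep' ⟨s.num, s.lstU, Function.update (Function.update s.lstW (.tie u r)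
        ((s.lstW (.tie u r)).erase w)) (.tie u r)
        (Function.update s.lstW (.tie u r) ((s.lstW (.tie u r)).erase w) (.tie u r) ++ [w]), t⟩
      Mq Q (Ft.erase (u, w)) G := by
  have hnd := h.tie_nodup u r
  have hw : w ∈ s.lstW (.tie u r) := (h.mem_tie _ _ _).2 ⟨hT, hr⟩
  have hup : ∀ u' r', Function.update (Function.update s.lstW (.tie u r)
        ((s.lstW (.tie u r)).erase w)) (.tie u r)
        (Function.update s.lstW (.tie u r) ((s.lstW (.tie u r)).erase w) (.tie u r) ++ [w])
        (.tie u' r') =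
      if u' = u ∧ r' = r then (s.lstW (.tie u r)).erase w ++ [w] else s.lstW (.tie u' r') := by
    intro u' r'
    simp only [Function.update_apply, WCell.tie.injEq, if_true]
    split_ifs <;> rfl
  refine { h with tie_nodup := ?_, mem_tie := ?_, tie_order := ?_, again := ?_, second := ?_ }
  · intro u' r'
    dsimp only
    rw [hup]
    split_ifs
    · refine (hnd.erase _).append (by simp) ?_
      simpa using hnd.not_mem_erase
    · exact h.tie_nodup _ _
  · intro u' r' w'
    dsimp only
    rw [hup]
    split_ifs with hc
    · obtain ⟨rfl, rfl⟩ := hc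
      rw [List.mem_append, List.mem_singleton, hnd.mem_erase_iff, h.mem_tie]
      constructor
      · rintro (⟨-, h1⟩ | rfl)
        exacts [h1, ⟨hT, hr⟩]
      · intro h1
        by_cases e : w' = w
        exacts [Or.inr e, Or.inl ⟨e, h1⟩]
    · exact h.mem_tie _ _ _
  · intro u' r'
    dsimp only
    rw [hup]
    split_ifs with hc
    · obtain ⟨rfl, rfl⟩ := hc
      refine List.pairwise_append.2 ⟨?_, by simp, fun a _ b hb hb' => ?_⟩
      · refine ((h.tie_order u' r').sublist List.erase_sublist).imp_of_mem fun {a b} ha hb hab => ?_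
        have ha' := (hnd.mem_erase_iff.1 ha).1
        have hb' := (hnd.mem_erase_iff.1 hb).1
        simpa [ha', hb'] using hab
      · rw [List.mem_singleton.1 hb] at hb'
        simp at hb'
    · refine (h.tie_order u' r').imp_of_mem fun {a b} ha hb hab => ?_
      have key : ∀ a ∈ s.lstW (.tie u' r'), ((u', a) ∈ Ft.erase (u, w) ↔ (u', a) ∈ Ft) := by
        intro a ha
        rw [Finset.mem_erase, and_iff_right]
        rintro ⟨⟩
        exact hc ⟨rfl, ((h.mem_tie _ _ _).1 ha).2.symm.trans hr⟩
      rw [key a ha, key b hb]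
      exact hab
  · intro u'
    simpa [Function.update_apply] using h.again u'
  · intro u'
    simpa [Function.update_apply] using h.second u'

theorem Rep'.pop_sat (h : Rep' s Mq Q Ft G) (w : Fin I.nW) (t : ℕ) :
    Rep' ⟨s.num, Function.update s.lstU (.sat w) (s.lstU (.sat w)).tail, s.lstW, t⟩ Mq Q Ft
      { G with sat := Function.update G.sat w (G.sat w).tail } := by
  refine { h with sat := ?_ }
  intro w'
  simp only [Function.update_apply, UCell.sat.injEq, h.sat]

theorem Rep'.set_stack (h : Rep' s Mq Q Ft G) (l : List (Fin I.nU)) (t : ℕ) :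
    Rep' ⟨s.num, Function.update s.lstU .stack l, s.lstW, t⟩ Mq Q Ft { G with stack := l } :=
  { h with stack := by simp }

theorem Rep'.set_again (h : Rep' s Mq Q Ft G) (u : Fin I.nU) (l : List (Fin I.nW)) (t : ℕ) :
    Rep' ⟨s.num, s.lstU, Function.update s.lstW (.again u) l, t⟩ Mq Q Ft
      { G with again := Function.update G.again u l } := by
  refine { h with again := ?_ }
  intro w'
  simp only [Function.update_apply, WCell.again.injEq, h.again]

theorem Rep'.set_second (h : Rep' s Mq Q Ft G) (u : Fin I.nU) (l : List (Fin I.nW)) (t : ℕ) :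
    Rep' ⟨s.num, s.lstU, Function.update s.lstW (.second u) l, t⟩ Mq Q Ft
      { G with second := Function.update G.second u l } := by
  refine { h with second := ?_ }
  intro w'
  simp only [Function.update_apply, WCell.second.injEq, h.second]

theorem Rep'.incr_ptr (h : Rep' s Mq Q Ft G) (u : Fin I.nU) (t : ℕ) :
    Rep' ⟨Function.update s.num (.ptr u) (s.num (.ptr u) + 1), s.lstU, s.lstW, t⟩ Mq Q Ft
      { G with ptr := Function.update G.ptr u (G.ptr u + 1) } := by
  refine { h with ptr := ?_ }
  intro w'
  simp only [Function.update_apply, NumCell.ptr.injEq, h.ptr]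

/-! ## Lowering counters -/

/-- Only the order of one queue is affected. For this reason the set of agents who come first may
depend on `w`. -/
theorem Rep'.rotate_queue (h : Rep' s Mq Q Ft G) {u : Fin I.nU} {w : Fin I.nW}
    (hu : (u, w) ∈ Mq) {r : ℕ} (hr : rankW I w u = r) (t : ℕ) :
    Rep' ⟨s.num, Function.update (Function.update s.lstU (.queue w r)
        ((s.lstU (.queue w r)).erase u)) (.queue w r)
        (Function.update s.lstU (.queue w r) ((s.lstU (.queue w r)).erase u) (.queue w r) ++ [u]),
        s.lstW, t⟩
      Mq (Function.update Q w ((Q w).erase u)) Ft G := by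
  have hnd := h.queue_nodup w r
  have hw : u ∈ s.lstU (.queue w r) := (h.mem_queue _ _ _).2 ⟨hu, hr⟩
  have hup : ∀ w' r', Function.update (Function.update s.lstU (.queue w r)
        ((s.lstU (.queue w r)).erase u)) (.queue w r)
        (Function.update s.lstU (.queue w r) ((s.lstU (.queue w r)).erase u) (.queue w r) ++ [u])
        (.queue w' r') =
      if w' = w ∧ r' = r then (s.lstU (.queue w r)).erase u ++ [u] else s.lstU (.queue w' r') := by
    intro u' r'
    simp only [Function.update_apply, UCell.queue.injEq, if_true]
    split_ifs <;> rfl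
  refine { h with queue_nodup := ?_, mem_queue := ?_, queue_order := ?_, sat := ?_, stack := ?_ }
  · intro u' r'
    dsimp only
    rw [hup]
    split_ifs
    · refine (hnd.erase _).append (by simp) ?_
      simpa using hnd.not_mem_erase
    · exact h.queue_nodup _ _
  · intro w' r' u'
    dsimp only
    rw [hup]
    split_ifs with hc
    · obtain ⟨rfl, rfl⟩ := hc
      rw [List.mem_append, List.mem_singleton, hnd.mem_erase_iff, h.mem_queue]
      constructor
      · rintro (⟨-, h1⟩ | rfl)
        exacts [h1, ⟨hu, hr⟩]
      · intro h1
        by_cases e : u' = u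
        exacts [Or.inr e, Or.inl ⟨e, h1⟩]
    · exact h.mem_queue _ _ _
  · intro w' r'
    dsimp only
    rw [hup]
    split_ifs with hc
    · obtain ⟨rfl, rfl⟩ := hc
      rw [Function.update_self]
      refine List.pairwise_append.2 ⟨?_, by simp, fun a _ b hb hb' => ?_⟩
      · refine ((h.queue_order w' r').sublist List.erase_sublist).imp_of_mem
          fun {a b} ha hb hab => ?_
        have ha' := (hnd.mem_erase_iff.1 ha).1
        have hb' := (hnd.mem_erase_iff.1 hb).1
        simpa [ha', hb'] using hab
      · rw [List.mem_singleton.1 hb] at hb'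
        simp at hb'
    · by_cases hww : w' = w
      · subst hww
        rw [Function.update_self]
        refine (h.queue_order w' r').imp_of_mem fun {a b} ha hb hab => ?_
        have key : ∀ a ∈ s.lstU (.queue w' r'), (a ∈ (Q w').erase u ↔ a ∈ Q w') := by
          intro a ha
          rw [Finset.mem_erase, and_iff_right]
          rintro rfl
          exact hc ⟨rfl, ((h.mem_queue _ _ _).1 ha).2.symm.trans hr⟩
        rw [key a ha, key b hb]
        exact hab
      · rw [Function.update_of_ne hww]
        exact h.queue_order _ _
  · intro u'
    simpa [Function.update_apply] using h.sat u'
  · simpa [Function.update_apply] using h.stack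

theorem edge_iff_mem_prefW {u : Fin I.nU} {w : Fin I.nW} :
    Edge I u w ↔ u ∈ (I.prefW w).flatten := I.mutual_acc u w

theorem rankU_of_mem {u : Fin I.nU} {w : Fin I.nW} {i : ℕ} (hi : i < (I.prefU u).length)
    (h : w ∈ (I.prefU u)[i]) : rankU I u w = i :=
  findIdx_eq_of_mem (I.nodupU u) hi h

theorem rankW_of_mem {u : Fin I.nU} {w : Fin I.nW} {i : ℕ} (hi : i < (I.prefW w).length)
    (h : u ∈ (I.prefW w)[i]) : rankW I w u = i :=
  findIdx_eq_of_mem (I.nodupW w) hi h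

theorem rankU_lt {u : Fin I.nU} {w : Fin I.nW} (h : Edge I u w) :
    rankU I u w < (I.prefU u).length := findIdx_lt_of_mem h

/-- In the loop invariant, `u` has lost his priority in the queues of the neighbours already visited
and keeps it in the others. The factor 7 is the cost 4 of the body plus 3 for the loops. -/
theorem wp_demote {A : Finset (Fin I.nU)} (h : Rep' s G.M (fun _ => A) Ft G)
    (hM : ∀ u w, (u, w) ∈ G.M → Edge I u w) (u : Fin I.nU) :
    wp (demote u) (fun _ s' => Rep' s' G.M (fun _ => A.erase u) Ft G ∧
      s'.time ≤ s.time + 7 * (I.prefU u).flatten.length + 1) s := by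
  have hnd := I.nodupU u
  refine wp_mono (wp_forTies (rankU I u) 4 (fun l s' => l.Nodup ∧
    Rep' s' G.M (fun w => if w ∈ l then A else A.erase u) Ft G) (fun _ => 0) ?_ (fun _ _ => rfl)
    (I.tieU_ne u) (fun i hi a ha => by rw [zero_add]; exact rankU_of_mem hi ha) ?_ ⟨hnd, ?_⟩) ?_
  · rintro l s' t ⟨h1, h2⟩
    exact ⟨h1, h2.time t⟩
  · rintro w hw l s' ⟨h1, h2⟩
    have hwl := (List.nodup_cons.1 h1).1
    simp only [wp_bind, wp_load, h2.inM, add_zero]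
    refine wp_ite (fun hc => ?_) (fun hc => ?_)
    · have hm : (u, w) ∈ G.M := by by_contra hm; simp [hm] at hc
      simp only [wp_bind, wp_load, wp_eraseU, wp_pushBackU, h2.rkW u w hw]
      refine ⟨⟨h1.of_cons, ?_⟩, le_rfl⟩
      refine (h2.rotate_queue hm rfl _).congr_queue fun u' w' _ => ?_
      by_cases hww : w' = w
      · subst hww
        simp [hwl]
      · simp [hww]
    · have hm : (u, w) ∉ G.M := by intro hm; simp [hm] at hc
      rw [wp_pure]
      refine ⟨⟨h1.of_cons, (h2.time _).congr_queue fun u' w' hm' => ?_⟩, by simp⟩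
      by_cases hww : w' = w
      · subst hww
        have : u' ≠ u := by rintro rfl; exact hm hm'
        simp [hwl, this]
      · simp [hww]
  · refine h.congr_queue fun u' w hm => ?_
    by_cases hw : w ∈ (I.prefU u).flatten
    · rw [if_pos hw]
    · rw [if_neg hw, Finset.mem_erase, and_iff_right]
      rintro rfl
      exact hw (hM _ _ hm)
  · rintro _ s' ⟨⟨-, h2⟩, h3⟩
    exact ⟨by simpa using h2, by simpa using h3⟩

/-- The time that is available for the demotion of agents who are still subsatellitic. -/
def liveCost (s : Machine I) : ℕ :=
  ∑ u, if 0 < s.num (.cnt u) then 7 * (I.prefU u).flatten.length + 1 else 0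

/-- The potential on the memory depends on `F` only; hence it is not changed by operations that
leave `F` alone. -/
theorem Rep'.liveCost_eq (h : Rep' s Mq Q Ft G) :
    liveCost s = ∑ u, if u ∈ live G.F then 7 * (I.prefU u).flatten.length + 1 else 0 := by
  unfold liveCost
  simp only [h.cnt_pos]

theorem liveCost_mono {F F' : Finset (Fin I.nU × Fin I.nW)} (h : F' ⊆ F) :
    (∑ u, if u ∈ live F' then 7 * (I.prefU u).flatten.length + 1 else 0) ≤
      ∑ u, if u ∈ live F then 7 * (I.prefU u).flatten.length + 1 else 0 := by
  refine Finset.sum_le_sum fun u _ => ?_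
  have : u ∈ live F' → u ∈ live F := fun h' => Finset.image_subset_image h h'
  split_ifs <;> simp_all

theorem liveCost_erase {F F' : Finset (Fin I.nU × Fin I.nW)} (h : F' ⊆ F) {u : Fin I.nU}
    (hu : u ∈ live F) (hu' : u ∉ live F') :
    (∑ u, if u ∈ live F' then 7 * (I.prefU u).flatten.length + 1 else 0) +
      (7 * (I.prefU u).flatten.length + 1) ≤
      ∑ u, if u ∈ live F then 7 * (I.prefU u).flatten.length + 1 else 0 := by
  rw [← Finset.sum_erase_add _ _ (Finset.mem_univ u),
    ← Finset.sum_erase_add (s := Finset.univ) (a := u)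
      (f := fun u => if u ∈ live F then 7 * (I.prefU u).flatten.length + 1 else 0)
      (Finset.mem_univ u), if_neg hu', if_pos hu, add_zero]
  refine Nat.add_le_add_right (Finset.sum_le_sum fun u _ => ?_) _
  have : u ∈ live F' → u ∈ live F := fun h' => Finset.image_subset_image h h'
  split_ifs <;> simp_all

theorem filter_erase_card (F : Finset (Fin I.nU × Fin I.nW)) {e : Fin I.nU × Fin I.nW}
    (he : e ∈ F) (p : Fin I.nU × Fin I.nW → Prop) [DecidablePred p] :
    ((F.erase e).filter p).card = (F.filter p).card - if p e then 1 else 0 := by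
  rw [Finset.filter_erase]
  split_ifs with h
  · exact Finset.card_erase_of_mem (by simp [he, h])
  · rw [Finset.erase_eq_of_notMem (by simp [h]), Nat.sub_zero]

/-- Constant amortised time: `demote` is called only if the last free pair of `u` has just
disappeared. Then the summand of `u` drops out of `liveCost`, and this summand is the bound for the
cost of `demote`. -/
theorem wp_lower (h : Rep' s G.M (fun _ => live G.F) Ft G)
    (hM : ∀ u w, (u, w) ∈ G.M → Edge I u w) {u : Fin I.nU} {w : Fin I.nW} (hF : (u, w) ∈ G.F) :
    wp (lower u (rankU I u w)) (fun _ s' =>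
      Rep' s' G.M (fun _ => live (G.F.erase (u, w))) Ft { G with F := G.F.erase (u, w) } ∧
      s'.time + liveCost s' ≤ s.time + liveCost s + 5) s := by
  simp only [lower, wp_bind, wp_decr, wp_load]
  obtain ⟨s1, hs1⟩ : ∃ s1 : Machine I, s1 = ⟨Function.update (Function.update s.num
      (.tieCnt u (rankU I u w)) (s.num (.tieCnt u (rankU I u w)) - 1)) (.cnt u)
      (Function.update s.num (.tieCnt u (rankU I u w)) (s.num (.tieCnt u (rankU I u w)) - 1)
        (.cnt u) - 1), s.lstU, s.lstW, s.time + 1 + 1 + 1 + 1 + 1⟩ := ⟨_, rfl⟩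
  have ht1 : s1.time = s.time + 5 := by rw [hs1]
  have h1 : Rep' s1 G.M (fun _ => live G.F) Ft { G with F := G.F.erase (u, w) } := by
    rw [hs1]
    refine { h with cnt := ?_, tieCnt := ?_ }
    · intro u'
      have e1 := h.cnt u'
      have e2 := h.cnt u
      simp only [Function.update_apply, reduceCtorEq, if_false, NumCell.cnt.injEq, e1, e2,
        filter_erase_card _ hF]
      split_ifs with h1 h2 h2
      · rw [h1]
      · exact absurd h1.symm h2
      · exact absurd h2.symm h1
      · rfl
    · intro u' r'
      have e1 := h.tieCnt u' r'
      have e2 := h.tieCnt u (rankU I u w)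
      simp only [Function.update_apply, reduceCtorEq, if_false, NumCell.tieCnt.injEq, e1, e2,
        filter_erase_card _ hF]
      split_ifs with h1 h2 h2
      · rw [h1.1, h1.2]
      · exact absurd ⟨h1.1.symm, h1.1 ▸ h1.2.symm⟩ h2
      · exact absurd ⟨h2.1.symm, h2.1 ▸ h2.2.symm⟩ h1
      · rfl
  have hu : u ∈ live G.F := mem_live.2 ⟨w, hF⟩
  have hsub : G.F.erase (u, w) ⊆ G.F := Finset.erase_subset _ _
  have hne : ∀ u', u' ≠ u → (u' ∈ live (G.F.erase (u, w)) ↔ u' ∈ live G.F) := by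
    intro u' hu'
    simp [mem_live, hu']
  have hpos : 0 < s1.num (.cnt u) ↔ u ∈ live (G.F.erase (u, w)) := h1.cnt_pos
  change wp _ _ (⟨_, s.lstU, s.lstW, s.time + 1 + 1 + 1 + 1 + 1⟩ : Machine I)
  rw [← hs1]
  refine wp_ite (fun hc => ?_) (fun hc => ?_)
  · have hu' : u ∉ live (G.F.erase (u, w)) := fun h' => by
      have := hpos.2 h'
      have hc' : s1.num (.cnt u) = 0 := by rw [hs1]; exact hc
      omega
    refine wp_mono (wp_demote (G := { G with F := G.F.erase (u, w) }) h1 hM u) fun _ s2 h2 => ?_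
    have hQ : (live G.F).erase u = live (G.F.erase (u, w)) := by
      ext u'
      by_cases e : u' = u
      · subst e; simp [hu']
      · simp [e, hne u' e]
    rw [hQ] at h2
    refine ⟨h2.1, ?_⟩
    rw [h2.1.liveCost_eq, h.liveCost_eq]
    have := liveCost_erase hsub hu hu'
    have ht := h2.2
    dsimp only at this ⊢
    omega
  · rw [wp_pure]
    have hu' : u ∈ live (G.F.erase (u, w)) :=
      hpos.1 (Nat.pos_of_ne_zero (by rw [hs1]; exact hc))
    have h2 := h1.congr_queue (Q' := fun _ => live (G.F.erase (u, w))) fun u' _ _ => by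
      by_cases e : u' = u
      · subst e; simp [hu, hu']
      · exact (hne u' e).symm
    refine ⟨h2, ?_⟩
    rw [h2.liveCost_eq, h.liveCost_eq]
    have := liveCost_mono hsub
    dsimp only at this ⊢
    omega

/-- The free pairs of `w` disappear one by one: in the loop invariant, those with an agent still to
be visited remain. By `hw` the neighbours outside `M` are exactly those who need an update, and each
still has `w` in his tie-list. The demotions triggered are paid for by `liveCost`. -/
theorem wp_saturate (h : Rep s G) (hM : ∀ u w, (u, w) ∈ G.M → Edge I u w)
    (hF : ∀ u w, (u, w) ∈ G.F → Edge I u w) (hMF : ∀ e ∈ G.M, e ∉ G.F) {w : Fin I.nW}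
    (hw : ∀ u, Edge I u w → (u, w) ∉ G.M → (u, w) ∈ G.F ∧ (u, w) ∈ G.T) :
    wp (saturate w) (fun _ s' => Rep s' { G with F := G.F.filter fun e => e.2 ≠ w } ∧
      s'.time + liveCost s' ≤ s.time + liveCost s + 12 * (I.prefW w).flatten.length + 1) s := by
  refine wp_mono (wp_forTies (rankW I w) 9 (fun l s' => l.Nodup ∧
    Rep s' { G with F := G.F.filter fun e => e.2 = w → e.1 ∈ l }) liveCost ?_ (fun _ _ => rfl)
    (I.tieW_ne w) (fun i hi a ha => by rw [zero_add]; exact rankW_of_mem hi ha) ?_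
    ⟨I.nodupW w, ?_⟩) ?_
  · rintro l s' t ⟨h1, h2⟩
    exact ⟨h1, h2.time t⟩
  · rintro u hu l s' ⟨h1, h2⟩
    have he : Edge I u w := edge_iff_mem_prefW.2 hu
    have hul := (List.nodup_cons.1 h1).1
    have hFl : (G.F.filter fun e => e.2 = w → e.1 ∈ u :: l).erase (u, w) =
        G.F.filter fun e => e.2 = w → e.1 ∈ l := by
      ext ⟨u', w'⟩
      simp only [Finset.mem_erase, Finset.mem_filter, List.mem_cons, Ne, Prod.mk.injEq]
      by_cases e1 : w' = w
      · by_cases e2 : u' = u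
        · subst e1 e2; simp [hul]
        · simp [e1, e2]
      · simp [e1]
    simp only [wp_bind, wp_load, h2.inM]
    refine wp_ite (fun hc => ?_) (fun hc => ?_)
    · have hm : (u, w) ∉ G.M := by intro hm; simp [hm] at hc
      simp only [wp_bind, wp_load, wp_eraseW, wp_pushBackW, h2.rkU u w he]
      have h3 := h2.rotate_tie (hw u he hm).2 rfl (s'.time + 1 + 1 + 1 + 1)
      refine wp_mono (wp_lower h3 hM (Finset.mem_filter.2 ⟨(hw u he hm).1, by simp⟩))
        fun _ s2 h4 => ?_
      refine ⟨⟨h1.of_cons, by rw [← hFl]; exact h4.1⟩, ?_⟩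
      have ht := h4.2
      have : ∀ f t, liveCost (⟨s'.num, s'.lstU, f, t⟩ : Machine I) = liveCost s' :=
        fun _ _ => rfl
      simp only [this] at ht
      omega
    · have hm : (u, w) ∈ G.M := by by_contra hm; simp [hm] at hc
      rw [wp_pure]
      refine ⟨⟨h1.of_cons, ?_⟩, ?_⟩
      · rw [← hFl, Finset.erase_eq_of_notMem]
        · exact h2.time _
        · intro hm'
          exact hMF _ hm (Finset.mem_filter.1 hm').1
      · show s'.time + 1 + liveCost s' ≤ _
        omega
  · have hfe : (G.F.filter fun e => e.2 = w → e.1 ∈ (I.prefW w).flatten) = G.F := by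
      rw [Finset.filter_true_of_mem]
      rintro ⟨u', w'⟩ he rfl
      exact edge_iff_mem_prefW.1 (hF _ _ he)
    rw [hfe]
    exact h
  · rintro _ s' ⟨⟨-, h2⟩, h3⟩
    exact ⟨by simpa using h2, h3⟩

end
end ASBM

namespace ASBM

variable {I : Instance} {s : Machine I} {G : Ghost I}

/-! ### Composite operations of the implementation -/

theorem card_partners_le {M : Finset (Fin I.nU × Fin I.nW)}
    (hM : ∀ u w, (u, w) ∈ M → Edge I u w) (w : Fin I.nW) :
    (M.filter fun e => e.2 = w).card ≤ (I.prefW w).flatten.length := by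
  rw [← List.toFinset_card_of_nodup (I.nodupW w)]
  refine Finset.card_le_card_of_injOn Prod.fst ?_ ?_
  · rintro ⟨u', w'⟩ he
    obtain ⟨h1, rfl⟩ := Finset.mem_filter.1 he
    simpa using edge_iff_mem_prefW.1 (hM _ _ h1)
  · rintro ⟨u1, w1⟩ h1 ⟨u2, w2⟩ h2 h
    have e1 := (Finset.mem_filter.1 h1).2
    have e2 := (Finset.mem_filter.1 h2).2
    exact Prod.ext h (e1.trans e2.symm)

/-- With the pair `(u, w)` added, the partners of `w` would still be neighbours of hers. This yields
the unused leaf when the degree of `w`, rather than her capacity, determines the size of the tree.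
-/
theorem card_partners_lt {M : Finset (Fin I.nU × Fin I.nW)}
    (hM : ∀ u w, (u, w) ∈ M → Edge I u w) {u : Fin I.nU} {w : Fin I.nW} (he : Edge I u w)
    (huw : (u, w) ∉ M) :
    (M.filter fun e => e.2 = w).card < (I.prefW w).flatten.length := by
  have := card_partners_le (M := insert (u, w) M) (fun u' w' h => by
    rcases Finset.mem_insert.1 h with h | h
    · obtain ⟨rfl, rfl⟩ := Prod.mk.inj h
      exact he
    · exact hM _ _ h) w
  rw [filter_snd_insert_card huw, if_pos rfl] at this
  omega

/-- The free pairs after an unsaturated `w` has been linked with `u`; `M` is the new matching. -/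
def freeAfter (M F : Finset (Fin I.nU × Fin I.nW)) (u : Fin I.nU) (w : Fin I.nW) :
    Finset (Fin I.nU × Fin I.nW) :=
  if (M.filter fun e => e.2 = w).card = I.capW w then
    (F.erase (u, w)).filter fun e => e.2 ≠ w
  else F.erase (u, w)

/-- The remaining lists after `u` has proposed to `w`. -/
def leftAfter (F : Finset (Fin I.nU × Fin I.nW)) (L : Fin I.nU → Finset (Fin I.nW)) (u : Fin I.nU)
    (w : Fin I.nW) : Fin I.nU → Finset (Fin I.nW) :=
  if tieNum I F u (rankU I u w) < 2 then Function.update L u ((L u).erase w) else L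

/-- The counters are lowered before the pair is linked, so that `link` sees whether `u` is still
subsatellitic and satellitic without `w`. The only term that is not logarithmic is the cost of
`saturate`, and it is kept separate because `satSum` will pay for it. -/
theorem wp_linkUnsat (h : Rep s G) (hM : ∀ u w, (u, w) ∈ G.M → Edge I u w)
    (hF : ∀ u w, (u, w) ∈ G.F → Edge I u w) (hMF : ∀ e ∈ G.M, e ∉ G.F)
    {u : Fin I.nU} {w : Fin I.nW} (huF : (u, w) ∈ G.F) (huT : (u, w) ∉ G.T)
    (hcard : (G.M.filter fun e => e.2 = w).card < I.capW w)
    (hw : ∀ u', u' ≠ u → Edge I u' w → (u', w) ∉ G.M → (u', w) ∈ G.F ∧ (u', w) ∈ G.T) :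
    wp (linkUnsat u w) (fun _ s' => Rep s' { G with
        M := insert (u, w) G.M
        L := leftAfter G.F G.L u w
        F := freeAfter (insert (u, w) G.M) G.F u w
        sat := satPush (G.F.erase (u, w)) u w G.sat } ∧
      s'.time + liveCost s' ≤ s.time + liveCost s + 3 * Nat.log 2 (I.capW w) + 33 +
        if (G.M.filter fun e => e.2 = w).card + 1 = I.capW w then
          12 * (I.prefW w).flatten.length + 1 else 0) s := by
  have he : Edge I u w := hF _ _ huF
  have huM : (u, w) ∉ G.M := fun h' => hMF _ h' huF
  have hins : ∀ u' w', (u', w') ∈ insert (u, w) G.M → Edge I u' w' := by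
    intro u' w' h
    rcases Finset.mem_insert.1 h with h | h
    · obtain ⟨rfl, rfl⟩ := Prod.mk.inj h
      exact he
    · exact hM _ _ h
  have key : ∀ s1, Rep s1 { G with L := leftAfter G.F G.L u w } → s1.time ≤ s.time + 3 →
      wp (do
        lower u (rankU I u w)
        link u w
        let d ← load (.degW w)
        let c ← input (I.capW w)
        if d = c then saturate w else pure ())
      (fun _ s' => Rep s' { G with
          M := insert (u, w) G.M
          L := leftAfter G.F G.L u w
          F := freeAfter (insert (u, w) G.M) G.F u w
          sat := satPush (G.F.erase (u, w)) u w G.sat } ∧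
        s'.time + liveCost s' ≤ s.time + liveCost s + 3 * Nat.log 2 (I.capW w) + 33 +
          if (G.M.filter fun e => e.2 = w).card + 1 = I.capW w then
            12 * (I.prefW w).flatten.length + 1 else 0) s1 := by
    intro s1 h1 ht1
    have hl1 : liveCost s1 = liveCost s := by rw [h1.liveCost_eq, h.liveCost_eq]
    rw [wp_bind]
    refine wp_mono (wp_lower h1 hM huF) fun _ s2 ⟨h2, ht2⟩ => ?_
    -- The pair has been taken out of the tie-list before, so for the order there it does not matter
    -- whether it counts as free.
    have h2' := h2.congr_tie (Ft' := G.F.erase (u, w)) (by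
      intro e heT
      have : e ≠ (u, w) := by rintro rfl; exact huT heT
      simp [this])
    rw [wp_bind]
    refine wp_mono (wp_link
      (G := { G with L := leftAfter G.F G.L u w, F := G.F.erase (u, w) }) h2' he huM
      (lt_min hcard (card_partners_lt hM he huM))) fun _ s3 ⟨h3, ht3⟩ => ?_
    have hl3 : liveCost s3 = liveCost s2 := by rw [h3.liveCost_eq, h2.liveCost_eq]
    have hdeg := h3.degW w
    have hc := filter_snd_insert_card huM w
    rw [if_pos rfl] at hc
    dsimp only at hdeg ht2 ht3
    rw [wp_bind, wp_load, wp_bind, wp_input, hdeg]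
    refine wp_ite (fun hd => ?_) (fun hd => ?_)
    · rw [hc] at hd
      refine wp_mono (wp_saturate (h3.time _) hins (fun u' w' h' => hF _ _ (Finset.mem_of_mem_erase h'))
        ?_ ?_) fun _ s4 ⟨h4, ht4⟩ => ⟨?_, ?_⟩
      · intro e he' heF
        rcases Finset.mem_insert.1 he' with rfl | he'
        · simp at heF
        · exact hMF _ he' (Finset.mem_of_mem_erase heF)
      · intro u' he' hm
        dsimp only at hm ⊢
        rw [Finset.mem_insert, not_or] at hm
        have hu' : u' ≠ u := by rintro rfl; exact hm.1 rfl
        have := hw u' hu' he' hm.2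
        exact ⟨by simp [hu', this.1], this.2⟩
      · rw [freeAfter, hc, if_pos hd]
        exact h4
      · rw [if_pos hd]
        have : ∀ t, liveCost (⟨s3.num, s3.lstU, s3.lstW, t⟩ : Machine I) = liveCost s3 :=
          fun _ => rfl
        dsimp only at ht4
        rw [this] at ht4
        omega
    · rw [wp_pure]
      rw [hc] at hd
      refine ⟨?_, ?_⟩
      · rw [freeAfter, hc, if_neg hd]
        exact h3.time _
      · rw [if_neg hd]
        change s3.time + 1 + 1 + liveCost s3 ≤ _
        omega
  simp only [linkUnsat]
  rw [wp_bind, wp_load, wp_bind, wp_load]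
  simp only [h.rkU u w he, h.tieCnt]
  refine wp_ite (fun hc => ?_) (fun hc => ?_)
  · rw [wp_bind, wp_store]
    refine key _ ?_ le_rfl
    rw [leftAfter, tieNum, if_pos hc]
    exact h.store_inL _ _ _
  · refine key _ ?_ (by simp)
    rw [leftAfter, tieNum, if_neg hc]
    exact h.time _

/-- The list splits into a discarded part `l₁` of agents without free pairs in the tie concerned and
a rest `l₂` whose first element, if any, is satellitic. Each discarded agent costs 3 units, which
the term `3 * l₂.length` on the left accounts for. -/
theorem wp_findSat (h : Rep s G) {w : Fin I.nW} (hsat : ∀ u ∈ G.sat w, Edge I u w) :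
    wp (findSat w) (fun o s' => ∃ l₁ l₂, G.sat w = l₁ ++ l₂ ∧
      (∀ u ∈ l₁, tieNum I G.F u (rankU I u w) = 0) ∧ o = l₂.head? ∧
      (∀ u, o = some u → 0 < tieNum I G.F u (rankU I u w)) ∧
      Rep s' { G with sat := Function.update G.sat w l₂ } ∧
      s'.time + 3 * l₂.length ≤ s.time + 3 * (G.sat w).length + 2) s := by
  simp only [findSat]
  rw [wp_bind, wp_get, h.sat]
  have key : ∀ l s1, (∀ u ∈ l, Edge I u w) → Rep s1 { G with sat := Function.update G.sat w l } →
      wp (clean w l) (fun o s' => ∃ l₁ l₂, l = l₁ ++ l₂ ∧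
      (∀ u ∈ l₁, tieNum I G.F u (rankU I u w) = 0) ∧ o = l₂.head? ∧
      (∀ u, o = some u → 0 < tieNum I G.F u (rankU I u w)) ∧
      Rep s' { G with sat := Function.update G.sat w l₂ } ∧
      s'.time + 3 * l₂.length ≤ s1.time + 3 * l.length + 2) s1 := by
    intro l
    induction l with
    | nil =>
      intro s1 _ h1
      simp only [clean]
      rw [wp_bind, wp_tick, wp_pure]
      exact ⟨[], [], rfl, by simp, rfl, by simp, h1.time _, by simp⟩
    | cons a l ih =>
      intro s1 hl h1
      simp only [clean]
      rw [wp_bind, wp_load, wp_bind, wp_load, h1.rkU a w (hl a (by simp)), h1.tieCnt]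
      refine wp_ite (fun hc => ?_) (fun hc => ?_)
      · rw [wp_pure]
        refine ⟨[], a :: l, rfl, by simp, rfl, ?_, h1.time _, ?_⟩
        swap
        · change s1.time + 1 + 1 + _ ≤ _
          omega
        intro u hu
        obtain rfl : a = u := by simpa using hu
        exact hc
      · rw [wp_bind, wp_popU]
        have h2 := h1.pop_sat w (s1.time + 1 + 1 + 1)
        simp only [Function.update_self, List.tail_cons, Function.update_idem] at h2
        refine wp_mono (ih _ (fun u hu => hl u (by simp [hu])) h2) ?_
        rintro o s' ⟨l₁, l₂, e1, e2, e3, e4, e5, e6⟩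
        refine ⟨a :: l₁, l₂, by rw [e1]; rfl, ?_, e3, e4, e5, ?_⟩
        · intro u hu
          rcases List.mem_cons.1 hu with rfl | hu
          · exact Nat.eq_zero_of_not_pos hc
          · exact e2 u hu
        · dsimp only at e6
          rw [List.length_cons]
          omega
  refine key (G.sat w) s hsat ?_
  rw [Function.update_eq_self]
  exact h

/-- Subsatellitic agents come first in a queue, so its head decides for the whole tie. -/
theorem wp_findSub (h : Rep s G) (w : Fin I.nW) (r : ℕ) :
    wp (findSub w r) (fun o s' => Rep s' G ∧ s'.time ≤ s.time + 2 ∧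
      (o = none → ∀ u, (u, w) ∈ G.M → rankW I w u = r → u ∉ live G.F) ∧
      (∀ u, o = some u → (u, w) ∈ G.M ∧ rankW I w u = r ∧ u ∈ live G.F)) s := by
  have hord := h.queue_order w r
  have hmem := h.mem_queue w r
  simp only [findSub]
  rw [wp_bind, wp_headU]
  rcases hq : s.lstU (.queue w r) with _ | ⟨a, l⟩
  · rw [hq] at hmem
    simp only [List.head?_nil, wp_pure]
    refine ⟨h.time _, by simp, fun _ u h1 h2 => ?_, by simp⟩
    exact absurd ((hmem u).2 ⟨h1, h2⟩) (by simp)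
  · rw [hq] at hmem hord
    have hpos := h.cnt_pos (u := a)
    simp only [List.head?_cons, wp_bind, wp_load, wp_pure]
    refine ⟨h.time _, le_rfl, ?_, ?_⟩
    · intro hc u h1 h2 hu
      have ha : a ∉ live G.F := fun ha => by simp [hpos.2 ha] at hc
      rcases List.mem_cons.1 ((hmem u).2 ⟨h1, h2⟩) with rfl | hul
      · exact ha hu
      · exact ha (List.rel_of_pairwise_cons hord hul hu)
    · intro u hc
      split_ifs at hc with hc'
      obtain rfl : a = u := by simpa using hc
      obtain ⟨h1, h2⟩ := (hmem a).1 (by simp)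
      exact ⟨h1, h2, hpos.1 hc'⟩

/-- The number of partners of `w` is the same at the end as at the beginning, so no counter of free
pairs has to change. -/
theorem wp_takeOver (h : Rep s G) (hM : ∀ u w, (u, w) ∈ G.M → Edge I u w)
    {u u' : Fin I.nU} {w : Fin I.nW} (he : Edge I u w) (huw : (u, w) ∉ G.M)
    (hu' : (u', w) ∈ G.M) (hcard : (G.M.filter fun e => e.2 = w).card ≤ I.capW w) :
    wp (takeOver u u' w) (fun _ s' => Rep s' { G with
        M := insert (u, w) (G.M.erase (u', w))
        sat := satPush G.F u w G.sat
        again := if w ∈ G.L u' then Function.update G.again u' (G.again u' ++ [w]) else G.again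
        stack := u' :: G.stack } ∧
      s'.time ≤ s.time + 6 * Nat.log 2 (I.capW w) + 45) s := by
  have hc := filter_snd_erase_card hu' w
  rw [if_pos rfl] at hc
  have hdeg := card_partners_le hM w
  simp only [takeOver]
  rw [wp_bind]
  refine wp_mono (wp_unlink h (hM _ _ hu') hu') fun _ s1 ⟨h1, _, ht1⟩ => ?_
  rw [wp_bind]
  refine wp_mono (wp_link h1 he (fun h' => huw (Finset.mem_of_mem_erase h')) (by
    refine lt_min ?_ ?_ <;> dsimp only <;> omega)) fun _ s2 ⟨h2, ht2⟩ => ?_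
  have hin := h2.inL u' w
  rw [wp_bind, wp_load, hin]
  dsimp only at ht1 ht2 ⊢
  refine wp_ite (fun hx => ?_) (fun hx => ?_)
  · have hL : w ∈ G.L u' := by by_contra hL; simp [hL] at hx
    rw [if_pos hL, wp_bind, wp_pushBackW, wp_pushFrontU]
    have h3 := h2.set_again u' (G.again u' ++ [w]) (s2.time + 2)
    refine ⟨?_, ?_⟩
    · have h4 := h3.set_stack (u' :: G.stack) (s2.time + 3)
      rw [show G.again u' = s2.lstW (.again u') from (h2.again u').symm,
        show G.stack = s2.lstU .stack from h2.stack.symm]  at h4 ⊢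
      exact h4
    · show s2.time + 1 + 1 + 1 ≤ _
      omega
  · have hL : w ∉ G.L u' := fun hL => by simp [hL] at hx
    rw [if_neg hL, wp_pushFrontU]
    refine ⟨?_, ?_⟩
    · have h4 := h2.set_stack (u' :: G.stack) (s2.time + 2)
      rw [show G.stack = s2.lstU .stack from h2.stack.symm]  at h4 ⊢
      exact h4
    · show s2.time + 1 + 1 ≤ _
      omega

end ASBM

namespace ASBM

variable {I : Instance} {s : Machine I} {G : Ghost I}

/-! ## Invariants between the rounds -/

/-- The values of the variables of the algorithm. -/
def Ghost.state (G : Ghost I) : State I := ⟨G.M, G.L, G.second⟩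

theorem Rep'.state_eq {Mq Ft : Finset (Fin I.nU × Fin I.nW)} {Q : Fin I.nW → Finset (Fin I.nU)}
    (h : Rep' s Mq Q Ft G) : s.state = G.state := by
  refine State.ext ?_ (funext fun u => ?_) (funext fun u => h.second u)
  · ext e
    simp [Machine.state, Ghost.state, h.inM]
  · ext w
    simp [Machine.state, Ghost.state, h.inL]

/-- Invariants that do not concern the stack and the lists of agents to propose to again. -/
structure Base (G : Ghost I) : Prop where
  mem_F : ∀ u w, (u, w) ∈ G.F ↔ Edge I u w ∧ UnsatW G.M w ∧ (u, w) ∉ G.M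
  edge : ∀ u w, (u, w) ∈ G.M → Edge I u w
  capW : ∀ w, (G.M.filter fun e => e.2 = w).card ≤ I.capW w
  edgeL : ∀ u w, w ∈ G.L u → Edge I u w
  mem_L : ∀ u w, (u, w) ∈ G.F → w ∈ G.L u
  le_ptr : ∀ u w, (u, w) ∈ G.M → rankU I u w ≤ G.ptr u
  sat_nodup : ∀ w, (G.sat w).Nodup
  mem_M : ∀ u w, u ∈ G.sat w → (u, w) ∈ G.M
  mem_sat : ∀ u w, (u, w) ∈ G.M → 0 < tieNum I G.F u (rankU I u w) → u ∈ G.sat w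
  second : ∀ u w, w ∈ G.second u → Edge I u w ∧ ¬ UnsatW G.M w

/-- The invariants that hold between two rounds. -/
structure Inv (G : Ghost I) : Prop extends Base G where
  mem_T : ∀ u w, (u, w) ∈ G.T ↔ w ∈ G.L u ∧ (u, w) ∉ G.M ∧ w ∉ G.again u
  ptr_le : ∀ u w, (u, w) ∈ G.T → G.ptr u ≤ rankU I u w
  capU : ∀ u, (G.M.filter fun e => e.1 = u).card ≤ I.capU u
  again : ∀ u w, w ∈ G.again u → G.again u = [w] ∧ G.stack.head? = some u ∧ UnsatU G.M u ∧
    w ∈ G.L u ∧ (u, w) ∉ G.M ∧ ¬ UnsatW G.M w ∧ rankU I u w ≤ G.ptr u ∧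
    tieNum I G.F u (rankU I u w) = 0
  done : ∀ u, UnsatU G.M u →
    u ∈ G.stack ∨ ((I.prefU u).length ≤ G.ptr u ∧ G.second u = [])

/-- `u` is about to propose to `w`, who has been taken out of the tie-list of `u`. -/
structure Ready (G : Ghost I) (u : Fin I.nU) (w : Fin I.nW) : Prop extends Base G where
  mem_T : ∀ u' w', (u', w') ∈ G.T ↔ w' ∈ G.L u' ∧ (u', w') ∉ G.M ∧ (u', w') ≠ (u, w)
  ptr_le : ∀ u w, (u, w) ∈ G.T → G.ptr u ≤ rankU I u w
  capU : ∀ u, (G.M.filter fun e => e.1 = u).card ≤ I.capU u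
  again : ∀ u, G.again u = []
  done : ∀ u, UnsatU G.M u →
    u ∈ G.stack ∨ ((I.prefU u).length ≤ G.ptr u ∧ G.second u = [])
  mem_stack : u ∈ G.stack
  unsat : UnsatU G.M u
  wL : w ∈ G.L u
  wM : (u, w) ∉ G.M
  wptr : rankU I u w ≤ G.ptr u
  tied : ¬ UnsatW G.M w → tieNum I G.F u (rankU I u w) = 0

/-- `u` proposes to a saturated `w`, who has been removed from the lists of `u`. -/
structure Mid (G : Ghost I) (u : Fin I.nU) (w : Fin I.nW) : Prop extends Inv G where
  no_again : ∀ u, G.again u = []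
  mem_stack : u ∈ G.stack
  unsat : UnsatU G.M u
  uw : Edge I u w
  wL : w ∉ G.L u
  wM : (u, w) ∉ G.M
  wsat : ¬ UnsatW G.M w
  wptr : rankU I u w ≤ G.ptr u
  tied : tieNum I G.F u (rankU I u w) = 0

/-! ### Auxiliary facts on tie counts and on the updates of the lists -/

theorem tieNum_pos {F : Finset (Fin I.nU × Fin I.nW)} {u : Fin I.nU} {r : ℕ} :
    0 < tieNum I F u r ↔ ∃ w, (u, w) ∈ F ∧ rankU I u w = r := by
  rw [tieNum, Finset.card_pos]
  constructor
  · rintro ⟨⟨u', w⟩, he⟩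
    obtain ⟨h1, rfl, h2⟩ := Finset.mem_filter.1 he
    exact ⟨w, h1, h2⟩
  · rintro ⟨w, h1, h2⟩
    exact ⟨(u, w), by simp [h1, h2]⟩

theorem tieNum_mono {F F' : Finset (Fin I.nU × Fin I.nW)} (h : F' ⊆ F) (u : Fin I.nU) (r : ℕ) :
    tieNum I F' u r ≤ tieNum I F u r :=
  Finset.card_le_card (Finset.filter_subset_filter _ h)

theorem freeAfter_subset (M F : Finset (Fin I.nU × Fin I.nW)) (u : Fin I.nU) (w : Fin I.nW) :
    freeAfter M F u w ⊆ F.erase (u, w) := by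
  unfold freeAfter
  split_ifs
  exacts [Finset.filter_subset _ _, subset_rfl]

theorem leftAfter_subset (F : Finset (Fin I.nU × Fin I.nW)) (L : Fin I.nU → Finset (Fin I.nW))
    (u u' : Fin I.nU) (w : Fin I.nW) : leftAfter F L u w u' ⊆ L u' := by
  unfold leftAfter
  split_ifs
  · by_cases h : u' = u
    · subst h; simp [Finset.erase_subset]
    · simp [h]
  · exact subset_rfl

theorem mem_leftAfter {F : Finset (Fin I.nU × Fin I.nW)} {L : Fin I.nU → Finset (Fin I.nW)}
    {u u' : Fin I.nU} {w w' : Fin I.nW} (h : (u', w') ≠ (u, w)) :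
    w' ∈ leftAfter F L u w u' ↔ w' ∈ L u' := by
  unfold leftAfter
  split_ifs
  · by_cases hu : u' = u
    · subst hu
      have : w' ≠ w := by rintro rfl; exact h rfl
      simp [this]
    · simp [hu]
  · rfl

theorem mem_satPush {F : Finset (Fin I.nU × Fin I.nW)} {sat : Fin I.nW → List (Fin I.nU)}
    {u u' : Fin I.nU} {w w' : Fin I.nW} : u' ∈ satPush F u w sat w' ↔
      u' ∈ sat w' ∨ ((u', w') = (u, w) ∧ 0 < tieNum I F u (rankU I u w)) := by
  unfold satPush
  split_ifs with h
  · by_cases hw : w' = w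
    · subst hw; simp [h, or_comm]
    · simp [hw]
  · simp [h]

theorem satPush_nodup {F : Finset (Fin I.nU × Fin I.nW)} {sat : Fin I.nW → List (Fin I.nU)}
    {u : Fin I.nU} {w : Fin I.nW} (h : ∀ w, (sat w).Nodup) (hu : u ∉ sat w) (w' : Fin I.nW) :
    (satPush F u w sat w').Nodup := by
  unfold satPush
  split_ifs
  · by_cases hw : w' = w
    · subst hw; simpa [hu] using h w'
    · simpa [hw] using h w'
  · exact h w'

theorem sum_satPush_le {F : Finset (Fin I.nU × Fin I.nW)} {sat : Fin I.nW → List (Fin I.nU)}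
    {u : Fin I.nU} {w : Fin I.nW} :
    ∑ w', (satPush F u w sat w').length ≤ ∑ w', (sat w').length + 1 := by
  unfold satPush
  split_ifs
  · rw [← Finset.add_sum_erase _ _ (Finset.mem_univ w),
      ← Finset.add_sum_erase (s := Finset.univ) (f := fun w' => (sat w').length)
        (h := Finset.mem_univ w)]
    rw [Finset.sum_congr (s₁ := Finset.univ.erase w) rfl (g := fun w' => (sat w').length)
      (fun w' hw' => by rw [Function.update_of_ne (Finset.ne_of_mem_erase hw')])]
    simp only [Function.update_self, List.length_cons]
    omega
  · omega

/-! ### Effect of the operations on the invariants -/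

namespace Base

theorem card_of_not_unsat (h : Base G) {w : Fin I.nW} (hw : ¬ UnsatW G.M w) :
    (G.M.filter fun e => e.2 = w).card = I.capW w :=
  le_antisymm (h.capW w) (not_lt.1 hw)

theorem subsatellitic_iff (h : Base G) {u : Fin I.nU} : Subsatellitic G.M u ↔ u ∈ live G.F := by
  simp only [Subsatellitic, mem_live, h.mem_F]

theorem satellite_iff (h : Base G) {u : Fin I.nU} {w w' : Fin I.nW} :
    Satellite G.M u w w' ↔ (u, w) ∈ G.M ∧ (u, w') ∈ G.F ∧ rankU I u w' = rankU I u w := by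
  simp only [Satellite, h.mem_F, TiedU]
  constructor
  · rintro ⟨h1, h2, ⟨h3, h4, h5⟩, h6⟩
    exact ⟨h1, ⟨h4, h2, h6⟩, h5.symm⟩
  · rintro ⟨h1, ⟨h4, h2, h6⟩, h5⟩
    exact ⟨h1, h2, ⟨h.edge _ _ h1, h4, h5.symm⟩, h6⟩

theorem insecure_iff (h : Base G) {w : Fin I.nW} :
    Insecure G.M w ↔ ∃ u, (u, w) ∈ G.M ∧ 0 < tieNum I G.F u (rankU I u w) := by
  simp only [Insecure, h.satellite_iff, tieNum_pos, exists_and_left]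

/-- The list contains every satellitic partner, so if nothing is left after cleaning there is none.
-/
theorem not_insecure (h : Base G) {w : Fin I.nW} (hw : G.sat w = []) : ¬ Insecure G.M w := by
  rw [h.insecure_iff]
  rintro ⟨u, h1, h2⟩
  have := h.mem_sat u w h1 h2
  simp [hw] at this

/-- The pair `(u, w)` itself is counted, so a second free agent in the tie means a count of at least
2. This justifies the test in `linkUnsat`. -/
theorem special_iff (h : Base G) {u : Fin I.nU} {w : Fin I.nW} (hF : (u, w) ∈ G.F) :
    Special G.M u w ↔ ¬ tieNum I G.F u (rankU I u w) < 2 := by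
  rw [not_lt, ← Nat.lt_iff_add_one_le, tieNum, Finset.one_lt_card]
  obtain ⟨he, hw, hm⟩ := (h.mem_F _ _).1 hF
  constructor
  · rintro ⟨-, w', h1, h2, ⟨-, h3, h4⟩, h5⟩
    refine ⟨(u, w'), ?_, (u, w), ?_, ?_⟩
    · simp [h.mem_F, h3, h2, h5, h4]
    · simp [hF]
    · simpa using h1
  · rintro ⟨⟨u1, w1⟩, h1, ⟨u2, w2⟩, h2, hne⟩
    obtain ⟨a1, rfl, a3⟩ := Finset.mem_filter.1 h1
    obtain ⟨b1, rfl, b3⟩ := Finset.mem_filter.1 h2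
    dsimp only at a1 a3 b1 b3 hne
    have key : ∀ w', w' ≠ w → (u2, w') ∈ G.F → rankU I u2 w' = rankU I u2 w →
        Special G.M u2 w := by
      intro w' h1 h2 h3
      obtain ⟨c1, c2, c3⟩ := (h.mem_F _ _).1 h2
      exact ⟨hw, w', h1, c2, ⟨he, c1, h3.symm⟩, c3⟩
    by_cases e : w1 = w
    · subst e
      exact key w2 (fun e => hne (by rw [e])) b1 b3
    · exact key w1 e a1 a3

theorem dropL_of_mem (h : Base G) {u : Fin I.nU} {w : Fin I.nW} (hF : (u, w) ∈ G.F)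
    (L : Fin I.nU → Finset (Fin I.nW)) : dropL G.M L u w = leftAfter G.F L u w := by
  unfold dropL leftAfter
  rw [h.special_iff hF]
  split_ifs <;> rfl

theorem notMem_F (h : Base G) {w : Fin I.nW} (hw : ¬ UnsatW G.M w) (u : Fin I.nU) :
    (u, w) ∉ G.F := fun h' => hw ((h.mem_F _ _).1 h').2.1

/-- Here, and only here, `F` changes. Free pairs remain on the lists `L`, since the only entry that
may be deleted is `w` from `L u`, and `(u, w)` is no longer free. -/
theorem linkUnsat (h : Base G) {u : Fin I.nU} {w : Fin I.nW} (hF : (u, w) ∈ G.F)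
    (hptr : rankU I u w ≤ G.ptr u) : Base { G with
        M := insert (u, w) G.M
        L := leftAfter G.F G.L u w
        F := freeAfter (insert (u, w) G.M) G.F u w
        sat := satPush (G.F.erase (u, w)) u w G.sat } := by
  obtain ⟨he, hw, hm⟩ := (h.mem_F _ _).1 hF
  have hcard := filter_snd_insert_card hm
  have hsub := freeAfter_subset (insert (u, w) G.M) G.F u w
  have hmono : ∀ w', UnsatW (insert (u, w) G.M) w' → UnsatW G.M w' := by
    intro w' h1
    unfold UnsatW at h1 ⊢
    rw [hcard] at h1
    omega
  refine ⟨?_, ?_, ?_, ?_, ?_, ?_, ?_, ?_, ?_, ?_⟩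
  · intro u' w'
    have h1 : (u', w') ∈ G.F.erase (u, w) ↔
        Edge I u' w' ∧ UnsatW G.M w' ∧ (u', w') ∉ insert (u, w) G.M := by
      rw [Finset.mem_erase, h.mem_F, Finset.mem_insert]
      tauto
    have h2 : UnsatW (insert (u, w) G.M) w' ↔ UnsatW G.M w' ∧
        ¬ ((insert (u, w) G.M).filter (fun e => e.2 = w)).card = I.capW w ∨
        UnsatW G.M w' ∧ w' ≠ w := by
      unfold UnsatW at hw ⊢
      have e1 := hcard w'
      have e2 := hcard w
      by_cases hww : w' = w
      · subst hww
        simp only [if_true] at e1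
        simp only [ne_eq, not_true_eq_false, and_false, or_false]
        omega
      · rw [if_neg hww] at e1
        simp only [e1, add_zero, ne_eq, hww, not_false_eq_true, and_true]
        tauto
    dsimp only
    rw [h2]
    unfold freeAfter
    split_ifs with hc
    · rw [Finset.mem_filter, h1]
      tauto
    · rw [h1]
      tauto
  · intro u' w' h1
    rcases Finset.mem_insert.1 h1 with h1 | h1
    · obtain ⟨rfl, rfl⟩ := Prod.mk.inj h1
      exact he
    · exact h.edge _ _ h1
  · intro w'
    dsimp only
    rw [hcard]
    have := h.capW w'
    unfold UnsatW at hw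
    split_ifs with hww
    · subst hww; omega
    · omega
  · exact fun u' w' h1 => h.edgeL _ _ (leftAfter_subset _ _ _ _ _ h1)
  · intro u' w' h1
    have h2 := Finset.mem_erase.1 (hsub h1)
    exact (mem_leftAfter h2.1).2 (h.mem_L _ _ h2.2)
  · intro u' w' h1
    rcases Finset.mem_insert.1 h1 with h1 | h1
    · obtain ⟨rfl, rfl⟩ := Prod.mk.inj h1
      exact hptr
    · exact h.le_ptr _ _ h1
  · exact satPush_nodup h.sat_nodup fun h' => hm (h.mem_M _ _ h')
  · intro u' w' h1
    rcases mem_satPush.1 h1 with h1 | ⟨h1, -⟩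
    · exact Finset.mem_insert_of_mem (h.mem_M _ _ h1)
    · rw [h1]
      exact Finset.mem_insert_self _ _
  · intro u' w' h1 h2
    refine mem_satPush.2 ?_
    dsimp only at h2
    have h3 := lt_of_lt_of_le h2 (tieNum_mono hsub _ _)
    rcases Finset.mem_insert.1 h1 with h1 | h1
    · obtain ⟨rfl, rfl⟩ := Prod.mk.inj h1
      exact Or.inr ⟨rfl, h3⟩
    · exact Or.inl (h.mem_sat _ _ h1 (lt_of_lt_of_le h3 (tieNum_mono (Finset.erase_subset _ _) _ _)))
  · intro u' w' h1
    exact ⟨(h.second _ _ h1).1, fun h2 => (h.second _ _ h1).2 (hmono _ h2)⟩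

theorem clean (h : Base G) {w : Fin I.nW} {l₁ l₂ : List (Fin I.nU)} (hl : G.sat w = l₁ ++ l₂)
    (hl₁ : ∀ u ∈ l₁, tieNum I G.F u (rankU I u w) = 0) :
    Base { G with sat := Function.update G.sat w l₂ } := by
  have hs : ∀ w', List.Sublist (Function.update G.sat w l₂ w') (G.sat w') := by
    intro w'
    by_cases e : w' = w
    · subst e; simp [hl]
    · simp [e]
  refine { h with sat_nodup := ?_, mem_M := ?_, mem_sat := ?_ }
  · exact fun w' => (h.sat_nodup w').sublist (hs w')
  · exact fun u' w' h1 => h.mem_M _ _ ((hs w').subset h1)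
  · intro u' w' h1 h2
    have h3 := h.mem_sat _ _ h1 h2
    dsimp only at h2 ⊢
    by_cases e : w' = w
    · subst e
      rw [hl, List.mem_append] at h3
      rw [Function.update_self]
      refine h3.resolve_left fun h4 => ?_
      have := hl₁ _ h4
      omega
    · rwa [Function.update_of_ne e]

theorem card_swap {M : Finset (Fin I.nU × Fin I.nW)} {u u' : Fin I.nU} {w : Fin I.nW}
    (huw : (u, w) ∉ M) (hu' : (u', w) ∈ M) (w' : Fin I.nW) :
    ((insert (u, w) (M.erase (u', w))).filter fun e => e.2 = w').card =
      (M.filter fun e => e.2 = w').card := by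
  have h1 := filter_snd_insert_card (M := M.erase (u', w)) (u := u) (w := w)
    (fun h => huw (Finset.mem_of_mem_erase h)) w'
  have h2 := filter_snd_erase_card hu' w'
  omega

/-- Since `w` remains saturated, the pair `(u', w)` that leaves the matching does not become free,
and `F` can stay the same. -/
theorem swap (h : Base G) {u u' : Fin I.nU} {w : Fin I.nW} (he : Edge I u w) (huw : (u, w) ∉ G.M)
    (hu' : (u', w) ∈ G.M) (hw : ¬ UnsatW G.M w) (hptr : rankU I u w ≤ G.ptr u) :
    Base { G with
      M := insert (u, w) (G.M.erase (u', w))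
      sat := satPush G.F u w (Function.update G.sat w ((G.sat w).erase u')) } := by
  have hcard := card_swap huw hu'
  have hun : ∀ w', UnsatW (insert (u, w) (G.M.erase (u', w))) w' ↔ UnsatW G.M w' := by
    intro w'
    unfold UnsatW
    rw [hcard]
  have hnd : ∀ w', (Function.update G.sat w ((G.sat w).erase u') w').Nodup := by
    intro w'
    by_cases hww : w' = w
    · subst hww; simpa using (h.sat_nodup w').erase u'
    · simpa [hww] using h.sat_nodup w'
  have hmem : ∀ a w', a ∈ Function.update G.sat w ((G.sat w).erase u') w' ↔
      a ∈ G.sat w' ∧ (a, w') ≠ (u', w) := by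
    intro a w'
    by_cases hww : w' = w
    · subst hww
      simp [(h.sat_nodup w').mem_erase_iff, and_comm]
    · simp [hww]
  refine ⟨?_, ?_, ?_, h.edgeL, h.mem_L, ?_, ?_, ?_, ?_, ?_⟩
  · intro a w'
    dsimp only
    rw [hun, h.mem_F, Finset.mem_insert, Finset.mem_erase, Ne, Prod.mk.injEq, Prod.mk.injEq]
    by_cases hww : w' = w
    · subst hww; simp [hw]
    · simp [hww]
  · intro a w' h1
    rcases Finset.mem_insert.1 h1 with h1 | h1
    · obtain ⟨rfl, rfl⟩ := Prod.mk.inj h1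
      exact he
    · exact h.edge _ _ (Finset.mem_of_mem_erase h1)
  · intro w'
    dsimp only
    rw [hcard]
    exact h.capW _
  · intro a w' h1
    rcases Finset.mem_insert.1 h1 with h1 | h1
    · obtain ⟨rfl, rfl⟩ := Prod.mk.inj h1
      exact hptr
    · exact h.le_ptr _ _ (Finset.mem_of_mem_erase h1)
  · exact satPush_nodup hnd fun h1 => huw (h.mem_M _ _ ((hmem _ _).1 h1).1)
  · intro a w' h1
    rcases mem_satPush.1 h1 with h1 | ⟨h1, -⟩
    · obtain ⟨h2, h3⟩ := (hmem _ _).1 h1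
      exact Finset.mem_insert_of_mem (Finset.mem_erase.2 ⟨h3, h.mem_M _ _ h2⟩)
    · rw [h1]
      exact Finset.mem_insert_self _ _
  · intro a w' h1 h2
    refine mem_satPush.2 ?_
    dsimp only at h2
    rcases Finset.mem_insert.1 h1 with h1 | h1
    · obtain ⟨rfl, rfl⟩ := Prod.mk.inj h1
      exact Or.inr ⟨rfl, h2⟩
    · obtain ⟨h3, h4⟩ := Finset.mem_erase.1 h1
      exact Or.inl ((hmem _ _).2 ⟨h.mem_sat _ _ h4 h2, h3⟩)
  · intro a w' h1
    dsimp only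
    rw [hun]
    exact h.second _ _ h1

end Base

namespace Ready

variable {u : Fin I.nU} {w : Fin I.nW}

/-- All other candidates of `u` are in tie-lists and hence not before the pointer of `u`, while `w`
is not after it. If `w` is saturated, `tied` excludes unsaturated candidates in her tie. -/
theorem onTop (h : Ready G u w) : OnTop G.state u w := by
  refine ⟨h.wL, h.wM, fun w' h1 h2 => ?_⟩
  by_cases e : w' = w
  · subst e
    exact ⟨le_rfl, fun _ => id⟩
  · refine ⟨h.wptr.trans (h.ptr_le _ _ ((h.mem_T _ _).2 ⟨h1, h2, by simpa using e⟩)),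
      fun h3 h4 => ?_⟩
    by_contra hw
    have := h.tied hw
    have hF : (u, w') ∈ G.F := (h.mem_F _ _).2 ⟨h.edgeL _ _ h1, h4, h2⟩
    have := tieNum_pos.2 ⟨w', hF, h3.symm⟩
    omega

theorem uw (h : Ready G u w) : Edge I u w := h.edgeL _ _ h.wL

theorem accept (h : Ready G u w) (hw : UnsatW G.M w) : Inv { G with
        M := insert (u, w) G.M
        L := leftAfter G.F G.L u w
        F := freeAfter (insert (u, w) G.M) G.F u w
        sat := satPush (G.F.erase (u, w)) u w G.sat } := by
  have hF : (u, w) ∈ G.F := (h.mem_F _ _).2 ⟨h.uw, hw, h.wM⟩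
  have hcard := filter_fst_insert_card h.wM
  have hb := h.toBase.linkUnsat hF h.wptr
  refine { hb with mem_T := ?_, ptr_le := h.ptr_le, capU := ?_, again := ?_, done := ?_ }
  · intro u' w'
    dsimp only
    rw [h.mem_T, h.again, Finset.mem_insert]
    by_cases e : (u', w') = (u, w)
    · simp [e]
    · simp [e, mem_leftAfter e]
  · intro u'
    dsimp only
    rw [hcard]
    have h1 := h.capU u'
    have h2 := h.unsat
    unfold UnsatU at h2
    split_ifs with e
    · subst e; omega
    · omega
  · intro u' w' h'
    dsimp only at h'
    rw [h.again] at h'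
    simp at h'
  · intro u' h'
    refine h.done u' ?_
    unfold UnsatU at h' ⊢
    dsimp only at h'
    rw [hcard] at h'
    omega

theorem step_accept (h : Ready G u w) (hw : UnsatW G.M w) :
    Step G.state ⟨insert (u, w) G.M, leftAfter G.F G.L u w, G.second⟩ := by
  have hF : (u, w) ∈ G.F := (h.mem_F _ _).2 ⟨h.uw, hw, h.wM⟩
  rw [← h.dropL_of_mem hF]
  exact Step.accept (A := G.state) u w h.unsat h.onTop hw

theorem dropL_eq (hw : ¬ UnsatW G.M w) :
    dropL G.M G.L u w = Function.update G.L u ((G.L u).erase w) :=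
  if_neg fun h => hw h.1

/-- The lists are shortened when `u` proposes to a saturated `w` and when the list of satellitic
partners of `w` is cleaned. -/
theorem mid (h : Ready G u w) (hw : ¬ UnsatW G.M w) {l₁ l₂ : List (Fin I.nU)}
    (hl : G.sat w = l₁ ++ l₂) (hl₁ : ∀ u ∈ l₁, tieNum I G.F u (rankU I u w) = 0) :
    Mid { G with
      L := Function.update G.L u ((G.L u).erase w)
      sat := Function.update G.sat w l₂ } u w := by
  have hL : ∀ u' w', w' ∈ Function.update G.L u ((G.L u).erase w) u' ↔
      w' ∈ G.L u' ∧ (u', w') ≠ (u, w) := by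
    intro u' w'
    by_cases e : u' = u
    · subst e; simp [and_comm]
    · simp [e]
  exact
  { h.toBase.clean hl hl₁ with
    edgeL := fun u' w' h1 => h.edgeL _ _ ((hL _ _).1 h1).1
    mem_L := fun u' w' h1 => (hL _ _).2 ⟨h.mem_L _ _ h1, by
      rintro e
      obtain ⟨rfl, rfl⟩ := Prod.mk.inj e
      exact h.notMem_F hw _ h1⟩
    mem_T := by
      intro u' w'
      dsimp only
      rw [h.mem_T, hL, h.again]
      simp only [List.not_mem_nil, not_false_eq_true, and_true]
      tauto
    ptr_le := h.ptr_le
    capU := h.capU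
    again := by
      intro u' w' h'
      dsimp only at h'
      rw [h.again] at h'
      simp at h'
    done := h.done
    no_again := h.again
    mem_stack := h.mem_stack
    unsat := h.unsat
    uw := h.uw
    wL := fun h' => ((hL _ _).1 h').2 rfl
    wM := h.wM
    wsat := hw
    wptr := h.wptr
    tied := h.tied hw }

end Ready

theorem Inv.clean (h : Inv G) {w : Fin I.nW} {l₁ l₂ : List (Fin I.nU)} (hl : G.sat w = l₁ ++ l₂)
    (hl₁ : ∀ u ∈ l₁, tieNum I G.F u (rankU I u w) = 0) :
    Inv { G with sat := Function.update G.sat w l₂ } :=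
  { h.toBase.clean hl hl₁ with
    mem_T := h.mem_T
    ptr_le := h.ptr_le
    capU := h.capU
    again := h.again
    done := h.done }

theorem Inv.push_second (h : Inv G) {u : Fin I.nU} {w : Fin I.nW} (he : Edge I u w)
    (hw : ¬ UnsatW G.M w) (hu : u ∈ G.stack) :
    Inv { G with second := Function.update G.second u (G.second u ++ [w]) } := by
  refine { h with second := ?_, done := ?_ }
  · intro u' w' h1
    dsimp only at h1 ⊢
    by_cases e : u' = u
    · subst e
      rw [Function.update_self, List.mem_append, List.mem_singleton] at h1
      rcases h1 with h1 | rfl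
      exacts [h.second _ _ h1, ⟨he, hw⟩]
    · rw [Function.update_of_ne e] at h1
      exact h.second _ _ h1
  · intro u' h1
    by_cases e : u' = u
    · exact Or.inl (e ▸ hu)
    · dsimp only
      rw [Function.update_of_ne e]
      exact h.done _ h1

namespace Mid

variable {u u' : Fin I.nU} {w : Fin I.nW}

/-- The displaced `u'` is put on top of the stack, so he is the one who uses the new entry of
`again` in the next round. That the tie of `w` on his list has no free pair follows from `mem_sat`:
otherwise `u'` would be on the empty list `sat w`. -/
theorem takeOver (h : Mid G u w) (hu' : (u', w) ∈ G.M) (hsat : G.sat w = []) : Inv { G with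
        M := insert (u, w) (G.M.erase (u', w))
        sat := satPush G.F u w G.sat
        again := if w ∈ G.L u' then Function.update G.again u' (G.again u' ++ [w]) else G.again
        stack := u' :: G.stack } := by
  have hne : u' ≠ u := by rintro rfl; exact h.wM hu'
  have hb := h.toBase.swap h.uw h.wM hu' h.wsat h.wptr
  have hupd : Function.update G.sat w ((G.sat w).erase u') = G.sat := by
    rw [hsat]
    exact Function.update_eq_self_iff.2 (by rw [hsat]; rfl)
  rw [hupd] at hb
  have hag : ∀ u1 w1, w1 ∈ (if w ∈ G.L u' then Function.update G.again u' (G.again u' ++ [w])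
      else G.again) u1 ↔ (u1, w1) = (u', w) ∧ w ∈ G.L u' := by
    intro u1 w1
    split_ifs with hL
    · by_cases e : u1 = u'
      · subst e; simp [h.no_again, hL]
      · simp [h.no_again, e]
    · simp [h.no_again, hL]
  have hc1 := filter_fst_insert_card (M := G.M.erase (u', w)) (u := u) (w := w)
    (fun h' => h.wM (Finset.mem_of_mem_erase h'))
  have hc2 := filter_fst_erase_card hu'
  have hT0 : (u', w) ∉ G.T := fun h' => ((h.mem_T _ _).1 h').2.1 hu'
  refine { hb with mem_T := ?_, ptr_le := h.ptr_le, capU := ?_, again := ?_, done := ?_ }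
  · intro u1 w1
    dsimp only
    rw [hag, Finset.mem_insert, Finset.mem_erase]
    by_cases e1 : (u1, w1) = (u', w)
    · obtain ⟨rfl, rfl⟩ := Prod.mk.inj e1
      have : u1 ≠ u := hne
      simp [hT0, this]
    · by_cases e2 : (u1, w1) = (u, w)
      · obtain ⟨rfl, rfl⟩ := Prod.mk.inj e2
        simp only [true_or, not_true_eq_false, false_and, and_false, iff_false]
        exact fun h' => h.wL ((h.mem_T _ _).1 h').1
      · rw [h.mem_T, h.no_again]
        simp [e1, e2]
  · intro u1
    have h1 := hc1 u1
    have h2 := hc2 u1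
    have h3 := h.capU u1
    have h4 := h.unsat
    unfold UnsatU at h4
    dsimp only
    by_cases e : u1 = u
    · subst e
      rw [if_pos rfl] at h1
      rw [if_neg hne.symm] at h2
      omega
    · rw [if_neg e] at h1
      omega
  · intro u1 w1 h1
    dsimp only at h1
    obtain ⟨e, hL⟩ := (hag _ _).1 h1
    obtain ⟨rfl, rfl⟩ := Prod.mk.inj e
    refine ⟨?_, rfl, ?_, hL, ?_, ?_, h.le_ptr _ _ hu', ?_⟩
    · dsimp only
      rw [if_pos hL, Function.update_self, h.no_again]
      rfl
    · unfold UnsatU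
      have h1 := hc1 u1
      have h2 := hc2 u1
      have h3 := h.capU u1
      rw [if_neg hne] at h1
      rw [if_pos rfl] at h2
      dsimp only
      omega
    · have : u1 ≠ u := hne
      simp [this]
    · unfold UnsatW
      dsimp only
      rw [Base.card_swap h.wM hu']
      exact h.wsat
    · by_contra h0
      have := h.mem_sat _ _ hu' (Nat.pos_of_ne_zero h0)
      simp [hsat] at this
  · intro u1 h1
    dsimp only
    by_cases e : u1 = u'
    · exact Or.inl (by simp [e])
    · have : UnsatU G.M u1 := by
        unfold UnsatU at h1 ⊢
        have h2 := hc1 u1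
        have h3 := hc2 u1
        rw [if_neg e] at h3
        dsimp only at h1
        omega
      exact (h.done _ this).imp (List.mem_cons_of_mem _) id

/-- Here `w` returns to a tie-list of `u'` and not to `again u'`. This is consistent with the
pointer of `u'`: the tie also contained `w'`, who was still in `T`, so the pointer has not passed
it. -/
theorem exchange (h : Mid G u w) {l : List (Fin I.nU)} (hsat : G.sat w = u' :: l)
    {w' : Fin I.nW} (hw' : (u', w') ∈ G.F) (hr : rankU I u' w' = rankU I u' w)
    (hne : w' ≠ w) : Inv { G with
        M := insert (u, w) (insert (u', w') (G.M.erase (u', w)))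
        F := freeAfter (insert (u', w') (G.M.erase (u', w))) G.F u' w'
        T := if w ∈ G.L u' then insert (u', w) (G.T.erase (u', w')) else G.T.erase (u', w')
        L := leftAfter G.F G.L u' w'
        sat := satPush (freeAfter (insert (u', w') (G.M.erase (u', w))) G.F u' w') u w
          (satPush (G.F.erase (u', w')) u' w' (Function.update G.sat w l))
        stack := u' :: G.stack } := by
  have hu' : (u', w) ∈ G.M := h.mem_M _ _ (by simp [hsat])
  have hneu : u' ≠ u := by rintro rfl; exact h.wM hu'
  have hwM' : (u', w') ∉ G.M := ((h.mem_F _ _).1 hw').2.2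
  have hptr' : rankU I u' w' ≤ G.ptr u' := hr ▸ h.le_ptr _ _ hu'
  have hT' : (u', w') ∈ G.T := (h.mem_T _ _).2 ⟨h.mem_L _ _ hw', hwM', by simp [h.no_again]⟩
  have hT0 : (u', w) ∉ G.T := fun h' => ((h.mem_T _ _).1 h').2.1 hu'
  have hT1 : (u, w) ∉ G.T := fun h' => h.wL ((h.mem_T _ _).1 h').1
  have hMeq : insert (u', w') (G.M.erase (u', w)) = (insert (u', w') G.M).erase (u', w) :=
    (Finset.erase_insert_of_ne (by simpa using hne)).symm
  have hFeq : freeAfter (insert (u', w') (G.M.erase (u', w))) G.F u' w' =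
      freeAfter (insert (u', w') G.M) G.F u' w' := by
    unfold freeAfter
    have : ((insert (u', w') (G.M.erase (u', w))).filter fun e => e.2 = w').card =
        ((insert (u', w') G.M).filter fun e => e.2 = w').card := by
      rw [hMeq]
      have := filter_snd_erase_card (M := insert (u', w') G.M) (u := u') (w := w)
        (by simp [hu']) w'
      rw [if_neg hne] at this
      exact this
    rw [this]
  -- For the invariants it is convenient to link `u'` with `w'` first and to exchange `u'` for `u`
  -- at `w` afterwards. The program unlinks `(u', w)` first; `hMeq` and `hFeq` show that the outcome
  -- is the same.
  have hb1 := h.toBase.linkUnsat hw' hptr'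
  have huw : (u, w) ∉ insert (u', w') G.M := by
    simp [h.wM, hneu.symm]
  have hsatw : ¬ UnsatW (insert (u', w') G.M) w := by
    have := h.wsat
    unfold UnsatW at this ⊢
    rw [filter_snd_insert_card hwM', if_neg hne.symm]
    exact this
  have hb := hb1.swap (u := u) (u' := u') (w := w) h.uw huw (by simp [hu']) hsatw h.wptr
  have hsatEq : Function.update (satPush (G.F.erase (u', w')) u' w' G.sat) w
      ((satPush (G.F.erase (u', w')) u' w' G.sat w).erase u') =
      satPush (G.F.erase (u', w')) u' w' (Function.update G.sat w l) := by
    have e1 : satPush (G.F.erase (u', w')) u' w' G.sat w = u' :: l := by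
      unfold satPush
      split_ifs
      · rw [Function.update_of_ne hne.symm, hsat]
      · exact hsat
    rw [e1, List.erase_cons_head]
    unfold satPush
    split_ifs
    · rw [Function.update_comm hne.symm, Function.update_of_ne hne]
    · rfl
  dsimp only at hb
  rw [hsatEq, ← hMeq, ← hFeq] at hb
  have hc0 := filter_fst_erase_card hu'
  have hc1 := filter_fst_insert_card (M := G.M.erase (u', w)) (u := u') (w := w')
    (fun h' => hwM' (Finset.mem_of_mem_erase h'))
  have hc2 := filter_fst_insert_card (M := insert (u', w') (G.M.erase (u', w))) (u := u) (w := w)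
    (by simp [h.wM, hneu.symm])
  have hT3 : ∀ u1 w1, (u1, w1) ∈ (if w ∈ G.L u' then insert (u', w) (G.T.erase (u', w'))
      else G.T.erase (u', w')) ↔
      ((u1, w1) = (u', w) ∧ w ∈ G.L u') ∨ ((u1, w1) ∈ G.T ∧ (u1, w1) ≠ (u', w')) := by
    intro u1 w1
    split_ifs with hL
    · simp only [Finset.mem_insert, Finset.mem_erase, hL, and_true]
      tauto
    · simp only [Finset.mem_erase, hL, and_false, false_or]
      tauto
  refine { hb with mem_T := ?_, ptr_le := ?_, capU := ?_, again := ?_, done := ?_ }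
  · intro u1 w1
    dsimp only
    rw [hT3, h.no_again, Finset.mem_insert, Finset.mem_insert, Finset.mem_erase]
    by_cases e1 : (u1, w1) = (u', w')
    · have e1' : (u', w') ≠ (u', w) := by simpa using hne
      simp [e1, e1']
    · rw [mem_leftAfter e1]
      by_cases e2 : (u1, w1) = (u', w)
      · obtain ⟨rfl, rfl⟩ := Prod.mk.inj e2
        have : u1 ≠ u := hneu
        simp [hT0, this, e1]
      · by_cases e3 : (u1, w1) = (u, w)
        · simp [e3, hT1]
          intro e
          exact absurd e.symm hneu
        · rw [h.mem_T, h.no_again]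
          simp [e1, e2, e3]
  · intro u1 w1 h1
    rcases (hT3 _ _).1 h1 with ⟨e, -⟩ | ⟨h1, -⟩
    · obtain ⟨rfl, rfl⟩ := Prod.mk.inj e
      exact (h.ptr_le _ _ hT').trans hr.le
    · exact h.ptr_le _ _ h1
  · intro u1
    have h0 := hc0 u1
    have h1 := hc1 u1
    have h2 := hc2 u1
    have h3 := h.capU u1
    have h4 := h.unsat
    unfold UnsatU at h4
    dsimp only
    by_cases e : u1 = u
    · subst e
      rw [if_pos rfl] at h2
      rw [if_neg hneu.symm] at h0 h1
      omega
    · rw [if_neg e] at h2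
      omega
  · intro u1 w1 h1
    dsimp only at h1
    rw [h.no_again] at h1
    simp at h1
  · intro u1 h1
    have h0 := hc0 u1
    have h2 := hc1 u1
    have h3 := hc2 u1
    have : UnsatU G.M u1 := by
      unfold UnsatU at h1 ⊢
      dsimp only at h1
      omega
    exact (h.done _ this).imp (List.mem_cons_of_mem _) id

end Mid
end ASBM

namespace ASBM

variable {I : Instance} {s : Machine I} {G : Ghost I}

/-! ## Potential -/

theorem sum_update {ι β : Type} [Fintype ι] [DecidableEq ι] (g : ι → β) (f : β → ℕ) (a : ι)
    (b : β) : ∑ x, f (Function.update g a b x) + f (g a) = ∑ x, f (g x) + f b := by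
  rw [← Finset.add_sum_erase _ _ (Finset.mem_univ a),
    ← Finset.add_sum_erase (s := Finset.univ) (f := fun x => f (g x)) (h := Finset.mem_univ a),
    Finset.sum_congr (s₁ := Finset.univ.erase a) rfl (g := fun x => f (g x))
      (fun x hx => by rw [Function.update_of_ne (Finset.ne_of_mem_erase hx)])]
  simp only [Function.update_self]
  omega

/-- The number of pairs in `M` whose first component is subsatellitic. -/
def livePairs (F M : Finset (Fin I.nU × Fin I.nW)) : ℕ := (M.filter fun e => e.1 ∈ live F).card

/-- The time that is available for the demotion of agents who are still subsatellitic. -/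
def liveSum (F : Finset (Fin I.nU × Fin I.nW)) : ℕ :=
  ∑ u, if u ∈ live F then 7 * (I.prefU u).flatten.length + 1 else 0

/-- The time that is available for the saturation of agents who are still unsaturated. -/
def satSum (M : Finset (Fin I.nU × Fin I.nW)) : ℕ :=
  ∑ w, if (M.filter fun e => e.2 = w).card < I.capW w then
    12 * (I.prefW w).flatten.length + 1 else 0

/-- The part of the potential that pays for whole rounds. -/
def weight (G : Ghost I) : ℕ :=
  5 * (∑ u, (G.L u).card + G.F.card) + 2 * livePairs G.F G.M + ∑ u, (G.second u).length +
    G.stack.length + ∑ u, ((I.prefU u).length - G.ptr u)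

/-- The part of the potential that pays for loops within a round. -/
def credit (G : Ghost I) : ℕ := 3 * ∑ w, (G.sat w).length + liveSum G.F + satSum G.M

/-- A shrinking `F` cannot make agents subsatellitic, so only the new pair can add to the count. -/
theorem livePairs_insert {F F' M : Finset (Fin I.nU × Fin I.nW)} (h : F' ⊆ F)
    (e : Fin I.nU × Fin I.nW) : livePairs F' (insert e M) ≤ livePairs F M + 1 := by
  have hl : live F' ⊆ live F := Finset.image_subset_image h
  refine (Finset.card_le_card (t := insert e (M.filter fun e => e.1 ∈ live F)) ?_).trans
    (Finset.card_insert_le _ _)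
  intro a ha
  obtain ⟨h1, h2⟩ := Finset.mem_filter.1 ha
  rcases Finset.mem_insert.1 h1 with rfl | h1
  · exact Finset.mem_insert_self _ _
  · exact Finset.mem_insert_of_mem (Finset.mem_filter.2 ⟨h1, hl h2⟩)

theorem livePairs_erase (F M : Finset (Fin I.nU × Fin I.nW)) (e : Fin I.nU × Fin I.nW) :
    livePairs F (M.erase e) ≤ livePairs F M :=
  Finset.card_le_card (Finset.filter_subset_filter _ (Finset.erase_subset _ _))

/-- In a proposal from `L' u`, the proposer is not subsatellitic and the displaced agent is. The
loss of one such pair, with weight 2, pays for the new entries on the stack and in the list `L'` of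
the displaced agent. -/
theorem livePairs_swap {F M : Finset (Fin I.nU × Fin I.nW)} {u u' : Fin I.nU} {w : Fin I.nW}
    (hu : u ∉ live F) (hu' : u' ∈ live F) (hM : (u', w) ∈ M) :
    livePairs F (insert (u, w) (M.erase (u', w))) + 1 ≤ livePairs F M := by
  refine Nat.succ_le_of_lt (Finset.card_lt_card ?_)
  rw [Finset.ssubset_iff_of_subset]
  · refine ⟨(u', w), by simp [hM, hu'], ?_⟩
    have : u' ≠ u := by rintro rfl; exact hu hu'
    simp [this]
  · intro a ha
    obtain ⟨h1, h2⟩ := Finset.mem_filter.1 ha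
    rcases Finset.mem_insert.1 h1 with rfl | h1
    · exact absurd h2 hu
    · exact Finset.mem_filter.2 ⟨Finset.mem_of_mem_erase h1, h2⟩

/-- The summand of `w` disappears exactly when she gets saturated, and it then covers the cost of
`saturate`. -/
theorem satSum_link {M M' : Finset (Fin I.nU × Fin I.nW)} {w : Fin I.nW}
    (hne : ∀ w', w' ≠ w →
      (M'.filter fun e => e.2 = w').card = (M.filter fun e => e.2 = w').card)
    (hw : (M'.filter fun e => e.2 = w).card = (M.filter fun e => e.2 = w).card + 1)
    (hcard : (M.filter fun e => e.2 = w).card < I.capW w) :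
    satSum M' + (if (M.filter fun e => e.2 = w).card + 1 = I.capW w then
      12 * (I.prefW w).flatten.length + 1 else 0) ≤ satSum M := by
  unfold satSum
  rw [← Finset.add_sum_erase _ _ (Finset.mem_univ w),
    ← Finset.add_sum_erase (s := Finset.univ) (a := w) (h := Finset.mem_univ w),
    Finset.sum_congr (s₁ := Finset.univ.erase w) rfl
      (fun w' hw' => by rw [hne w' (Finset.ne_of_mem_erase hw')]), hw, if_pos hcard]
  split_ifs <;> omega

theorem satSum_congr {M M' : Finset (Fin I.nU × Fin I.nW)}
    (h : ∀ w, (M'.filter fun e => e.2 = w).card = (M.filter fun e => e.2 = w).card) :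
    satSum M' = satSum M := by
  unfold satSum
  simp only [h]

theorem sum_card_le {L L' : Fin I.nU → Finset (Fin I.nW)} (h : ∀ u, L' u ⊆ L u) :
    ∑ u, (L' u).card ≤ ∑ u, (L u).card :=
  Finset.sum_le_sum fun u _ => Finset.card_le_card (h u)

/-! ## Proposals -/

/-- At least one free pair disappears, which releases 5, and at most one pair with a subsatellitic
agent is added, which costs 2. -/
theorem wp_accept (h : Rep s G) {u : Fin I.nU} {w : Fin I.nW} (hr : Ready G u w)
    (hw : UnsatW G.M w) :
    wp (linkUnsat u w) (fun _ s' => ∃ G', Rep s' G' ∧ Inv G' ∧ Step G.state G'.state ∧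
      weight G' + 1 ≤ weight G ∧
      s'.time + credit G' ≤ s.time + credit G + 3 * Nat.log 2 (I.capW w) + 36) s := by
  have hF : (u, w) ∈ G.F := (hr.mem_F _ _).2 ⟨hr.uw, hw, hr.wM⟩
  refine wp_mono (wp_linkUnsat h hr.edge (fun u' w' h' => ((hr.mem_F _ _).1 h').1)
    (fun e h1 h2 => ((hr.mem_F _ _).1 h2).2.2 h1) hF
    (fun h' => ((hr.mem_T _ _).1 h').2.2 rfl) hw ?_) ?_
  · intro u' hu' he hm
    have hF' : (u', w) ∈ G.F := (hr.mem_F _ _).2 ⟨he, hw, hm⟩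
    exact ⟨hF', (hr.mem_T _ _).2 ⟨hr.mem_L _ _ hF', hm, by simpa using hu'⟩⟩
  · rintro _ s' ⟨h1, h2⟩
    refine ⟨_, h1, hr.accept hw, hr.step_accept hw, ?_, ?_⟩
    · have hsub := freeAfter_subset (insert (u, w) G.M) G.F u w
      have e1 := Finset.card_le_card hsub
      rw [Finset.card_erase_of_mem hF] at e1
      have e2 := Finset.card_pos.2 ⟨_, hF⟩
      have e3 := sum_card_le (leftAfter_subset G.F G.L u · w)
      have e4 := livePairs_insert (M := G.M) (hsub.trans (Finset.erase_subset _ _)) (u, w)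
      simp only [weight]
      omega
    · rw [h1.liveCost_eq, h.liveCost_eq] at h2
      have hcard := filter_snd_insert_card hr.wM
      have e1 := satSum_link (M := G.M) (M' := insert (u, w) G.M) (w := w)
        (fun w' hw' => by rw [hcard, if_neg hw', add_zero]) (by rw [hcard, if_pos rfl]) hw
      have e2 := sum_satPush_le (F := G.F.erase (u, w)) (sat := G.sat) (u := u) (w := w)
      simp only [credit, liveSum]
      dsimp only at h2
      omega

/-- `u` is matched with `w`, and `u'` with a satellite. -/
def exchange (u u' : Fin I.nU) (w : Fin I.nW) : Prog I Unit := do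
  let r ← load (.rkU u' w)
  match ← headW (.tie u' r) with
  | none => tick
  | some w' =>
    popU (.sat w)
    unlink u' w
    popW (.tie u' r)
    let x ← load (.inL u' w)
    if x = 1 then pushBackW (.tie u' r) w
    linkUnsat u' w'
    link u w
    pushFrontU .stack u'

/-- The program has already removed `w` from `L u`; `L₀` stands for the lists before that, from
which the step of the algorithm starts. The three tree updates account for `9 * ell`. -/
theorem wp_exchange (h : Rep s G) {u u' : Fin I.nU} {w : Fin I.nW} (hm : Mid G u w)
    {l : List (Fin I.nU)} (hsat : G.sat w = u' :: l)
    (htie : 0 < tieNum I G.F u' (rankU I u' w)) {L₀ : Fin I.nU → Finset (Fin I.nW)}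
    (hL₀ : dropL G.M L₀ u w = G.L) (htop : OnTop ⟨G.M, L₀, G.second⟩ u w) {ell : ℕ}
    (hell : ∀ w, Nat.log 2 (I.capW w) ≤ ell) :
    wp (exchange u u' w) (fun _ s' => ∃ G', Rep s' G' ∧ Inv G' ∧
      Step ⟨G.M, L₀, G.second⟩ G'.state ∧ weight G' ≤ weight G + 4 ∧
      s'.time + credit G' ≤ s.time + credit G + 9 * ell + 90) s := by
  have hu' : (u', w) ∈ G.M := hm.mem_M _ _ (by simp [hsat])
  have hneu : u' ≠ u := by rintro rfl; exact hm.wM hu'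
  have he' : Edge I u' w := hm.edge _ _ hu'
  obtain ⟨w₁, hw₁, hr₁⟩ := tieNum_pos.1 htie
  have hT₁ : (u', w₁) ∈ G.T :=
    (hm.mem_T _ _).2 ⟨hm.mem_L _ _ hw₁, ((hm.mem_F _ _).1 hw₁).2.2, by simp [hm.no_again]⟩
  have hmem := h.mem_tie u' (rankU I u' w)
  have hord := h.tie_order u' (rankU I u' w)
  -- A free `w₁` in the tie makes the tie-list nonempty. Since free agents come first, the head is
  -- free, too, and thus a satellite.
  obtain ⟨w', t, ht⟩ : ∃ w' t, s.lstW (.tie u' (rankU I u' w)) = w' :: t := by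
    rw [← List.ne_nil_iff_exists_cons]
    exact List.ne_nil_of_mem ((hmem w₁).2 ⟨hT₁, hr₁⟩)
  have hmem₁ := (hmem w₁).2 ⟨hT₁, hr₁⟩
  rw [ht] at hmem hord hmem₁
  have hr : rankU I u' w' = rankU I u' w := ((hmem w').1 (by simp)).2
  have hw' : (u', w') ∈ G.F := by
    rcases List.mem_cons.1 hmem₁ with rfl | h'
    exacts [hw₁, List.rel_of_pairwise_cons hord h' hw₁]
  obtain ⟨heF, hunF, hmF⟩ := (hm.mem_F _ _).1 hw'
  have hne : w' ≠ w := by rintro rfl; exact hm.wsat hunF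
  have hT0 : (u', w) ∉ G.T := fun h' => ((hm.mem_T _ _).1 h').2.1 hu'
  have hinv := hm.exchange hsat hw' hr hne
  have hstep := Step.exchange (A := ⟨G.M, L₀, G.second⟩) u w hm.unsat htop hm.wsat u' w'
    (hm.satellite_iff.2 ⟨hu', hw', hr⟩)
  have hM3 : (insert (u, w) (insert (u', w') G.M)).erase (u', w) =
      insert (u, w) (insert (u', w') (G.M.erase (u', w))) := by
    rw [Finset.erase_insert_of_ne (by simpa using hneu.symm),
      Finset.erase_insert_of_ne (by simpa using hne)]
  dsimp only at hstep
  rw [hL₀, hm.dropL_of_mem hw', hM3] at hstep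
  set M₁ := G.M.erase (u', w) with hM₁
  set F₁ := freeAfter (insert (u', w') M₁) G.F u' w' with hF₁
  have c0 := filter_snd_erase_card hu'
  have hmF₁ : (u', w') ∉ M₁ := fun h' => hmF (Finset.mem_of_mem_erase h')
  have c1 := filter_snd_insert_card hmF₁
  have huM₂ : (u, w) ∉ insert (u', w') M₁ := by simp [hM₁, hm.wM, hneu.symm]
  have c2 := filter_snd_insert_card huM₂
  have hcap := hm.card_of_not_unsat hm.wsat
  have hunF' := hunF
  unfold UnsatW at hunF'
  rw [← hM₁] at c0
  simp only [exchange]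
  rw [wp_bind, wp_load, wp_bind, wp_headW, h.rkU u' w he', ht]
  dsimp only [List.head?_cons]
  rw [wp_bind, wp_popU]
  have h1 := h.pop_sat w (s.time + 1 + 1 + 1)
  rw [hsat, List.tail_cons] at h1
  rw [wp_bind]
  refine wp_mono (wp_unlink (G := { G with sat := Function.update G.sat w l }) h1 he' hu')
    fun _ s2 ⟨h2, hW2, ht2⟩ => ?_
  rw [wp_bind, wp_popW]
  have hhead : (s2.lstW (.tie u' (rankU I u' w))).head? = some w' := by
    rw [hW2]
    exact congrArg List.head? ht
  have h3 := h2.pop_tie hhead (s2.time + 1)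
  rw [wp_bind, wp_load, h3.inL]
  dsimp only at ht2
  -- Meanwhile `w` lacks one partner although `F` has not been adjusted. This is harmless: `Rep`
  -- does not relate `F` to `M`, and the invariants are only needed for the final contents.
  have key : ∀ s3, Rep s3 { G with
        M := M₁
        T := if w ∈ G.L u' then insert (u', w) (G.T.erase (u', w')) else G.T.erase (u', w')
        sat := Function.update G.sat w l } →
      s3.time ≤ s.time + 3 * Nat.log 2 (I.capW w) + 25 →
      wp (do
        linkUnsat u' w'
        link u w
        pushFrontU .stack u') (fun _ s' => ∃ G', Rep s' G' ∧ Inv G' ∧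
          Step ⟨G.M, L₀, G.second⟩ G'.state ∧ weight G' ≤ weight G + 4 ∧
          s'.time + credit G' ≤ s.time + credit G + 9 * ell + 90) s3 := by
    intro s3 h4 ht3
    rw [wp_bind]
    refine wp_mono (wp_linkUnsat h4 (fun u' w' h' => hm.edge _ _ (Finset.mem_of_mem_erase h'))
      (fun u' w' h' => ((hm.mem_F _ _).1 h').1)
      (fun e h1 h2 => ((hm.mem_F _ _).1 h2).2.2 (Finset.mem_of_mem_erase h1)) hw' ?_ ?_ ?_)
      fun _ s5 ⟨h5, ht5⟩ => ?_
    · dsimp only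
      split_ifs
      · simpa using hne
      · simp
    · have := c0 w'
      rw [if_neg hne] at this
      dsimp only
      omega
    · intro u₁ hu₁ he₁ hm₁
      dsimp only at hm₁ ⊢
      have hm₁' : (u₁, w') ∉ G.M := fun h' =>
        hm₁ (Finset.mem_erase.2 ⟨fun e => hne (Prod.mk.inj e).2, h'⟩)
      have hF' : (u₁, w') ∈ G.F := (hm.mem_F _ _).2 ⟨he₁, hunF, hm₁'⟩
      have hT' : (u₁, w') ∈ G.T := (hm.mem_T _ _).2 ⟨hm.mem_L _ _ hF', hm₁', by simp [hm.no_again]⟩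
      refine ⟨hF', ?_⟩
      split_ifs <;> simp [hT', hu₁]
    · rw [wp_bind]
      have c0w := c0 w
      have c1w := c1 w
      rw [if_pos rfl] at c0w
      rw [if_neg hne.symm] at c1w
      have hdeg := card_partners_le hm.edge w
      refine wp_mono (wp_link h5 hm.uw huM₂ (by refine lt_min ?_ ?_ <;> dsimp only <;> omega))
        fun _ s6 ⟨h6, ht6⟩ => ?_
      rw [wp_pushFrontU]
      have h7 := h6.set_stack (u' :: G.stack) (s6.time + 1)
      rw [show G.stack = s6.lstU .stack from h6.stack.symm] at h7 hinv
      refine ⟨_, h7, hinv, hstep, ?_, ?_⟩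
      · have hsub := freeAfter_subset (insert (u', w') M₁) G.F u' w'
        rw [← hF₁] at hsub
        have e1 := Finset.card_le_card hsub
        rw [Finset.card_erase_of_mem hw'] at e1
        have e2 := Finset.card_pos.2 ⟨_, hw'⟩
        have e3 := sum_card_le (leftAfter_subset G.F G.L u' · w')
        have e4 := livePairs_insert (M := insert (u', w') M₁) (subset_refl F₁) (u, w)
        have e5 := livePairs_insert (M := M₁) (hsub.trans (Finset.erase_subset _ _)) (u', w')
        have e6 := livePairs_erase G.F G.M (u', w)
        rw [← hM₁] at e6
        have e7 : (s6.lstU .stack).length = G.stack.length := by rw [h6.stack]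
        simp only [weight, List.length_cons]
        omega
      · have e1 := satSum_link (M := G.M) (M' := insert (u, w) (insert (u', w') M₁)) (w := w')
          (fun w₁ hw₁ => by
            have a0 := c0 w₁
            have a1 := c1 w₁
            have a2 := c2 w₁
            rw [if_neg hw₁] at a1
            omega)
          (by
            have a0 := c0 w'
            have a1 := c1 w'
            have a2 := c2 w'
            rw [if_neg hne] at a0 a2
            rw [if_pos rfl] at a1
            omega) hunF'
        have e2 := sum_satPush_le (F := G.F.erase (u', w')) (sat := Function.update G.sat w l)
          (u := u') (w := w')
        have e3 := sum_satPush_le (F := F₁) (sat := satPush (G.F.erase (u', w')) u' w'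
          (Function.update G.sat w l)) (u := u) (w := w)
        have e4 := sum_update G.sat List.length w l
        rw [hsat, List.length_cons] at e4
        have e5 := hell w
        have e6 := hell w'
        have c0w' := c0 w'
        rw [if_neg hne, add_zero] at c0w'
        rw [h5.liveCost_eq, h4.liveCost_eq] at ht5
        dsimp only at ht5 ht6
        rw [c0w', ← hF₁] at ht5
        simp only [credit, liveSum]
        omega
  refine wp_ite (fun hx => ?_) (fun hx => ?_)
  · have hL : w ∈ G.L u' := by
      by_contra hL
      simp [hL] at hx
    rw [wp_bind, wp_pushBackW]
    refine key _ ?_ ?_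
    · rw [if_pos hL]
      exact h3.push_tie (by simp [hT0]) (hm.notMem_F hm.wsat _) rfl _
    · show s2.time + 1 + 1 + 1 ≤ _
      omega
  · have hL : w ∉ G.L u' := fun hL => by simp [hL] at hx
    refine key _ ?_ ?_
    · rw [if_neg hL]
      exact h3.time _
    · show s2.time + 1 + 1 ≤ _
      omega

end ASBM

namespace ASBM

variable {I : Instance} {s : Machine I} {G : Ghost I}

/-! ### Competition for saturated agents; the two kinds of proposals -/

theorem satPush_eq_self {F : Finset (Fin I.nU × Fin I.nW)} {u : Fin I.nU} {w : Fin I.nW}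
    (h : tieNum I F u (rankU I u w) = 0) (sat : Fin I.nW → List (Fin I.nU)) :
    satPush F u w sat = sat := if_neg (by omega)

/-- When the cleaned list is empty, `w` is not insecure. What remains is a condition on one tie,
which `findSub` tests. -/
theorem Base.uneasy_iff (h : Base G) {w : Fin I.nW} (hw : ¬ UnsatW G.M w)
    (hs : G.sat w = []) {u : Fin I.nU} (he : Edge I u w) :
    Uneasy G.M w u ↔ ∃ u₁, (u₁, w) ∈ G.M ∧ rankW I w u₁ = rankW I w u ∧ u₁ ∈ live G.F := by
  unfold Uneasy TiedW
  simp only [h.subsatellitic_iff]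
  constructor
  · rintro ⟨-, -, u₁, h1, h2, h3⟩
    exact ⟨u₁, h1, h3.2.2, h2⟩
  · rintro ⟨u₁, h1, h2, h3⟩
    exact ⟨hw, h.not_insecure hs, u₁, h1, h3, h.edge _ _ h1, he, h2⟩

/-- `u` proposes to a saturated `w` who is not insecure. -/
def compete (u : Fin I.nU) (w : Fin I.nW) : Prog I Unit := do
  let r ← load (.rkW w u)
  let q ← load (.node w 1)
  if r + 1 < q then
    match ← headU (.queue w (q - 1)) with
    | none => tick
    | some u' =>
      takeOver u u' w
      match ← findSub w (q - 1) with
      | none => tick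
      | some _ => pushBackW (.second u') w
  else
    match ← findSub w r with
    | none => tick
    | some _ => pushBackW (.second u) w

theorem Rep'.le_node_one {Mq Ft : Finset (Fin I.nU × Fin I.nW)} {Q : Fin I.nW → Finset (Fin I.nU)}
    (h : Rep' s Mq Q Ft G) {u : Fin I.nU} {w : Fin I.nW} (hu : (u, w) ∈ Mq) :
    rankW I w u + 1 ≤ s.num (.node w 1) :=
  (h.tree w).le_node_one (mem_ranks.2 ⟨u, hu, rfl⟩)

theorem Rep'.exists_node_one {Mq Ft : Finset (Fin I.nU × Fin I.nW)}
    {Q : Fin I.nW → Finset (Fin I.nU)} (h : Rep' s Mq Q Ft G) {u : Fin I.nU} {w : Fin I.nW}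
    (hu : (u, w) ∈ Mq) : ∃ u', (u', w) ∈ Mq ∧ s.num (.node w 1) = rankW I w u' + 1 := by
  obtain ⟨r, h1, h2⟩ := (h.tree w).exists_node_one ⟨_, mem_ranks.2 ⟨u, hu, rfl⟩⟩
  obtain ⟨u', h3, rfl⟩ := mem_ranks.1 h1
  exact ⟨u', h3, h2⟩

theorem sum_push_second (second : Fin I.nU → List (Fin I.nW)) (u : Fin I.nU) (w : Fin I.nW) :
    ∑ x, (Function.update second u (second u ++ [w]) x).length =
      ∑ x, (second x).length + 1 := by
  have := sum_update second List.length u (second u ++ [w])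
  rw [List.length_append, List.length_singleton] at this
  omega

theorem addL'_pos {M : Matching I} {L' : Fin I.nU → List (Fin I.nW)} {u : Fin I.nU} {w : Fin I.nW}
    (h : Uneasy M w u) : addL' M L' w u = Function.update L' u (L' u ++ [w]) := if_pos h

theorem addL'_neg {M : Matching I} {L' : Fin I.nU → List (Fin I.nW)} {u : Fin I.nU} {w : Fin I.nW}
    (h : ¬ Uneasy M w u) : addL' M L' w u = L' := if_neg h

/-- The root of the tree gives the tie of the worst partners, and the head of its queue is a
subsatellitic one if possible. The increase of `weight` is at most 4: 2 for a new pair with a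
subsatellitic agent, 1 for the stack, 1 for a list `L'`. -/
theorem wp_compete (h : Rep s G) {u : Fin I.nU} {w : Fin I.nW} (hm : Mid G u w)
    (hsat : G.sat w = []) {L₀ : Fin I.nU → Finset (Fin I.nW)}
    (hL₀ : dropL G.M L₀ u w = G.L) (htop : OnTop ⟨G.M, L₀, G.second⟩ u w) {ell : ℕ}
    (hell : ∀ w, Nat.log 2 (I.capW w) ≤ ell) :
    wp (compete u w) (fun _ s' => ∃ G', Rep s' G' ∧ Inv G' ∧
      Step ⟨G.M, L₀, G.second⟩ G'.state ∧ weight G' ≤ weight G + 4 ∧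
      s'.time + credit G' ≤ s.time + credit G + 9 * ell + 60) s := by
  have hcap := hm.card_of_not_unsat hm.wsat
  -- Capacities are positive, so a saturated `w` has a partner and her tree is not empty.
  obtain ⟨⟨u₀, w₀⟩, h₀⟩ := Finset.card_pos.1 (hcap ▸ I.capW_pos w)
  obtain ⟨hu₀, rfl⟩ := Finset.mem_filter.1 h₀
  dsimp only at hu₀ hm hcap hsat hL₀ htop ⊢
  obtain ⟨u₂, hu₂, hq⟩ := h.exists_node_one hu₀
  have hle : ∀ u₁, (u₁, w₀) ∈ G.M → rankW I w₀ u₁ ≤ rankW I w₀ u₂ := by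
    intro u₁ h1
    have := h.le_node_one h1
    omega
  have hins := hm.not_insecure hsat
  simp only [compete]
  rw [wp_bind, wp_load, wp_bind, wp_load, h.rkW u w₀ hm.uw]
  dsimp only
  rw [hq, Nat.add_sub_cancel]
  have hworst : ∀ v, Worst G.M w₀ v ↔ (v, w₀) ∈ G.M ∧ rankW I w₀ v = rankW I w₀ u₂ := by
    intro v
    refine and_congr_right fun hv => ?_
    have := hle v hv
    constructor
    · intro h1
      by_contra hne
      exact h1 u₂ hu₂ ⟨hm.edge _ _ hv, hm.edge _ _ hu₂, by omega⟩
    · rintro h1 u₁ h2 ⟨-, -, h3⟩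
      have := hle u₁ h2
      omega
  refine wp_ite (fun hc => ?_) (fun hc => ?_)
  · have hmem := h.mem_queue w₀ (rankW I w₀ u₂)
    have hord := h.queue_order w₀ (rankW I w₀ u₂)
    obtain ⟨u', t, ht⟩ : ∃ u' t, s.lstU (.queue w₀ (rankW I w₀ u₂)) = u' :: t := by
      rw [← List.ne_nil_iff_exists_cons]
      exact List.ne_nil_of_mem ((hmem u₂).2 ⟨hu₂, rfl⟩)
    rw [wp_bind, wp_headU, ht]
    dsimp only [List.head?_cons]
    rw [ht] at hmem hord
    obtain ⟨hu', hr'⟩ := (hmem u').1 (by simp)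
    have hneu : u' ≠ u := by rintro rfl; exact hm.wM hu'
    have hpref : PrefersW I w₀ u u' := ⟨hm.uw, hm.edge _ _ hu', by omega⟩
    have hsub : Subsatellitic G.M u' ∨ ∀ v, Worst G.M w₀ v → ¬ Subsatellitic G.M v := by
      simp only [hm.subsatellitic_iff, hworst]
      by_cases hl : u' ∈ live G.F
      · exact Or.inl hl
      · refine Or.inr fun v hv hvl => hl ?_
        rcases List.mem_cons.1 ((hmem v).2 hv) with rfl | hv'
        exacts [hvl, List.rel_of_pairwise_cons hord hv' hvl]
    have hstep := Step.replace (A := ⟨G.M, L₀, G.second⟩) u w₀ hm.unsat htop hm.wsat hins u'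
      ((hworst u').2 ⟨hu', hr'⟩) hpref hsub
    have hMeq : (insert (u, w₀) G.M).erase (u', w₀) = insert (u, w₀) (G.M.erase (u', w₀)) :=
      Finset.erase_insert_of_ne (by simpa using hneu.symm)
    dsimp only at hstep
    rw [hL₀, hMeq] at hstep
    have hinv := hm.takeOver hu' hsat
    rw [wp_bind]
    refine wp_mono (wp_takeOver (h.time _) hm.edge hm.uw hm.wM hu' hcap.le) fun _ s2 ⟨h2, ht2⟩ => ?_
    dsimp only at ht2
    -- The proposer has no free pair in the tie of `w`, so linking him does not lengthen her list of
    -- satellitic partners.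
    have hsp := satPush_eq_self hm.tied G.sat
    rw [hsp] at h2 hinv
    have hwsat : ¬ UnsatW (insert (u, w₀) (G.M.erase (u', w₀))) w₀ := by
      unfold UnsatW
      rw [Base.card_swap hm.wM hu']
      exact hm.wsat
    have huneasy := Base.uneasy_iff hinv.toBase hwsat hsat (hm.edge _ _ hu')
    have hss := satSum_congr (Base.card_swap hm.wM hu')
    have e4 := livePairs_insert (M := G.M.erase (u', w₀)) (subset_refl G.F) (u, w₀)
    have e6 := livePairs_erase G.F G.M (u', w₀)
    have hl := hell w₀
    rw [wp_bind]
    refine wp_mono (wp_findSub h2 w₀ (rankW I w₀ u₂)) ?_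
    rintro o s3 ⟨h3, ht3, hnone, hsome⟩
    rcases o with _ | u₃
    · rw [wp_tick]
      refine ⟨_, h3.time _, hinv, ?_, ?_, ?_⟩
      · rw [addL'_neg] at hstep
        · exact hstep
        · rw [huneasy]
          rintro ⟨u₁, a1, a2, a3⟩
          exact hnone rfl u₁ a1 (a2.trans hr') a3
      · simp only [weight, List.length_cons]
        omega
      · simp only [credit, hss]
        omega
    · rw [wp_pushBackW]
      have h4 := h3.set_second u' (G.second u' ++ [w₀]) (s3.time + 1)
      have hinv' := hinv.push_second (hm.edge _ _ hu') hwsat (List.mem_cons_self ..)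
      dsimp only at hinv'
      rw [show G.second u' = s3.lstW (.second u') from (h3.second u').symm] at h4 hinv'
      refine ⟨_, h4, hinv', ?_, ?_, ?_⟩
      · rw [addL'_pos] at hstep
        · rw [show G.second u' = s3.lstW (.second u') from (h3.second u').symm] at hstep
          exact hstep
        · rw [huneasy]
          obtain ⟨a1, a2, a3⟩ := hsome u₃ rfl
          exact ⟨u₃, a1, a2.trans hr'.symm, a3⟩
      · rw [show s3.lstW (.second u') = G.second u' from h3.second u']
        simp only [weight, List.length_cons, sum_push_second]
        omega
      · simp only [credit, hss]
        omega
  · have hp : ∀ v, Worst G.M w₀ v → ¬ PrefersW I w₀ u v := by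
      rintro v hv ⟨-, -, h1⟩
      have := ((hworst v).1 hv).2
      omega
    have hstep := Step.reject (A := ⟨G.M, L₀, G.second⟩) u w₀ hm.unsat htop hm.wsat hins hp
    dsimp only at hstep
    rw [hL₀] at hstep
    have huneasy := Base.uneasy_iff hm.toBase hm.wsat hsat hm.uw
    rw [wp_bind]
    refine wp_mono (wp_findSub (h.time _) w₀ (rankW I w₀ u)) ?_
    rintro o s3 ⟨h3, ht3, hnone, hsome⟩
    dsimp only at ht3
    rcases o with _ | u₃
    · rw [wp_tick]
      refine ⟨_, h3.time _, hm.toInv, ?_, by omega, ?_⟩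
      · rw [addL'_neg] at hstep
        · exact hstep
        · rw [huneasy]
          rintro ⟨u₁, a1, a2, a3⟩
          exact hnone rfl u₁ a1 a2 a3
      · dsimp only [Machine.later]
        omega
    · rw [wp_pushBackW]
      have h4 := h3.set_second u (G.second u ++ [w₀]) (s3.time + 1)
      have hinv' := hm.toInv.push_second hm.uw hm.wsat hm.mem_stack
      rw [show G.second u = s3.lstW (.second u) from (h3.second u).symm] at h4 hinv'
      refine ⟨_, h4, hinv', ?_, ?_, ?_⟩
      · rw [addL'_pos] at hstep
        · rw [show G.second u = s3.lstW (.second u) from (h3.second u).symm] at hstep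
          exact hstep
        · rw [huneasy]
          obtain ⟨a1, a2, a3⟩ := hsome u₃ rfl
          exact ⟨u₃, a1, a2, a3⟩
      · rw [show s3.lstW (.second u) = G.second u from h3.second u]
        simp only [weight, sum_push_second]
        omega
      · simp only [credit]
        omega

/-- If `w` is saturated, her removal from `L u` releases 5, of which an exchange or a competition
uses at most 4. -/
theorem wp_propose (h : Rep s G) {u : Fin I.nU} {w : Fin I.nW} (hr : Ready G u w) {ell : ℕ}
    (hell : ∀ w, Nat.log 2 (I.capW w) ≤ ell) :
    wp (propose u w) (fun _ s' => ∃ G', Rep s' G' ∧ Inv G' ∧ Step G.state G'.state ∧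
      weight G' + 1 ≤ weight G ∧
      s'.time + credit G' ≤ s.time + credit G + 9 * ell + 95) s := by
  simp only [propose]
  rw [wp_bind, wp_load, wp_bind, wp_input, h.degW]
  refine wp_ite (fun hw => ?_) (fun hw => ?_)
  · refine wp_mono (wp_accept (h.time (s.time + 1 + 1)) hr hw) ?_
    rintro _ s' ⟨G', h1, h2, h3, h4, h5⟩
    refine ⟨G', h1, h2, h3, h4, ?_⟩
    have := hell w
    dsimp only at h5
    omega
  · change ¬ UnsatW G.M w at hw
    rw [wp_bind, wp_store]
    have h1 := h.store_inL u w (s.time + 1 + 1 + 1)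
    rw [wp_bind]
    refine wp_mono (wp_findSat (G := { G with L := Function.update G.L u ((G.L u).erase w) }) h1
      (w := w) fun u' hu' => hr.edge _ _ (hr.mem_M _ _ hu')) ?_
    rintro o s1 ⟨l₁, l₂, hl, hl₁, ho, hpos, h2, ht2⟩
    have hm := hr.mid hw hl hl₁
    dsimp only at hl hl₁ hpos h2 ht2
    have hdrop := Ready.dropL_eq (u := u) hw
    have hwt : weight { G with
        L := Function.update G.L u ((G.L u).erase w)
        sat := Function.update G.sat w l₂ } + 5 = weight G := by
      have e1 := sum_update G.L Finset.card u ((G.L u).erase w)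
      have e2 := Finset.card_erase_of_mem hr.wL
      have e3 := Finset.card_pos.2 ⟨_, hr.wL⟩
      simp only [weight]
      omega
    have hcr : credit { G with
        L := Function.update G.L u ((G.L u).erase w)
        sat := Function.update G.sat w l₂ } + 3 * (G.sat w).length =
        credit G + 3 * l₂.length := by
      have e1 := sum_update G.sat List.length w l₂
      simp only [credit]
      omega
    rcases l₂ with _ | ⟨u', l⟩
    · obtain rfl : o = none := ho
      refine wp_mono (wp_compete h2 hm (Function.update_self ..) hdrop hr.onTop hell) ?_
      rintro _ s' ⟨G', a1, a2, a3, a4, a5⟩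
      refine ⟨G', a1, a2, a3, ?_, ?_⟩ <;> omega
    · obtain rfl : o = some u' := ho
      refine wp_mono (wp_exchange h2 hm (Function.update_self ..) (hpos u' rfl) hdrop
        hr.onTop hell) ?_
      rintro _ s' ⟨G', a1, a2, a3, a4, a5⟩
      refine ⟨G', a1, a2, a3, ?_, ?_⟩ <;> omega

/-- Here `S₀` stands for the lists `L'` before `w` was removed from `L' u`. That removal pays for
the round, so `weight` need not decrease further. -/
theorem wp_propose' (h : Rep s G) (hi : Inv G) {u : Fin I.nU} {w : Fin I.nW} {ell : ℕ}
    (hell : ∀ w, Nat.log 2 (I.capW w) ≤ ell) (hag : ∀ u, G.again u = []) (hst : u ∈ G.stack)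
    (hu : UnsatU G.M u) (hptr : (I.prefU u).length ≤ G.ptr u) (he : Edge I u w)
    (hw : ¬ UnsatW G.M w) {S₀ : Fin I.nU → List (Fin I.nW)} {l₀ : List (Fin I.nW)}
    (hl₀ : S₀ u = w :: l₀) (hS₀ : Function.update S₀ u l₀ = G.second) :
    wp (propose' u w) (fun _ s' => ∃ G', Rep s' G' ∧ Inv G' ∧ Step ⟨G.M, G.L, S₀⟩ G'.state ∧
      weight G' ≤ weight G ∧
      s'.time + credit G' ≤ s.time + credit G + 9 * ell + 60) s := by
  -- Candidates are in tie-lists not before the pointer, but the pointer has passed the last tie.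
  have hex : Exhausted ⟨G.M, G.L, S₀⟩ u := by
    intro w' h1
    by_contra h2
    have := hi.ptr_le _ _ ((hi.mem_T u w').2 ⟨h1, h2, by simp [hag]⟩)
    have := rankU_lt (hi.edgeL _ _ h1)
    omega
  -- Free pairs lie on `L u`, where only partners are left; hence `u` is not subsatellitic.
  have hlive : ∀ w', (u, w') ∉ G.F := fun w' h1 =>
    ((hi.mem_F _ _).1 h1).2.2 (hex w' (hi.mem_L _ _ h1))
  have hrej : (u, w) ∈ G.M ∨ ¬ Uneasy G.M w u → Step ⟨G.M, G.L, S₀⟩ G.state := by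
    intro h1
    have := Step.reject' (A := ⟨G.M, G.L, S₀⟩) u w l₀ hu hex hl₀ h1
    rw [hS₀] at this
    exact this
  simp only [propose']
  rw [wp_bind, wp_load, h.inM]
  refine wp_ite (fun hx => ?_) (fun hx => ?_)
  · have hM : (u, w) ∉ G.M := fun hM => by simp [hM] at hx
    rw [wp_bind]
    refine wp_mono (wp_findSat (h.time _) (w := w) fun u' hu' => hi.edge _ _ (hi.mem_M _ _ hu')) ?_
    rintro o s1 ⟨l₁, l₂, hl, hl₁, ho, hpos, h2, ht2⟩
    dsimp only at ht2
    have hi2 := hi.clean hl hl₁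
    have hcr : credit { G with sat := Function.update G.sat w l₂ } + 3 * (G.sat w).length =
        credit G + 3 * l₂.length := by
      have e1 := sum_update G.sat List.length w l₂
      simp only [credit]
      omega
    rcases l₂ with _ | ⟨u', l⟩
    · obtain rfl : o = none := ho
      have hm : Mid { G with sat := Function.update G.sat w [] } u w :=
        { hi2 with
          no_again := hag
          mem_stack := hst
          unsat := hu
          uw := he
          wL := fun h1 => hM (hex w h1)
          wM := hM
          wsat := hw
          wptr := (rankU_lt he).le.trans hptr
          tied := Nat.eq_zero_of_not_pos fun h1 => by
            obtain ⟨w', h2, -⟩ := tieNum_pos.1 h1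
            exact hlive w' h2 }
      have hs : Function.update G.sat w [] w = [] := Function.update_self ..
      have huneasy := Base.uneasy_iff hm.toBase hm.wsat hs he
      dsimp only at huneasy
      rw [wp_bind, wp_load, h2.rkW u w he, wp_bind]
      refine wp_mono (wp_findSub (h2.time _) w (rankW I w u)) ?_
      rintro o s3 ⟨h3, ht3, hnone, hsome⟩
      dsimp only at ht3 hnone hsome
      rw [List.length_nil] at hcr ht2
      rcases o with _ | u'
      · rw [wp_tick]
        refine ⟨_, h3.time _, hi2, hrej (Or.inr ?_), le_rfl, ?_⟩
        · rw [huneasy]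
          rintro ⟨u₁, a1, a2, a3⟩
          exact hnone rfl u₁ a1 a2 a3
        · dsimp only [Machine.later] at hcr ⊢
          omega
      · obtain ⟨b1, b2, b3⟩ := hsome u' rfl
        have hneu : u' ≠ u := by rintro rfl; exact hM b1
        have hsp := satPush_eq_self hm.tied (Function.update G.sat w [])
        have hinv := hm.takeOver b1 hs
        rw [wp_bind]
        refine wp_mono (wp_takeOver h3 hm.edge he hM b1 (hm.capW w)) ?_
        rintro _ s4 ⟨h4, ht4⟩
        dsimp only at hsp h4 ht4 hinv
        rw [hsp] at h4 hinv
        have hwsat : ¬ UnsatW (insert (u, w) (G.M.erase (u', w))) w := by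
          unfold UnsatW
          rw [Base.card_swap hM b1]
          exact hw
        rw [wp_pushBackW]
        have h5 := h4.set_second u' (G.second u' ++ [w]) (s4.time + 1)
        have hinv' := hinv.push_second (hi.edge _ _ b1) hwsat (List.mem_cons_self ..)
        dsimp only at hinv'
        have hstep := Step.accept' (A := ⟨G.M, G.L, S₀⟩) u w l₀ hu hex hl₀ hM
          (huneasy.2 ⟨u', b1, b2, b3⟩) u' b1 (hi.subsatellitic_iff.2 b3)
          ⟨hi.edge _ _ b1, he, b2⟩
        have hMeq : (insert (u, w) G.M).erase (u', w) = insert (u, w) (G.M.erase (u', w)) :=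
          Finset.erase_insert_of_ne (by simpa using hneu.symm)
        dsimp only at hstep
        have hun' := Base.uneasy_iff hm.toBase hm.wsat hs (hi.edge _ _ b1)
        dsimp only at hun'
        -- Before the exchange, `u'` himself is a subsatellitic partner as good as `u'`. So `w` is
        -- uneasy with respect to him, and the program may append her without a test.
        rw [hMeq, hS₀, addL'_pos (hun'.2 ⟨u', b1, rfl, b3⟩)] at hstep
        rw [show G.second u' = s4.lstW (.second u') from (h4.second u').symm] at h5 hinv' hstep
        refine ⟨_, h5, hinv', hstep, ?_, ?_⟩
        · rw [show s4.lstW (.second u') = G.second u' from h4.second u']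
          have e1 := livePairs_swap (F := G.F) (u := u)
            (fun h' => by obtain ⟨w', h'⟩ := mem_live.1 h'; exact hlive w' h') b3 b1
          simp only [weight, List.length_cons, sum_push_second]
          omega
        · have hss := satSum_congr (Base.card_swap hM b1)
          have hl := hell w
          simp only [credit, hss] at hcr ⊢
          omega
    · obtain rfl : o = some u' := ho
      rw [wp_tick]
      refine ⟨_, h2.time _, hi2, hrej (Or.inr ?_), le_rfl, ?_⟩
      · rintro ⟨-, h1, -⟩
        exact h1 (hi.insecure_iff.2 ⟨u', hi.mem_M _ _ (by rw [hl]; simp), hpos u' rfl⟩)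
      · dsimp only [Machine.later]
        omega
  · have hM : (u, w) ∈ G.M := by
      by_contra hM
      simp [hM] at hx
    rw [wp_pure]
    refine ⟨G, h.time _, hi, hrej (Or.inl hM), le_rfl, ?_⟩
    dsimp only [Machine.later]
    omega

end ASBM

namespace ASBM

variable {I : Instance} {s : Machine I} {G : Ghost I}

/-! ## One round -/

theorem Inv.again_eq_nil (h : Inv G) {u : Fin I.nU} {l : List (Fin I.nU)} (hst : G.stack = u :: l)
    {u' : Fin I.nU} (hu : u' ≠ u) : G.again u' = [] := by
  refine List.eq_nil_iff_forall_not_mem.2 fun w hw => hu ?_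
  have := (h.again u' w hw).2.1
  rw [hst] at this
  exact (Option.some.inj this).symm

/-- Only the agent on top of the stack can have an entry in `again`, and he has just one. So all
these lists are empty afterwards. -/
theorem Inv.pop_again (h : Inv G) {u : Fin I.nU} {l : List (Fin I.nU)} (hst : G.stack = u :: l)
    {w : Fin I.nW} (hw : w ∈ G.again u) :
    Ready { G with again := Function.update G.again u [] } u w := by
  obtain ⟨h1, -, h2, h3, h4, h5, h6, h7⟩ := h.again u w hw
  refine { h with
    mem_T := ?_
    again := ?_
    mem_stack := ?_
    unsat := h2
    wL := h3
    wM := h4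
    wptr := h6
    tied := fun _ => h7 }
  · intro u' w'
    dsimp only
    rw [h.mem_T]
    refine and_congr_right fun _ => and_congr_right fun _ => not_congr ?_
    by_cases e : u' = u
    · subst e
      simp [h1]
    · simp [h.again_eq_nil hst e, e]
  · intro u'
    dsimp only
    by_cases e : u' = u
    · subst e
      simp
    · simp [h.again_eq_nil hst e, e]
  · dsimp only
    rw [hst]
    exact List.mem_cons_self ..

/-- If the first agent of the tie-list is saturated, no agent in the list is free, because free ones
come first. Free agents of the tie are all in this list, which gives `tied`. -/
theorem Inv.pop_tie (h : Inv G) (hr : Rep s G) {u : Fin I.nU} (hst : u ∈ G.stack)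
    (hag : ∀ u, G.again u = []) (hu : UnsatU G.M u) {w : Fin I.nW}
    (hw : (s.lstW (.tie u (G.ptr u))).head? = some w) :
    Ready { G with T := G.T.erase (u, w) } u w := by
  obtain ⟨l, hl⟩ : ∃ l, s.lstW (.tie u (G.ptr u)) = w :: l := List.head?_eq_some_iff.1 hw
  have hmem := hr.mem_tie u (G.ptr u)
  have hord := hr.tie_order u (G.ptr u)
  rw [hl] at hmem hord
  obtain ⟨h1, h2⟩ := (hmem w).1 (by simp)
  obtain ⟨h3, h4, -⟩ := (h.mem_T u w).1 h1
  refine { h with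
    mem_T := ?_
    ptr_le := ?_
    again := hag
    mem_stack := hst
    unsat := hu
    wL := h3
    wM := h4
    wptr := h2.le
    tied := ?_ }
  · intro u' w'
    dsimp only
    rw [Finset.mem_erase, h.mem_T, hag]
    simp only [List.not_mem_nil, not_false_eq_true, and_true]
    tauto
  · intro u' w' h5
    exact h.ptr_le _ _ (Finset.mem_of_mem_erase h5)
  · intro h5
    refine Nat.eq_zero_of_not_pos fun h6 => ?_
    obtain ⟨w', h7, h8⟩ := tieNum_pos.1 h6
    dsimp only at h5 h7
    obtain ⟨-, -, h9⟩ := (h.mem_F _ _).1 h7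
    have hT : (u, w') ∈ G.T := (h.mem_T _ _).2 ⟨h.mem_L _ _ h7, h9, by simp [hag]⟩
    have hF : (u, w) ∈ G.F := by
      rcases List.mem_cons.1 ((hmem w').2 ⟨hT, h8.trans h2⟩) with rfl | h'
      exacts [h7, List.rel_of_pairwise_cons hord h' h7]
    exact h5 ((h.mem_F _ _).1 hF).2.1

/-- The pointer may pass its tie because the list there is empty. -/
theorem Inv.incr_ptr (h : Inv G) (hr : Rep s G) {u : Fin I.nU} (hag : ∀ u, G.again u = [])
    (hl : s.lstW (.tie u (G.ptr u)) = []) :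
    Inv { G with ptr := Function.update G.ptr u (G.ptr u + 1) } := by
  have hle : ∀ u', G.ptr u' ≤ Function.update G.ptr u (G.ptr u + 1) u' := by
    intro u'
    by_cases e : u' = u
    · subst e
      simp
    · simp [e]
  refine { h with le_ptr := ?_, ptr_le := ?_, again := ?_, done := ?_ }
  · exact fun u' w' h1 => (h.le_ptr _ _ h1).trans (hle u')
  · intro u' w' h1
    have h2 := h.ptr_le _ _ h1
    dsimp only
    by_cases e : u' = u
    · subst e
      rw [Function.update_self]
      refine lt_of_le_of_ne h2 fun h3 => ?_
      have := (hr.mem_tie u' (G.ptr u') w').2 ⟨h1, h3.symm⟩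
      simp [hl] at this
    · simpa [e] using h2
  · intro u' w' h1
    simp [hag] at h1
  · intro u' h1
    exact (h.done u' h1).imp_right fun h2 => ⟨h2.1.trans (hle u'), h2.2⟩

theorem Inv.pop_second (h : Inv G) {u : Fin I.nU} (hst : u ∈ G.stack) {w : Fin I.nW}
    {l : List (Fin I.nW)} (hl : G.second u = w :: l) :
    Inv { G with second := Function.update G.second u l } := by
  refine { h with second := ?_, done := ?_ }
  · intro u' w' h1
    dsimp only at h1
    by_cases e : u' = u
    · subst e
      rw [Function.update_self] at h1
      exact h.second _ _ (by rw [hl]; exact List.mem_cons_of_mem _ h1)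
    · rw [Function.update_of_ne e] at h1
      exact h.second _ _ h1
  · intro u' h1
    by_cases e : u' = u
    · exact Or.inl (e ▸ hst)
    · refine (h.done u' h1).imp_right fun h2 => ⟨h2.1, ?_⟩
      dsimp only
      rw [Function.update_of_ne e, h2.2]

theorem Inv.pop_stack (h : Inv G) {u : Fin I.nU} {l : List (Fin I.nU)} (hst : G.stack = u :: l)
    (hag : G.again u = []) (hu : UnsatU G.M u →
      (I.prefU u).length ≤ G.ptr u ∧ G.second u = []) : Inv { G with stack := l } := by
  refine { h with again := ?_, done := ?_ }
  · intro u' w' h1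
    by_cases e : u' = u
    · simp [e, hag] at h1
    · simp [h.again_eq_nil hst e] at h1
  · intro u' h1
    by_cases e : u' = u
    · subst e
      exact Or.inr (hu h1)
    · refine (h.done u' h1).imp_left fun h2 => ?_
      rw [hst] at h2
      exact (List.mem_cons.1 h2).resolve_left e

/-- A round without a proposal leaves the variables of the algorithm unchanged. It advances a
pointer or shortens the stack, and either decreases `weight` by one. -/
theorem wp_round (h : Rep s G) (hi : Inv G) {u : Fin I.nU} {l : List (Fin I.nU)}
    (hst : G.stack = u :: l) {ell : ℕ} (hell : ∀ w, Nat.log 2 (I.capW w) ≤ ell) :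
    wp round (fun _ s' => ∃ G', Rep s' G' ∧ Inv G' ∧
      (G'.state = G.state ∨ Step G.state G'.state) ∧ weight G' + 1 ≤ weight G ∧
      s'.time + credit G' ≤ s.time + credit G + 9 * ell + 105) s := by
  have hmem : u ∈ G.stack := by
    rw [hst]
    exact List.mem_cons_self ..
  have hpop : ∀ t, t ≤ s.time + 10 → G.again u = [] → (UnsatU G.M u →
      (I.prefU u).length ≤ G.ptr u ∧ G.second u = []) →
      ∃ G', Rep ⟨s.num, Function.update s.lstU .stack (s.lstU .stack).tail, s.lstW, t⟩ G' ∧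
      Inv G' ∧ (G'.state = G.state ∨ Step G.state G'.state) ∧ weight G' + 1 ≤ weight G ∧
      t + credit G' ≤ s.time + credit G + 9 * ell + 105 := by
    intro t ht h1 h2
    have h3 := h.set_stack (s.lstU .stack).tail t
    refine ⟨{ G with stack := (s.lstU .stack).tail }, h3, ?_, Or.inl rfl, ?_, ?_⟩
    · rw [h.stack, hst, List.tail_cons]
      exact hi.pop_stack hst h1 h2
    · simp only [weight, h.stack, hst, List.tail_cons, List.length_cons]
      omega
    · simp only [credit]
      omega
  simp only [round]
  rw [wp_bind, wp_headU, h.stack, hst]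
  dsimp only [List.head?_cons]
  rw [wp_bind, wp_load, h.degU, wp_bind, wp_input]
  refine wp_ite (fun hu => ?_) (fun hu => ?_)
  · change UnsatU G.M u at hu
    rw [wp_bind, wp_headW, h.again]
    rcases hag : G.again u with _ | ⟨w, t⟩
    · have hag' : ∀ u', G.again u' = [] := fun u' => by
        by_cases e : u' = u
        · rw [e, hag]
        · exact hi.again_eq_nil hst e
      dsimp only [List.head?_nil]
      rw [wp_bind, wp_load, h.ptr, wp_bind, wp_input]
      refine wp_ite (fun hp => ?_) (fun hp => ?_)
      · rw [wp_bind, wp_headW]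
        rcases ht : (s.lstW (.tie u (G.ptr u))).head? with _ | w
        · dsimp only
          have hnil : s.lstW (.tie u (G.ptr u)) = [] := List.head?_eq_none_iff.1 ht
          rw [wp_incr]
          refine ⟨_, h.incr_ptr u _, hi.incr_ptr h hag' hnil, Or.inl rfl, ?_, ?_⟩
          · have e1 : ∑ x, ((I.prefU x).length - Function.update G.ptr u (G.ptr u + 1) x) + 1 =
                ∑ x, ((I.prefU x).length - G.ptr x) := by
              rw [← Finset.add_sum_erase _ _ (Finset.mem_univ u),
                ← Finset.add_sum_erase (s := Finset.univ) (a := u) (h := Finset.mem_univ u),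
                Finset.sum_congr (s₁ := Finset.univ.erase u) rfl (fun x hx => by
                  rw [Function.update_of_ne (Finset.ne_of_mem_erase hx)]), Function.update_self]
              omega
            simp only [weight]
            omega
          · simp only [credit]
            omega
        · dsimp only
          rw [wp_bind, wp_popW]
          have h1 := h.pop_tie ht (s.time + 1 + 1 + 1 + 1 + 1 + 1 + 1 + 1)
          have h2 := hi.pop_tie h hmem hag' hu ht
          refine wp_mono (wp_propose h1 h2 hell) ?_
          rintro _ s' ⟨G', a1, a2, a3, a4, a5⟩
          refine ⟨G', a1, a2, Or.inr a3, a4, ?_⟩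
          dsimp only [credit] at a5 ⊢
          omega
      · rw [wp_bind, wp_headW]
        simp only [h.second]
        rcases ht : G.second u with _ | ⟨w, t⟩
        · dsimp only [List.head?_nil]
          rw [wp_popU]
          exact hpop _ (by dsimp only [Machine.later]; omega) hag fun _ => ⟨not_lt.1 hp, ht⟩
        · dsimp only [List.head?_cons]
          rw [wp_bind, wp_popW]
          have h1 := h.set_second u (s.lstW (.second u)).tail
            (s.time + 1 + 1 + 1 + 1 + 1 + 1 + 1 + 1)
          have h2 := hi.pop_second hmem ht
          obtain ⟨h3, h4⟩ := hi.second u w (by rw [ht]; exact List.mem_cons_self ..)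
          have h5 : (s.lstW (.second u)).tail = t := by rw [h.second, ht, List.tail_cons]
          have e1 := sum_update G.second List.length u t
          rw [ht, List.length_cons] at e1
          rw [← h5] at h2
          refine wp_mono (wp_propose' (S₀ := G.second) (l₀ := t)
            (G := { G with second := Function.update G.second u (s.lstW (.second u)).tail }) h1 h2
            hell hag' hmem hu (not_lt.1 hp) h3 h4 ht (by dsimp only; rw [h5])) ?_
          rintro _ s' ⟨G', a1, a2, a3, a4, a5⟩
          refine ⟨G', a1, a2, Or.inr a3, a4.trans_lt ?_, ?_⟩
          · simp only [weight, h5]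
            omega
          · dsimp only [credit] at a5 ⊢
            omega
    · have hw : w ∈ G.again u := by
        rw [hag]
        exact List.mem_cons_self ..
      have h1 := h.set_again u (s.lstW (.again u)).tail (s.time + 1 + 1 + 1 + 1 + 1)
      have h2 := hi.pop_again hst hw
      have h3 : (s.lstW (.again u)).tail = [] := by
        rw [h.again, (hi.again u w hw).1, List.tail_cons]
      dsimp only [List.head?_cons]
      rw [wp_bind, wp_popW]
      rw [← h3] at h2
      refine wp_mono (wp_propose
        (G := { G with again := Function.update G.again u (s.lstW (.again u)).tail }) h1 h2 hell) ?_
      rintro _ s' ⟨G', a1, a2, a3, a4, a5⟩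
      refine ⟨G', a1, a2, Or.inr a3, a4, ?_⟩
      dsimp only [credit] at a5 ⊢
      omega
  · rw [wp_popU]
    refine hpop _ (by dsimp only [Machine.later]; omega) ?_ fun h1 => absurd h1 hu
    refine List.eq_nil_iff_forall_not_mem.2 fun w hw => hu (hi.again u w hw).2.2.1

end ASBM

namespace ASBM

variable {I : Instance} {s : Machine I}

/-! ## Setup -/

/-- The machine during the setup: the pairs in `F` have been entered in the tables of the
proposing side, the pairs in `R` in those of the other side. -/
structure SetupInv (s : Machine I) (F R : Finset (Fin I.nU × Fin I.nW)) (st : List (Fin I.nU)) :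
    Prop where
  rkU : ∀ u w, (u, w) ∈ F → s.num (.rkU u w) = rankU I u w
  rkW : ∀ u w, (u, w) ∈ R → s.num (.rkW w u) = rankW I w u
  size : ∀ w, s.num (.size w) = min (I.capW w) (R.filter fun e => e.2 = w).card
  numFree : ∀ w, s.num (.numFree w) = min (I.capW w) (R.filter fun e => e.2 = w).card
  free : ∀ w, ∀ i < s.num (.size w), s.num (.free w i) = i
  node : ∀ w i, s.num (.node w i) = 0
  inM : ∀ u w, s.num (.inM u w) = 0
  inL : ∀ u w, s.num (.inL u w) = if (u, w) ∈ F then 1 else 0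
  degU : ∀ u, s.num (.degU u) = 0
  degW : ∀ w, s.num (.degW w) = 0
  cnt : ∀ u, s.num (.cnt u) = (F.filter fun e => e.1 = u).card
  tieCnt : ∀ u r, s.num (.tieCnt u r) = (F.filter fun e => e.1 = u ∧ rankU I u e.2 = r).card
  ptr : ∀ u, s.num (.ptr u) = 0
  queue : ∀ w r, s.lstU (.queue w r) = []
  sat : ∀ w, s.lstU (.sat w) = []
  stack : s.lstU .stack = st
  tie_nodup : ∀ u r, (s.lstW (.tie u r)).Nodup
  mem_tie : ∀ u r w, w ∈ s.lstW (.tie u r) ↔ (u, w) ∈ F ∧ rankU I u w = r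
  again : ∀ u, s.lstW (.again u) = []
  second : ∀ u, s.lstW (.second u) = []

namespace SetupInv

variable {F R : Finset (Fin I.nU × Fin I.nW)} {st : List (Fin I.nU)}

theorem time (h : SetupInv s F R st) (t : ℕ) : SetupInv { s with time := t } F R st := { h with }

theorem blank : SetupInv (Machine.blank I) ∅ ∅ [] := by
  constructor <;> simp [Machine.blank]

theorem filter_insert_card {e : Fin I.nU × Fin I.nW} (he : e ∉ F)
    (p : Fin I.nU × Fin I.nW → Prop) [DecidablePred p] :
    ((insert e F).filter p).card = (F.filter p).card + if p e then 1 else 0 := by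
  rw [Finset.filter_insert]
  split_ifs
  · rw [Finset.card_insert_of_notMem (by simp [he])]
  · rfl

theorem wp_enterU (h : SetupInv s F R st) {u : Fin I.nU} {w : Fin I.nW} (he : (u, w) ∉ F) :
    wp (do
      store (.rkU u w) (rankU I u w)
      store (.inL u w) 1
      pushBackW (.tie u (rankU I u w)) w
      incr (.tieCnt u (rankU I u w))
      incr (.cnt u)) (fun _ s' => SetupInv s' (insert (u, w) F) R st ∧ s'.time = s.time + 7) s := by
  simp only [wp_bind, wp_store, wp_pushBackW, wp_incr]
  refine ⟨{ h with
    rkU := ?_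
    inL := ?_
    cnt := ?_
    tieCnt := ?_
    tie_nodup := ?_
    mem_tie := ?_ }, trivial⟩
  · intro u' w' h'
    have e1 := h.rkU u' w'
    simp only [Function.update_apply, reduceCtorEq, if_false, NumCell.rkU.injEq]
    split_ifs with e
    · rw [e.1, e.2]
    · refine e1 ((Finset.mem_insert.1 h').resolve_left fun h2 => e ?_)
      exact Prod.mk.inj h2
  · intro u' w'
    simp only [Function.update_apply, reduceCtorEq, if_false, NumCell.inL.injEq, h.inL,
      Finset.mem_insert, Prod.mk.injEq]
    split_ifs <;> simp_all
  · intro u'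
    simp only [Function.update_apply, reduceCtorEq, if_false, NumCell.cnt.injEq, h.cnt,
      filter_insert_card he]
    by_cases e : u' = u
    · subst e; simp
    · simp [e, Ne.symm e]
  · intro u' r
    simp only [Function.update_apply, reduceCtorEq, if_false, NumCell.tieCnt.injEq, h.tieCnt,
      filter_insert_card he]
    by_cases e : u' = u ∧ r = rankU I u w
    · obtain ⟨rfl, rfl⟩ := e; simp
    · rw [if_neg e, if_neg, add_zero]
      rintro ⟨rfl, h'⟩
      exact e ⟨rfl, h'.symm⟩
  · intro u' r
    simp only [Function.update_apply, WCell.tie.injEq]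
    split_ifs with e
    · rw [List.nodup_append]
      refine ⟨h.tie_nodup _ _, List.nodup_singleton _, ?_⟩
      rintro a ha _ hb rfl
      rw [List.mem_singleton] at hb
      subst hb
      exact he ((h.mem_tie _ _ _).1 ha).1
    · exact h.tie_nodup _ _
  · intro u' r w'
    simp only [Function.update_apply, WCell.tie.injEq]
    split_ifs with e
    · obtain ⟨rfl, rfl⟩ := e
      simp only [List.mem_append, h.mem_tie, List.mem_singleton, Finset.mem_insert,
        Prod.mk.injEq, true_and]
      constructor
      · rintro (h1 | rfl)
        · exact ⟨Or.inr h1.1, h1.2⟩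
        · exact ⟨Or.inl rfl, rfl⟩
      · rintro ⟨h1 | h1, h2⟩
        · exact Or.inr h1
        · exact Or.inl ⟨h1, h2⟩
    · rw [h.mem_tie, Finset.mem_insert]
      refine and_congr_left fun h1 => ?_
      refine (or_iff_right fun h2 => e ?_).symm
      obtain ⟨rfl, rfl⟩ := Prod.mk.inj h2
      exact ⟨rfl, h1.symm⟩

theorem pushStack (h : SetupInv s F R st) (u : Fin I.nU) (t : ℕ) :
    SetupInv ⟨s.num, Function.update s.lstU .stack (s.lstU .stack ++ [u]), s.lstW, t⟩ F R
      (st ++ [u]) :=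
  { h with stack := by simp [h.stack] }

theorem wp_enterW (h : SetupInv s F R st) {u : Fin I.nU} {w : Fin I.nW} (he : (u, w) ∉ R) :
    wp (do
      store (.rkW w u) (rankW I w u)
      let d ← load (.size w)
      let c ← input (I.capW w)
      if d < c then
        store (.free w d) d
        incr (.size w)
        incr (.numFree w)) (fun _ s' => SetupInv s' F (insert (u, w) R) st ∧
          s'.time ≤ s.time + 8) s := by
  have hrk : ∀ u' w', (u', w') ∈ insert (u, w) R →
      Function.update s.num (.rkW w u) (rankW I w u) (.rkW w' u') = rankW I w' u' := by
    intro u' w' h'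
    have e1 := h.rkW u' w'
    simp only [Function.update_apply, NumCell.rkW.injEq]
    split_ifs with e
    · rw [e.1, e.2]
    · refine e1 ((Finset.mem_insert.1 h').resolve_left fun h2 => e ?_)
      exact (Prod.mk.inj h2).symm
  simp only [wp_bind, wp_store, wp_load, wp_input]
  have hsz := h.size w
  have hc : ∀ w', ((insert (u, w) R).filter fun e => e.2 = w').card =
    (R.filter fun e => e.2 = w').card + if w = w' then 1 else 0 := fun w' =>
      filter_insert_card he _
  rw [Function.update_of_ne (by simp), hsz]
  refine wp_ite (fun hlt => ?_) (fun hlt => ?_)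
  · simp only [wp_bind, wp_store, wp_incr]
    refine ⟨{ h with rkW := hrk, size := ?_, numFree := ?_, free := ?_ }, by omega⟩
    · intro w'
      simp only [Function.update_apply, reduceCtorEq, if_false, NumCell.size.injEq, h.size, hc]
      split_ifs with e1 e2 e2
      · subst e1; omega
      · exact absurd e1.symm e2
      · exact absurd e2.symm e1
      · rfl
    · intro w'
      simp only [Function.update_apply, reduceCtorEq, if_false, NumCell.numFree.injEq, h.numFree, hc]
      split_ifs with e1 e2 e2
      · subst e1; omega
      · exact absurd e1.symm e2
      · exact absurd e2.symm e1
      · rfl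
    · intro w' i
      have := h.free w' i
      simp only [Function.update_apply, reduceCtorEq, if_false, NumCell.size.injEq,
        NumCell.free.injEq]
      split_ifs with e1 e2 e2
      · intro; exact e2.2.symm
      · subst e1
        intro h2
        exact this (by rw [eq_self_iff_true, true_and] at e2; omega)
      · exact absurd e2.1 e1
      · exact this
  · rw [wp_pure]
    refine ⟨{ h with rkW := hrk, size := ?_, numFree := ?_ }, by dsimp only [Machine.later]; omega⟩
    · intro w'
      have := h.size w'
      simp only [Function.update_apply, reduceCtorEq, if_false, this, hc]
      split_ifs with e1
      · subst e1; omega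
      · rfl
    · intro w'
      have := h.numFree w'
      simp only [Function.update_apply, reduceCtorEq, if_false, this, hc]
      split_ifs with e1
      · subst e1; omega
      · rfl

end SetupInv

/-- The invariants of the nested loops say that the pairs entered so far are the edges not still to
come. An entry costs 7 or 8 units plus 3 for the loops. The constants 3 and 2 per agent come from
the ends of loops and, for the proposing side, from the stack. -/
theorem wp_setup (I : Instance) : wp (setup (I := I)) (fun _ s' =>
    (∃ F R, SetupInv s' F R (List.finRange I.nU) ∧ (∀ e, e ∈ F ↔ Edge I e.1 e.2) ∧
      ∀ e, e ∈ R ↔ Edge I e.1 e.2) ∧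
    s'.time ≤ ∑ u, (10 * (I.prefU u).flatten.length + 3) +
      ∑ w, (11 * (I.prefW w).flatten.length + 2) + 2) (Machine.blank I) := by
  simp only [setup]
  rw [wp_bind]
  refine wp_forEach (fun l s' => ∃ st F, st ++ l = List.finRange I.nU ∧ SetupInv s' F ∅ st ∧
    (∀ e, e ∈ F ↔ Edge I e.1 e.2 ∧ e.1 ∉ l) ∧
    s'.time + (l.map fun u => 10 * (I.prefU u).flatten.length + 3).sum ≤
      ∑ u, (10 * (I.prefU u).flatten.length + 3)) ?_ ?_ ?_
  · rintro u - l s1 ⟨st, F, h1, h2, h3, h4⟩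
    have hnd := List.nodup_finRange I.nU
    rw [← h1, List.nodup_append] at hnd
    have hul := (List.nodup_cons.1 hnd.2.1).1
    rw [wp_bind]
    refine wp_mono (wp_forTies (rankU I u) 7 (fun t s' => t.Nodup ∧ ∃ F', SetupInv s' F' ∅ st ∧
      ∀ e, e ∈ F' ↔ Edge I e.1 e.2 ∧ (e.1 ∉ u :: l ∨ e.1 = u ∧ e.2 ∉ t)) (fun _ => 0) ?_
      (fun _ _ => rfl) (I.tieU_ne u)
      (fun i hi a ha => by rw [zero_add]; exact rankU_of_mem hi ha) ?_
      ⟨I.nodupU u, F, h2.time _, ?_⟩) ?_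
    · rintro t s' n ⟨h5, F', h6, h7⟩
      exact ⟨h5, F', h6.time n, h7⟩
    · rintro w hw t s' ⟨h5, F', h6, h7⟩
      have hwt := (List.nodup_cons.1 h5).1
      refine wp_mono (h6.wp_enterU (u := u) (w := w) (by rw [h7]; simp)) ?_
      rintro _ s2 ⟨h8, h9⟩
      refine ⟨⟨h5.of_cons, _, h8, ?_⟩, by omega⟩
      rintro ⟨u', w'⟩
      rw [Finset.mem_insert, h7]
      dsimp only
      rw [Prod.mk.injEq, List.mem_cons (a := w')]
      constructor
      · rintro (⟨rfl, rfl⟩ | ⟨a1, a2 | a2⟩)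
        · exact ⟨hw, Or.inr ⟨rfl, hwt⟩⟩
        · exact ⟨a1, Or.inl a2⟩
        · exact ⟨a1, Or.inr ⟨a2.1, fun h => a2.2 (Or.inr h)⟩⟩
      · rintro ⟨a1, a2 | a2⟩
        · exact Or.inr ⟨a1, Or.inl a2⟩
        · by_cases e : w' = w
          · exact Or.inl ⟨a2.1, e⟩
          · exact Or.inr ⟨a1, Or.inr ⟨a2.1, fun h => h.elim e a2.2⟩⟩
    · intro e
      rw [h3]
      refine and_congr_right fun a1 => (or_iff_left ?_).symm
      rintro ⟨rfl, a2⟩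
      exact a2 a1
    · rintro _ s' ⟨⟨-, F', h5, h6⟩, h7⟩
      rw [wp_pushBackU]
      refine ⟨st ++ [u], F', by simpa using h1, h5.pushStack u _, ?_, ?_⟩
      · intro e
        rw [h6]
        refine and_congr_right fun a1 => ?_
        simp only [List.mem_cons, not_or, List.not_mem_nil, not_false_eq_true, and_true]
        constructor
        · rintro (a2 | a2)
          · exact a2.2
          · rw [a2]; exact hul
        · intro a2
          by_cases e' : e.1 = u
          · exact Or.inr e'
          · exact Or.inl ⟨e', a2⟩
      · simp only [List.map_cons, List.sum_cons] at h4
        dsimp only [Machine.later] at h7 ⊢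
        omega
  · rintro s1 ⟨st, F, h1, h2, h3, h4⟩
    rw [List.append_nil] at h1
    subst h1
    refine wp_forEach (fun l s' => l.Nodup ∧ ∃ R, SetupInv s' F R (List.finRange I.nU) ∧
      (∀ e, e ∈ R ↔ Edge I e.1 e.2 ∧ e.2 ∉ l) ∧
      s'.time + (l.map fun w => 11 * (I.prefW w).flatten.length + 2).sum ≤
        ∑ u, (10 * (I.prefU u).flatten.length + 3) +
          ∑ w, (11 * (I.prefW w).flatten.length + 2) + 1) ?_ ?_ ?_
    · rintro w - l s2 ⟨hnd, R, h5, h6, h7⟩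
      have hwl := (List.nodup_cons.1 hnd).1
      refine wp_mono (wp_forTies (rankW I w) 8 (fun t s' => t.Nodup ∧ ∃ R',
        SetupInv s' F R' (List.finRange I.nU) ∧
        ∀ e, e ∈ R' ↔ Edge I e.1 e.2 ∧ (e.2 ∉ w :: l ∨ e.2 = w ∧ e.1 ∉ t)) (fun _ => 0) ?_
        (fun _ _ => rfl) (I.tieW_ne w)
        (fun i hi a ha => by rw [zero_add]; exact rankW_of_mem hi ha) ?_
        ⟨I.nodupW w, R, h5.time _, ?_⟩) ?_
      · rintro t s' n ⟨h8, R', h9, h10⟩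
        exact ⟨h8, R', h9.time n, h10⟩
      · rintro u hu t s' ⟨h8, R', h9, h10⟩
        have hut := (List.nodup_cons.1 h8).1
        refine wp_mono (h9.wp_enterW (u := u) (w := w) (by rw [h10]; simp)) ?_
        rintro _ s3 ⟨h11, h12⟩
        refine ⟨⟨h8.of_cons, _, h11, ?_⟩, by omega⟩
        rintro ⟨u', w'⟩
        rw [Finset.mem_insert, h10]
        dsimp only
        rw [Prod.mk.injEq, List.mem_cons (a := u')]
        constructor
        · rintro (⟨rfl, rfl⟩ | ⟨a1, a2 | a2⟩)
          · exact ⟨edge_iff_mem_prefW.2 hu, Or.inr ⟨rfl, hut⟩⟩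
          · exact ⟨a1, Or.inl a2⟩
          · exact ⟨a1, Or.inr ⟨a2.1, fun h => a2.2 (Or.inr h)⟩⟩
        · rintro ⟨a1, a2 | a2⟩
          · exact Or.inr ⟨a1, Or.inl a2⟩
          · by_cases e : u' = u
            · exact Or.inl ⟨e, a2.1⟩
            · exact Or.inr ⟨a1, Or.inr ⟨a2.1, fun h => h.elim e a2.2⟩⟩
      · intro e
        rw [h6]
        refine and_congr_right fun a1 => (or_iff_left ?_).symm
        rintro ⟨rfl, a2⟩
        exact a2 (edge_iff_mem_prefW.1 a1)
      · rintro _ s' ⟨⟨-, R', h8, h9⟩, h10⟩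
        refine ⟨hnd.of_cons, R', h8, ?_, ?_⟩
        · intro e
          rw [h9]
          refine and_congr_right fun a1 => ?_
          simp only [List.mem_cons, not_or, List.not_mem_nil, not_false_eq_true, and_true]
          constructor
          · rintro (a2 | a2)
            · exact a2.2
            · rw [a2]; exact hwl
          · intro a2
            by_cases e' : e.2 = w
            · exact Or.inr e'
            · exact Or.inl ⟨e', a2⟩
        · simp only [List.map_cons, List.sum_cons] at h7
          dsimp only [Machine.later] at h10 ⊢
          omega
    · rintro s2 ⟨-, R, h5, h6, h7⟩
      refine ⟨⟨F, R, h5.time _, fun e => by simpa using h3 e, fun e => by simpa using h6 e⟩, ?_⟩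
      simp only [List.map_nil, List.sum_nil] at h7
      dsimp only [Machine.later]
      omega
    · refine ⟨List.nodup_finRange _, ∅, h2.time _, by simp, ?_⟩
      rw [← Fin.sum_univ_def]
      simp only [List.map_nil, List.sum_nil] at h4
      dsimp only [Machine.later]
      omega
  · refine ⟨[], ∅, by simp, SetupInv.blank, by simp, ?_⟩
    rw [← Fin.sum_univ_def]
    simp [Machine.blank]

end ASBM

namespace ASBM

variable {I : Instance} {s : Machine I} {G : Ghost I}

/-! ## Edges -/

variable (I) in
/-- The set of edges. -/
def edges : Finset (Fin I.nU × Fin I.nW) :=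
  Finset.univ.filter fun e => e.2 ∈ (I.prefU e.1).flatten

theorem mem_edges {e : Fin I.nU × Fin I.nW} : e ∈ edges I ↔ Edge I e.1 e.2 := by
  simp [edges, Edge]

theorem card_edges_filter_fst (u : Fin I.nU) :
    ((edges I).filter fun e => e.1 = u).card = (I.prefU u).flatten.length := by
  rw [← List.toFinset_card_of_nodup (I.nodupU u)]
  refine Finset.card_nbij' Prod.snd (Prod.mk u) ?_ ?_ ?_ ?_
  · rintro ⟨u', w⟩ h
    obtain ⟨h1, rfl⟩ := Finset.mem_filter.1 h
    exact List.mem_toFinset.2 (mem_edges.1 h1)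
  · intro w h
    exact Finset.mem_filter.2 ⟨mem_edges.2 (List.mem_toFinset.1 h), rfl⟩
  · rintro ⟨u', w⟩ h
    obtain ⟨h1, rfl⟩ := Finset.mem_filter.1 h
    rfl
  · intro w h
    rfl

theorem card_edges_filter_snd (w : Fin I.nW) :
    ((edges I).filter fun e => e.2 = w).card = (I.prefW w).flatten.length := by
  rw [← List.toFinset_card_of_nodup (I.nodupW w)]
  refine Finset.card_nbij' Prod.fst (fun u => (u, w)) ?_ ?_ ?_ ?_
  · rintro ⟨u, w'⟩ h
    obtain ⟨h1, rfl⟩ := Finset.mem_filter.1 h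
    simpa using edge_iff_mem_prefW.1 (mem_edges.1 h1)
  · intro u h
    exact Finset.mem_filter.2 ⟨mem_edges.2 (edge_iff_mem_prefW.2 (List.mem_toFinset.1 h)), rfl⟩
  · rintro ⟨u, w'⟩ h
    obtain ⟨h1, rfl⟩ := Finset.mem_filter.1 h
    rfl
  · intro u h
    rfl

theorem card_edges : (edges I).card = I.numEdges := by
  rw [Finset.card_eq_sum_card_fiberwise (f := Prod.fst) (t := Finset.univ) (by simp),
    Instance.numEdges]
  exact Finset.sum_congr rfl fun u _ => card_edges_filter_fst u

theorem sum_length_prefW : ∑ w, (I.prefW w).flatten.length = I.numEdges := by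
  rw [← card_edges, Finset.card_eq_sum_card_fiberwise (f := Prod.snd) (t := Finset.univ) (by simp)]
  exact Finset.sum_congr rfl fun w _ => (card_edges_filter_snd w).symm

theorem numEdges_swap (I : Instance) : I.swap.numEdges = I.numEdges := sum_length_prefW (I := I)

theorem nU_le_numEdges (hU : ∀ u, I.prefU u ≠ []) : I.nU ≤ I.numEdges := by
  have : ∑ _u : Fin I.nU, 1 ≤ I.numEdges := Finset.sum_le_sum fun u _ =>
    (List.length_pos_iff.2 (hU u)).trans_le (length_le_flatten (I.tieU_ne u))
  simpa using this

theorem nW_le_numEdges (hW : ∀ w, I.prefW w ≠ []) : I.nW ≤ I.numEdges := by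
  rw [← numEdges_swap]
  exact nU_le_numEdges (I := I.swap) hW

/-! ## The initial state -/

variable (I) in
/-- The contents of the memory after the setup. -/
def Ghost.initial : Ghost I where
  M := ∅
  F := edges I
  T := edges I
  L := fun u => (I.prefU u).flatten.toFinset
  ptr := fun _ => 0
  sat := fun _ => []
  stack := List.finRange I.nU
  again := fun _ => []
  second := fun _ => []

/-- At the beginning all edges are free and nobody is matched. So every order in the tie-lists is
admissible, and all leaves are unused. -/
theorem SetupInv.rep (h : SetupInv s (edges I) (edges I) (List.finRange I.nU)) :
    Rep s (Ghost.initial I) where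
  rkU u w he := h.rkU u w (mem_edges.2 he)
  rkW u w he := h.rkW u w (mem_edges.2 he)
  size w := by rw [h.size, card_edges_filter_snd]
  inM u w := by simp [h.inM, Ghost.initial]
  inL u w := by simp [h.inL, Ghost.initial, mem_edges, Edge]
  degU u := by simp [h.degU, Ghost.initial]
  degW w := by simp [h.degW, Ghost.initial]
  cnt := h.cnt
  tieCnt := h.tieCnt
  ptr := h.ptr
  tree w :=
    { inner := fun i _ _ => by simp [h.node]
      used := fun r hr => by simp [ranks, Ghost.initial] at hr
      unused := fun i hi => by
        rw [h.numFree, ← h.size] at hi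
        exact ⟨by rw [h.free w i hi]; exact hi, h.node _ _⟩
      inj := fun i hi j hj hij => by
        rw [h.numFree, ← h.size] at hi hj
        rwa [h.free w i hi, h.free w j hj] at hij
      cover := fun j hj => Or.inl ⟨j, by rwa [h.numFree, ← h.size], h.free w j hj⟩
      card := by simp [h.numFree, h.size, ranks, Ghost.initial] }
  queue_nodup w r := by simp [h.queue]
  mem_queue w r u := by simp [h.queue, Ghost.initial]
  queue_order w r := by simp [h.queue]
  sat := h.sat
  stack := h.stack
  tie_nodup := h.tie_nodup
  mem_tie := h.mem_tie
  tie_order u r := List.pairwise_iff_getElem.2 fun i j hi _ _ _ =>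
    ((h.mem_tie u r _).1 (List.getElem_mem hi)).1
  again := h.again
  second := h.second

theorem Inv.initial : Inv (Ghost.initial I) where
  mem_F u w := by simp [Ghost.initial, mem_edges, UnsatW, I.capW_pos]
  edge u w h := by simp [Ghost.initial] at h
  capW w := by simp [Ghost.initial]
  edgeL u w h := List.mem_toFinset.1 h
  mem_L u w h := List.mem_toFinset.2 (mem_edges.1 h)
  le_ptr u w h := by simp [Ghost.initial] at h
  sat_nodup w := List.nodup_nil
  mem_M u w h := by simp [Ghost.initial] at h
  mem_sat u w h := by simp [Ghost.initial] at h
  second u w h := by simp [Ghost.initial] at h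
  mem_T u w := by simp [Ghost.initial, mem_edges, Edge]
  ptr_le u w _ := Nat.zero_le _
  capU w := by simp [Ghost.initial]
  again u w h := by simp [Ghost.initial] at h
  done u _ := Or.inl (List.mem_finRange u)

/-- With `m` edges: `10 * m` from the lists `L` and the free pairs, and at most `m` each from the
stack and the pointers. The latter two use that no preference list and no tie is empty. -/
theorem weight_initial (hU : ∀ u, I.prefU u ≠ []) :
    weight (Ghost.initial I) ≤ 12 * I.numEdges := by
  have h1 : ∑ u, ((I.prefU u).flatten.toFinset).card = I.numEdges :=
    Finset.sum_congr rfl fun u _ => List.toFinset_card_of_nodup (I.nodupU u)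
  have h2 : ∑ u, (I.prefU u).length ≤ I.numEdges :=
    Finset.sum_le_sum fun u _ => length_le_flatten (I.tieU_ne u)
  have h3 := nU_le_numEdges hU
  have h4 : livePairs (edges I) ∅ = 0 := by simp [livePairs]
  simp only [weight, Ghost.initial, h1, h4, card_edges, List.length_nil, Finset.sum_const_zero,
    List.length_finRange, Nat.sub_zero]
  omega

/-- The terms with 7 and 12 contribute `19 * m`, and the summands 1 for the agents of the two sides
at most `2 * m`. -/
theorem credit_initial (hU : ∀ u, I.prefU u ≠ []) (hW : ∀ w, I.prefW w ≠ []) :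
    credit (Ghost.initial I) ≤ 21 * I.numEdges := by
  have h1 : liveSum (edges I) ≤ ∑ u, (7 * (I.prefU u).flatten.length + 1) :=
    Finset.sum_le_sum fun u _ => by split_ifs <;> omega
  have h2 : satSum (I := I) ∅ ≤ ∑ w, (12 * (I.prefW w).flatten.length + 1) :=
    Finset.sum_le_sum fun w _ => by split_ifs <;> omega
  have h3 := nU_le_numEdges hU
  have h4 := nW_le_numEdges hW
  rw [Finset.sum_add_distrib, ← Finset.mul_sum, ← Instance.numEdges] at h1
  rw [Finset.sum_add_distrib, ← Finset.mul_sum, sum_length_prefW] at h2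
  simp only [Finset.sum_const, Finset.card_univ, Fintype.card_fin, smul_eq_mul, mul_one] at h1 h2
  simp only [credit, Ghost.initial, List.length_nil, Finset.sum_const_zero]
  omega

theorem setup_spec (hU : ∀ u, I.prefU u ≠ []) (hW : ∀ w, I.prefW w ≠ []) :
    Rep (exec I 0) (Ghost.initial I) ∧ (exec I 0).time ≤ 26 * I.numEdges + 2 := by
  obtain ⟨⟨F, R, h1, h2, h3⟩, h4⟩ := wp_setup I
  obtain rfl : F = edges I := Finset.ext fun e => (h2 e).trans mem_edges.symm
  obtain rfl : R = edges I := Finset.ext fun e => (h3 e).trans mem_edges.symm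
  refine ⟨h1.rep, h4.trans ?_⟩
  have h3 := nU_le_numEdges hU
  have h4 := nW_le_numEdges hW
  simp only [Finset.sum_add_distrib, ← Finset.mul_sum, sum_length_prefW, Finset.sum_const,
    Finset.card_univ, Fintype.card_fin, smul_eq_mul]
  rw [← Instance.numEdges]
  omega

/-! ## The main loop -/

/-- With an empty stack, `done` says that every unsaturated agent has passed his last tie and has an
empty list `L'`. Anything left to propose to would lie in a tie-list at or after his pointer. -/
theorem Inv.terminal (h : Inv G) (hst : G.stack = []) : Terminal G.state := by
  intro u hu
  obtain ⟨h1, h2⟩ := (h.done u hu).resolve_left (by simp [hst])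
  refine ⟨fun w hw => ?_, h2⟩
  by_contra hM
  have h3 : w ∉ G.again u := fun h3 => by simpa [hst] using (h.again u w h3).2.1
  have h4 := h.ptr_le _ _ ((h.mem_T u w).2 ⟨hw, hM, h3⟩)
  have h5 := rankU_lt (h.edgeL _ _ hw)
  omega

/-- Induction on `weight`: it bounds the number of rounds, and the changes of `credit` telescope
along the run. -/
theorem exists_halted {ell : ℕ} (hell : ∀ w, Nat.log 2 (I.capW w) ≤ ell) (h : Rep s G)
    (hi : Inv G) : ∃ N, ((fun s => (round.run s).2)^[N] s).Halted ∧
      (∀ i < N, ((fun s => (round.run s).2)^[i + 1] s).state =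
          ((fun s => (round.run s).2)^[i] s).state ∨
        Step ((fun s => (round.run s).2)^[i] s).state
          ((fun s => (round.run s).2)^[i + 1] s).state) ∧
      Terminal ((fun s => (round.run s).2)^[N] s).state ∧
      ((fun s => (round.run s).2)^[N] s).time ≤
        s.time + credit G + (9 * ell + 105) * weight G := by
  generalize hn : weight G = n
  induction n using Nat.strong_induction_on generalizing s G with
  | _ n ih =>
    subst hn
    rcases hst : G.stack with _ | ⟨u, l⟩
    · refine ⟨0, h.stack.trans hst, by simp, ?_, ?_⟩
      · simpa [h.state_eq] using hi.terminal hst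
      · simp only [Function.iterate_zero, id_eq]
        omega
    · obtain ⟨G', h1, h2, h3, h4, h5⟩ := wp_round h hi hst hell
      obtain ⟨N, a1, a2, a3, a4⟩ := ih _ h4 h1 h2 rfl
      refine ⟨N + 1, a1, fun i hi => ?_, a3, a4.trans ?_⟩
      · rcases i with _ | i
        · simp only [zero_add, Function.iterate_one, Function.iterate_zero, id_eq]
          rw [h.state_eq]
          rw [h1.state_eq]
          exact h3
        · exact a2 i (by omega)
      · have := Nat.mul_le_mul_left (9 * ell + 105) h4
        rw [Nat.mul_add, mul_one] at this
        omega

/-! ## The choice of the roles -/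

theorem scanMax_eq (l : List ℕ) : scanMax l = (l.foldr max 0, l.length + 1) := by
  have : ∀ (l : List ℕ) (x : ℕ × ℕ), l.foldl (fun x n => (max x.1 n, x.2 + 1)) x =
      (max x.1 (l.foldr max 0), x.2 + l.length) := by
    intro l
    induction l with
    | nil => simp
    | cons a l ih =>
      intro x
      rw [List.foldl_cons, ih, List.foldr_cons, List.length_cons]
      exact Prod.ext (max_assoc _ _ _) (by dsimp only; omega)
  rw [scanMax, this]
  exact Prod.ext (by simp) (by dsimp only; omega)

theorem scanMax_map_finRange {n : ℕ} (f : Fin n → ℕ) :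
    scanMax ((List.finRange n).map f) = (Finset.univ.sup f, n + 1) := by
  rw [scanMax_eq]
  refine Prod.ext ?_ (by simp)
  dsimp only
  refine le_antisymm ?_ (Finset.sup_le fun i _ => ?_)
  · have : ∀ l : List (Fin n), (l.map f).foldr max 0 ≤ Finset.univ.sup f := by
      intro l
      induction l with
      | nil => simp
      | cons a l ih => exact max_le (Finset.le_sup (Finset.mem_univ a)) ih
    exact this _
  · have : ∀ l : List (Fin n), i ∈ l → f i ≤ (l.map f).foldr max 0 := by
      intro l hl
      induction l with
      | nil => simp at hl
      | cons a l ih =>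
        rcases List.mem_cons.1 hl with rfl | hl
        · exact le_max_left _ _
        · exact (ih hl).trans (le_max_right _ _)
    exact this _ (List.mem_finRange i)

theorem chooseRoles_eq (I : Instance) : I.chooseRoles =
    (if Finset.univ.sup I.capU < Finset.univ.sup I.capW then I.swap else I,
      I.nU + I.nW + 3) := by
  rw [Instance.chooseRoles, scanMax_map_finRange, scanMax_map_finRange]
  exact Prod.ext rfl (by dsimp only; omega)

/-- The constants: `1307 = 26 + 21 + 105 * 12` from the setup, the initial credit and the rounds,
and `108 = 9 * 12` from the tree updates. -/
theorem exists_run (hU : ∀ u, I.prefU u ≠ []) (hW : ∀ w, I.prefW w ≠ []) {c : ℕ}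
    (hc : ∀ w, I.capW w ≤ c) : ∃ N, (exec I N).Halted ∧
      (exec I 0).state = State.initial I ∧
      (∀ i < N, (exec I (i + 1)).state = (exec I i).state ∨
        Step (exec I i).state (exec I (i + 1)).state) ∧
      Terminal (exec I N).state ∧
      (exec I N).time ≤ (1307 + 108 * Nat.log 2 c) * I.numEdges + 2 := by
  obtain ⟨h1, h2⟩ := setup_spec hU hW
  obtain ⟨N, a1, a2, a3, a4⟩ :=
    exists_halted (fun w => Nat.log_mono_right (hc w)) h1 Inv.initial
  refine ⟨N, a1, h1.state_eq, a2, a3, a4.trans ?_⟩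
  have e1 := Nat.mul_le_mul_left (9 * Nat.log 2 c + 105) (weight_initial hU)
  have e2 := credit_initial hU hW
  calc _ ≤ 26 * I.numEdges + 2 + 21 * I.numEdges +
        (9 * Nat.log 2 c + 105) * (12 * I.numEdges) := by omega
    _ = _ := by ring

end ASBM

/-! ### The running time of the implementation -/

theorem theorem2 :
    ∃ C : ℝ, ∀ I : ASBM.Instance,
      (∀ u, I.prefU u ≠ []) → (∀ w, I.prefW w ≠ []) → 0 < I.numEdges →
      ∃ N : ℕ,
        -- the main loop ends after `N` rounds
        (ASBM.exec I.chooseRoles.1 N).Halted ∧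
        -- and what has been executed is a complete run of Algorithm ASBM
        (ASBM.exec I.chooseRoles.1 0).state = ASBM.State.initial I.chooseRoles.1 ∧
        (∀ i < N,
          (ASBM.exec I.chooseRoles.1 (i + 1)).state = (ASBM.exec I.chooseRoles.1 i).state ∨
          ASBM.Step (ASBM.exec I.chooseRoles.1 i).state
            (ASBM.exec I.chooseRoles.1 (i + 1)).state) ∧
        ASBM.Terminal (ASBM.exec I.chooseRoles.1 N).state ∧
        -- within the claimed time
        (I.totalTime N : ℝ) ≤ C * I.numEdges * max 1 (Real.log I.minMaxCap) ∧
        -- in particular in linear time for Hospitals-Residents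
        (((∀ u, I.capU u = 1) ∨ (∀ w, I.capW w = 1)) →
          (I.totalTime N : ℝ) ≤ C * I.numEdges) := by
  -- The constant is `1314 + 2 * 108`, where the factor 2 comes from the change to the natural
  -- logarithm.
  refine ⟨1530, fun I hU hW hm => ?_⟩
  -- In either case the receiving side is the one whose maximum capacity is the minimum of the two.
  have hroles : (∀ u, I.chooseRoles.1.prefU u ≠ []) ∧ (∀ w, I.chooseRoles.1.prefW w ≠ []) ∧
      I.chooseRoles.1.numEdges = I.numEdges ∧ ∀ w, I.chooseRoles.1.capW w ≤ I.minMaxCap := by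
    have hr : I.chooseRoles.1 = _ := congrArg Prod.fst (ASBM.chooseRoles_eq I)
    by_cases h : Finset.univ.sup I.capU < Finset.univ.sup I.capW
    · rw [hr, if_pos h]
      refine ⟨hW, hU, ASBM.numEdges_swap I, fun u => ?_⟩
      have h1 : I.capU u ≤ Finset.univ.sup I.capU := Finset.le_sup (Finset.mem_univ u)
      exact le_min h1 (h1.trans h.le)
    · rw [hr, if_neg h]
      refine ⟨hU, hW, rfl, fun w => ?_⟩
      have h1 : I.capW w ≤ Finset.univ.sup I.capW := Finset.le_sup (Finset.mem_univ w)
      exact le_min (h1.trans (not_lt.1 h)) h1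
  obtain ⟨hU', hW', hm', hc⟩ := hroles
  obtain ⟨N, h1, h2, h3, h4, h5⟩ := ASBM.exists_run hU' hW' hc
  -- The additive terms, `nU + nW + 3` for choosing the roles and 2 from the setup, are at most 7
  -- times the number of edges, since there is an edge and no agent is isolated.
  have htime : I.totalTime N ≤ (1314 + 108 * Nat.log 2 I.minMaxCap) * I.numEdges := by
    have e1 := ASBM.nU_le_numEdges hU
    have e2 := ASBM.nW_le_numEdges hW
    have e3 : I.chooseRoles.2 = I.nU + I.nW + 3 := by rw [ASBM.chooseRoles_eq]
    rw [hm', add_mul] at h5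
    rw [ASBM.Instance.totalTime, e3, add_mul]
    omega
  -- Passing from base 2 to the natural logarithm divides by `Real.log 2`, which exceeds `1 / 2`.
  have hlog : (Nat.log 2 I.minMaxCap : ℝ) ≤ 2 * max 1 (Real.log I.minMaxCap) := by
    have e1 : (Nat.log 2 I.minMaxCap : ℝ) ≤ Real.logb 2 I.minMaxCap :=
      Real.natLog_le_logb _ _
    have e2 : (1 : ℝ) / 2 < Real.log 2 := by linarith [Real.log_two_gt_d9]
    refine e1.trans ?_
    rw [Real.logb, div_le_iff₀ (by linarith)]
    have e3 := le_max_left 1 (Real.log I.minMaxCap)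
    have e4 := le_max_right 1 (Real.log I.minMaxCap)
    nlinarith
  have hmain : (I.totalTime N : ℝ) ≤ 1530 * I.numEdges * max 1 (Real.log I.minMaxCap) := by
    have e1 : (I.totalTime N : ℝ) ≤ (1314 + 108 * Nat.log 2 I.minMaxCap) * I.numEdges := by
      exact_mod_cast htime
    have e2 := le_max_left 1 (Real.log I.minMaxCap)
    have e3 : (0 : ℝ) ≤ I.numEdges := Nat.cast_nonneg _
    calc (I.totalTime N : ℝ) ≤ (1314 + 108 * Nat.log 2 I.minMaxCap) * I.numEdges := e1
      _ ≤ (1530 * max 1 (Real.log I.minMaxCap)) * I.numEdges := by gcongr; linarith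
      _ = _ := by ring
  refine ⟨N, h1, h2, h3, h4, hmain, fun hone => ?_⟩
  -- With unit capacities on one side the logarithm is not positive, so the maximum in the general
  -- bound is 1.
  have hle : I.minMaxCap ≤ 1 := by
    rcases hone with h | h
    · exact (min_le_left _ _).trans (Finset.sup_le fun u _ => (h u).le)
    · exact (min_le_right _ _).trans (Finset.sup_le fun w _ => (h w).le)
  have hlog1 : max 1 (Real.log I.minMaxCap) = 1 :=
    max_eq_left ((Real.log_nonpos (Nat.cast_nonneg _) (by exact_mod_cast hle)).trans zero_le_one)
  rwa [hlog1, mul_one] at hmain
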